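/- Let $G=SU(2,2)$ be the group of complex $4\times4$ matrices of determinant one preserving the Hermitian form $\mathrm{diag}(1,1,-1,-1)$, and let $K=S(U(2)\times U(2))$, so that $(\mathfrak g_0,\mathfrak k_0)=(\mathfrak{su}(2,2),\,\mathfrak u(2)+\mathfrak u(2))$ (with trace zero in $\mathfrak k_0$). Let $\mathfrak g=\mathfrak p^-+\mathfrak k+\mathfrak p^+$ be the Harish-Chandra decomposition of the complexified Lie algebra, with $\mathfrak p^+$ the upper right and $\mathfrak p^-$ the lower left $2\times2$ blocks. For $j=1,2$ let $e_j^+\in\mathfrak p^+$ be the matrix unit with entry $1$ at position $(j,j+2)$, let $e_j^-$ be its transpose, let $\gamma_j$ be the root of $e_j^+$ with respect to the diagonal Cartan subalgebra, let $\mathfrak a$ be spanned by $e_j=e_j^++e_j^-$ $(j=1,2)$, and let $\varepsilon_1,\varepsilon_2$ be the basis of $\mathfrak a^*$ dual to $e_1,e_2$. The half sum of the positive restricted roots $\varepsilon_1\pm\varepsilon_2$ (multiplicity $2$) and $2\varepsilon_1,2\varepsilon_2$ (multiplicity $1$) is $2\rho_1\varepsilon_1+2\rho_2\varepsilon_2$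 with $\rho=(\rho_1,\rho_2)=(\tfrac32,\tfrac12)$. Identify $x\in\mathbb C^2$ with $2x_1\varepsilon_1+2x_2\varepsilon_2\in\mathfrak a^*$, and let $$\Phi_x(g)=\int_K e^{(x+\rho)(A(kg))}\,dk$$ be the spherical function with parameter $x$, where $dk$ is normalized Haar measure and $g\in N\exp(A(g))K$ is the Iwasawa decomposition. For integers $\lambda_1\ge\lambda_2\ge0$ put $|\lambda|=\lambda_1+\lambda_2$, let $W_\lambda$ be the irreducible $K$-submodule of $S(\mathfrak p^+)$ of highest weight $\lambda_1\gamma_1+\lambda_2\gamma_2$, and let $\mathcal L_\lambda=\sum_\alpha\xi_\alpha^*\xi_\alpha$ be the Shimura operator, where $\{\xi_\alpha\}$ is an orthonormal basis of $W_\lambda$ for the Fock inner product, $\xi\mapsto\xi^*$ is the conjugation $S(\mathfrak p^+)\to S(\mathfrak p^-)$ with respect to the real form $\mathfrak p_0$ of $\mathfrak p=\mathfrak p^++\mathfrak p^-$, and elements of $\mathfrak g$ act on functions on $G$ as (complexified) left invariant vector fields. Let $\mathcal A$ be the set of all $x\in\mathbb C^2$ such that, for every such $\lambda$, $\Phi_x$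 is an eigenfunction of $(-1)^{|\lambda|}\mathcal L_\lambda$ with real nonnegative eigenvalue, and let $\mathcal A_0=\mathcal A\cap\mathcal C$, where $\mathcal C=\{x\in\mathbb R^2: x_1\ge x_2\ge0\}$. Then $\mathcal A_0=T_1\cup T_2$ is the union of the two triangles $$T_1=[0,\rho_2]^2\cap\mathcal C,\qquad T_2=\{(x_1,x_2): x_1\ge x_2\ge\rho_2,\ x_1+x_2\le\rho_1+\rho_2=2\}.$$ -/

import Mathlib

namespace Shimura

noncomputable section

open scoped Matrix BigOperators ComplexConjugate Nat
open MeasureTheory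

/-! ### The group `SU(2,2)` and its maximal compact subgroup -/

/-- Index set of `ℂ⁴ = ℂ² ⊕ ℂ²`. -/
abbrev Idx := Fin 2 ⊕ Fin 2

/-- Complex `4 × 4` matrices, written in `2 × 2` blocks. -/
abbrev Mat := Matrix Idx Idx ℂ

/-- The Hermitian form of signature `(2,2)`. -/
def J : Mat := Matrix.fromBlocks 1 0 0 (-1)

/-- `G = SU(2,2)`. -/
def G : Subgroup (Matrix.SpecialLinearGroup Idx ℂ) where
  carrier := {g | (g : Mat)ᴴ * J * (g : Mat) = J}
  one_mem' := by simp
  mul_mem' := by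
    intro a b ha hb
    simp only [Set.mem_ofPred_eq, Matrix.SpecialLinearGroup.coe_mul,
      Matrix.conjTranspose_mul] at *
    calc (b : Mat)ᴴ * (a : Mat)ᴴ * J * ((a : Mat) * (b : Mat))
        = (b : Mat)ᴴ * ((a : Mat)ᴴ * J * (a : Mat)) * (b : Mat) := by
          simp only [Matrix.mul_assoc]
      _ = J := by rw [ha, hb]
  inv_mem' := by
    intro a ha
    simp only [Set.mem_ofPred_eq] at *
    have h1 : (a : Mat) * ((a⁻¹ : Matrix.SpecialLinearGroup Idx ℂ) : Mat) = 1 := by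
      rw [← Matrix.SpecialLinearGroup.coe_mul, mul_inv_cancel,
        Matrix.SpecialLinearGroup.coe_one]
    set b : Mat := ((a⁻¹ : Matrix.SpecialLinearGroup Idx ℂ) : Mat) with hb
    have h2 : bᴴ * (a : Mat)ᴴ = 1 := by
      rw [← Matrix.conjTranspose_mul, h1, Matrix.conjTranspose_one]
    calc bᴴ * J * b = bᴴ * ((a : Mat)ᴴ * J * (a : Mat)) * b := by rw [ha]
      _ = (bᴴ * (a : Mat)ᴴ) * J * ((a : Mat) * b) := by simp only [Matrix.mul_assoc]
      _ = J := by rw [h1, h2]; simp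

/-- The subgroup of unitary matrices of determinant one, `SU(4)`. -/
def SU4 : Subgroup (Matrix.SpecialLinearGroup Idx ℂ) where
  carrier := {g | (g : Mat)ᴴ * (g : Mat) = 1}
  one_mem' := by simp
  mul_mem' := by
    intro a b ha hb
    simp only [Set.mem_ofPred_eq, Matrix.SpecialLinearGroup.coe_mul,
      Matrix.conjTranspose_mul] at *
    calc (b : Mat)ᴴ * (a : Mat)ᴴ * ((a : Mat) * (b : Mat))
        = (b : Mat)ᴴ * ((a : Mat)ᴴ * (a : Mat)) * (b : Mat) := by
          simp only [Matrix.mul_assoc]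
      _ = 1 := by rw [ha, Matrix.mul_one, hb]
  inv_mem' := by
    intro a ha
    simp only [Set.mem_ofPred_eq] at *
    have h1 : (a : Mat) * ((a⁻¹ : Matrix.SpecialLinearGroup Idx ℂ) : Mat) = 1 := by
      rw [← Matrix.SpecialLinearGroup.coe_mul, mul_inv_cancel,
        Matrix.SpecialLinearGroup.coe_one]
    set b : Mat := ((a⁻¹ : Matrix.SpecialLinearGroup Idx ℂ) : Mat) with hb
    have h2 : bᴴ * (a : Mat)ᴴ = 1 := by
      rw [← Matrix.conjTranspose_mul, h1, Matrix.conjTranspose_one]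
    calc bᴴ * b = bᴴ * ((a : Mat)ᴴ * (a : Mat)) * b := by rw [ha, Matrix.mul_one]
      _ = (bᴴ * (a : Mat)ᴴ) * ((a : Mat) * b) := by simp only [Matrix.mul_assoc]
      _ = 1 := by rw [h1, h2, Matrix.mul_one]

/-- `K = G ∩ SU(4) = S(U(2) × U(2))`, with Lie algebra `𝔲(2) + 𝔲(2)` (trace zero). -/
def K : Subgroup (Matrix.SpecialLinearGroup Idx ℂ) := G ⊓ SU4

/-- The underlying matrix of an element of `K`. -/
def K.mat (k : K) : Mat := ((k : Matrix.SpecialLinearGroup Idx ℂ) : Mat)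

instance : CompactSpace K := by
  have hc : IsCompact (Set.pi Set.univ fun _ : Idx => Set.pi Set.univ fun _ : Idx =>
      Metric.closedBall (0 : ℂ) 1) :=
    isCompact_univ_pi fun _ => isCompact_univ_pi fun _ => isCompact_closedBall _ _
  let f : K → (Idx → Idx → ℂ) := fun k i j => K.mat k i j
  have hcont : Continuous fun k : K => K.mat k :=
    continuous_subtype_val.comp continuous_subtype_val
  have hind : Topology.IsInducing f :=
    Topology.IsInducing.subtypeVal.comp Topology.IsInducing.subtypeVal
  have hrange : Set.range f =
      {A : Idx → Idx → ℂ | ((Matrix.of A).det = 1 ∧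
        (Matrix.of A)ᴴ * J * Matrix.of A = J) ∧ (Matrix.of A)ᴴ * Matrix.of A = 1} := by
    ext A
    constructor
    · rintro ⟨k, rfl⟩
      exact ⟨⟨k.1.2, k.2.1⟩, k.2.2⟩
    · rintro ⟨⟨h1, h2⟩, h3⟩
      exact ⟨⟨⟨Matrix.of A, h1⟩, h2, h3⟩, rfl⟩
  have hclosed : IsClosed (Set.range f) := by
    rw [hrange]
    have hid : Continuous fun A : Idx → Idx → ℂ => (Matrix.of A : Mat) := continuous_id
    refine IsClosed.and (IsClosed.and ?_ ?_) ?_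
    · exact isClosed_eq hid.matrix_det continuous_const
    · exact isClosed_eq ((hid.matrix_conjTranspose.matrix_mul continuous_const).matrix_mul hid)
        continuous_const
    · exact isClosed_eq (hid.matrix_conjTranspose.matrix_mul hid) continuous_const
  have hsub : Set.range f ⊆ Set.pi Set.univ fun _ : Idx => Set.pi Set.univ fun _ : Idx =>
      Metric.closedBall (0 : ℂ) 1 := by
    rintro _ ⟨k, rfl⟩ i _ j _
    rw [mem_closedBall_zero_iff]
    exact entry_norm_bound_of_unitary (Matrix.mem_unitaryGroup_iff'.2 k.2.2) i j
  have hcomp : IsCompact (Set.range f) := hc.of_isClosed_subset hclosed hsub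
  rw [← isCompact_univ_iff, hind.isCompact_iff, Set.image_univ]
  exact hcomp

instance : MeasurableSpace K := borel K

instance : BorelSpace K := ⟨rfl⟩

/-- The normalized Haar measure of the compact group `K`. -/
def haarK : Measure K := Measure.haarMeasure ⊤

/-! ### Iwasawa projection and spherical functions

`𝔞` is spanned by `e_j = e_j⁺ + e_j⁻` (`j = 1, 2`), where `e_j⁺` is the matrix unit in position
`(inl j, inr j)` and `e_j⁻` is its transpose. Positive restricted roots, with respect to the dual
basis `ε₁, ε₂`: `ε₁ ± ε₂` (multiplicity `2`) and `2ε₁, 2ε₂` (multiplicity `1`). -/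

/-- The element `t₁ e₁ + t₂ e₂` of `𝔞`. -/
def aElt (t : Fin 2 → ℝ) : Mat :=
  Matrix.fromBlocks 0 (Matrix.diagonal fun j => (t j : ℂ)) (Matrix.diagonal fun j => (t j : ℂ)) 0

/-- Columns `v₁, v₂` : the joint eigenvectors of `𝔞` with weights `ε₁, ε₂`. They span a maximal
isotropic subspace. -/
def V : Matrix Idx (Fin 2) ℂ := Matrix.fromRows 1 1

/-- `n ∈ N`: `n` lies in `G`, fixes `v₁` and maps `v₂` to `v₂ + c v₁`. -/
def IsN (n : Matrix.SpecialLinearGroup Idx ℂ) : Prop :=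
  n ∈ G ∧ ∃ c : ℂ, (n : Mat) * V = V * !![1, c; 0, 1]

/-- Normalized Gram matrix of `g⁻¹ v₁, g⁻¹ v₂`. -/
def gram (g : Mat) : Matrix (Fin 2) (Fin 2) ℂ :=
  (1 / 2 : ℂ) • (Vᴴ * (g * gᴴ)⁻¹ * V)

/-- Coordinates of the Iwasawa projection `A(g) ∈ 𝔞`, `g ∈ N exp(A(g)) K`
(see `iwasawaA_eq`). -/
def iwasawaA (g : Mat) : Fin 2 → ℝ :=
  ![-(1 / 2) * Real.log (gram g 0 0).re,
    -(1 / 2) * (Real.log (gram g).det.re - Real.log (gram g 0 0).re)]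

/-- The formula for `A(g)` is the Iwasawa projection for `G = N exp(𝔞) K`. -/
lemma iwasawaA_eq (n : Matrix.SpecialLinearGroup Idx ℂ) (hn : IsN n) (t : Fin 2 → ℝ) (k : K) :
    iwasawaA ((n : Mat) * NormedSpace.exp (aElt t) * K.mat k) = t := by
  obtain ⟨-, c, hc⟩ := hn
  -- the matrix `exp(aElt t)` acts diagonally on the columns of `V`
  have hV : NormedSpace.exp (-aElt t) * V =
      V * Matrix.diagonal fun j => ((Real.exp (-t j) : ℝ) : ℂ) := by
    let U : Mat := Matrix.fromBlocks 1 1 1 (-1)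
    let D : Idx → ℂ := Sum.elim (fun j => -(t j : ℂ)) (fun j => (t j : ℂ))
    have hUU : U * ((1 / 2 : ℂ) • U) = 1 := by
      rw [Matrix.mul_smul, Matrix.fromBlocks_multiply]
      ext i j
      rcases i with i | i <;> rcases j with j | j <;>
        fin_cases i <;> fin_cases j <;> simp <;> norm_num
    have hU : IsUnit U := IsUnit.of_mul_eq_one _ hUU
    have hD : -aElt t = U * Matrix.diagonal D * U⁻¹ := by
      have h : (-aElt t) * U = U * Matrix.diagonal D := by
        ext i j
        rcases i with i | i <;> rcases j with j | j <;>
          fin_cases i <;> fin_cases j <;>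
            simp [U, D, aElt, Matrix.mul_apply, Matrix.fromBlocks, Matrix.diagonal,
              Matrix.neg_apply]
      rw [← h, Matrix.mul_assoc, Matrix.mul_nonsing_inv _ ((Matrix.isUnit_iff_isUnit_det U).1 hU),
        Matrix.mul_one]
    let B : Matrix Idx (Fin 2) ℂ := Matrix.fromRows 1 0
    have hVU : V = U * B := by
      rw [Matrix.fromBlocks_mul_fromRows]
      simp [V]
    rw [hD, Matrix.exp_conj _ _ hU, Matrix.exp_diagonal, hVU, Matrix.mul_assoc (U * _),
      ← Matrix.mul_assoc U⁻¹, Matrix.nonsing_inv_mul _ ((Matrix.isUnit_iff_isUnit_det U).1 hU),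
      Matrix.one_mul, Matrix.mul_assoc, Matrix.mul_assoc]
    congr 1
    ext i j
    rcases i with i | i <;> fin_cases i <;> fin_cases j <;>
      simp [B, D, Matrix.mul_apply, Matrix.diagonal, Complex.exp_eq_exp_ℂ]
  set E := NormedSpace.exp (aElt t) with hE
  set E' := NormedSpace.exp (-aElt t) with hE'
  have hEE : E * E' = 1 := by
    have h := Matrix.isUnit_exp (aElt t)
    rw [hE', Matrix.exp_neg,
      Matrix.mul_nonsing_inv _ ((Matrix.isUnit_iff_isUnit_det _).1 h)]
  set n' : Mat := ((n⁻¹ : Matrix.SpecialLinearGroup Idx ℂ) : Mat)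
  have hnn : (n : Mat) * n' = 1 := by
    rw [← Matrix.SpecialLinearGroup.coe_mul, mul_inv_cancel, Matrix.SpecialLinearGroup.coe_one]
  have hnn' : n' * (n : Mat) = 1 := by
    rw [← Matrix.SpecialLinearGroup.coe_mul, inv_mul_cancel, Matrix.SpecialLinearGroup.coe_one]
  have hkk : K.mat k * (K.mat k)ᴴ = 1 := mul_eq_one_comm.1 k.2.2
  have hn'V : n' * V = V * !![1, -c; 0, 1] := by
    have h1 : V = (n : Mat) * V * !![1, -c; 0, 1] := by
      rw [hc, Matrix.mul_assoc]
      have : (!![1, c; 0, 1] : Matrix (Fin 2) (Fin 2) ℂ) * !![1, -c; 0, 1] = 1 := by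
        ext i j
        fin_cases i <;> fin_cases j <;> simp [Matrix.mul_apply, Fin.sum_univ_two]
      rw [this, Matrix.mul_one]
    calc n' * V = n' * ((n : Mat) * V * !![1, -c; 0, 1]) := by rw [← h1]
      _ = (n' * (n : Mat)) * V * !![1, -c; 0, 1] := by simp only [Matrix.mul_assoc]
      _ = _ := by rw [hnn', Matrix.one_mul]
  set d : Matrix (Fin 2) (Fin 2) ℂ := Matrix.diagonal fun j => ((Real.exp (-t j) : ℝ) : ℂ)
  have hh : (E' * n') * V = V * (d * !![1, -c; 0, 1]) := by
    rw [Matrix.mul_assoc, hn'V, ← Matrix.mul_assoc, hV, Matrix.mul_assoc]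
  have hinv : ((n : Mat) * E * K.mat k * ((n : Mat) * E * K.mat k)ᴴ)⁻¹ =
      (E' * n')ᴴ * (E' * n') := by
    apply Matrix.inv_eq_right_inv
    have h1 : ((n : Mat) * E) * (E' * n') = 1 := by
      rw [Matrix.mul_assoc, ← Matrix.mul_assoc E, hEE, Matrix.one_mul, hnn]
    have h2 : ((n : Mat) * E)ᴴ * (E' * n')ᴴ = 1 := by
      rw [← Matrix.conjTranspose_mul, mul_eq_one_comm.1 h1, Matrix.conjTranspose_one]
    rw [Matrix.conjTranspose_mul ((n : Mat) * E)]
    calc (n : Mat) * E * K.mat k * ((K.mat k)ᴴ * ((n : Mat) * E)ᴴ) * ((E' * n')ᴴ * (E' * n'))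
        = (n : Mat) * E * (K.mat k * (K.mat k)ᴴ) * (((n : Mat) * E)ᴴ * (E' * n')ᴴ) *
            (E' * n') := by simp only [Matrix.mul_assoc]
      _ = 1 := by rw [hkk, h2, Matrix.mul_one, Matrix.mul_one, h1]
  have hg : gram ((n : Mat) * E * K.mat k) =
      (d * !![1, -c; 0, 1])ᴴ * (d * !![1, -c; 0, 1]) := by
    have hVV : Vᴴ * V = (2 : ℂ) • (1 : Matrix (Fin 2) (Fin 2) ℂ) := by
      ext i j
      fin_cases i <;> fin_cases j <;>
        simp [V, Matrix.mul_apply, Matrix.one_apply] <;> norm_num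
    unfold gram
    rw [hinv]
    calc (1 / 2 : ℂ) • (Vᴴ * ((E' * n')ᴴ * (E' * n')) * V)
        = (1 / 2 : ℂ) • (((E' * n') * V)ᴴ * ((E' * n') * V)) := by
          rw [Matrix.conjTranspose_mul (E' * n') V]
          simp only [Matrix.mul_assoc]
      _ = (1 / 2 : ℂ) • ((d * !![1, -c; 0, 1])ᴴ * (Vᴴ * V) * (d * !![1, -c; 0, 1])) := by
          rw [hh, Matrix.conjTranspose_mul V]
          simp only [Matrix.mul_assoc]
      _ = _ := by
          rw [hVV, Matrix.mul_smul, Matrix.smul_mul, smul_smul, Matrix.mul_one]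
          norm_num
  have h00 : (gram ((n : Mat) * E * K.mat k) 0 0).re = Real.exp (-(2 * t 0)) := by
    rw [hg]
    have : (Real.exp (-(2 * t 0)) : ℂ) = Real.exp (-t 0) * Real.exp (-t 0) := by
      rw [← Complex.ofReal_mul, ← Real.exp_add]
      congr 2
      ring
    have h : ((d * !![1, -c; 0, 1])ᴴ * (d * !![1, -c; 0, 1])) 0 0 =
        (Real.exp (-(2 * t 0)) : ℂ) := by
      rw [this]
      simp [d, Matrix.mul_apply, Fin.sum_univ_two, Matrix.diagonal, -Complex.ofReal_exp]
    rw [h, Complex.ofReal_re]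
  have hdet : (gram ((n : Mat) * E * K.mat k)).det.re = Real.exp (-(2 * (t 0 + t 1))) := by
    rw [hg, Matrix.det_mul, Matrix.det_conjTranspose, Matrix.det_mul]
    have h1 : d.det = (Real.exp (-(t 0 + t 1)) : ℂ) := by
      rw [Matrix.det_diagonal, Fin.prod_univ_two, ← Complex.ofReal_mul, ← Real.exp_add]
      congr 2
      ring
    have h2 : (!![1, -c; 0, 1] : Matrix (Fin 2) (Fin 2) ℂ).det = 1 := by
      simp [Matrix.det_fin_two]
    rw [h1, h2, mul_one, RCLike.star_def, Complex.conj_ofReal, ← Complex.ofReal_mul,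
      Complex.ofReal_re, ← Real.exp_add]
    congr 1
    ring
  funext i
  unfold iwasawaA
  rw [h00, hdet, Real.log_exp, Real.log_exp]
  fin_cases i <;> simp <;> ring

/-- The half sum of positive roots is `2ρ₁ε₁ + 2ρ₂ε₂ = 3ε₁ + ε₂`. -/
def rho : Fin 2 → ℝ := ![3 / 2, 1 / 2]

/-- The spherical function `Φ_x(g) = ∫_K exp((x + ρ)(A(kg))) dk` with parameter
`x = x₁(2ε₁) + x₂(2ε₂) ∈ 𝔞*`, `x ∈ ℂ²`. -/
def Phi (x : Fin 2 → ℂ) (g : Mat) : ℂ :=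
  ∫ k : K, Complex.exp (∑ i, 2 * (x i + rho i) * iwasawaA (K.mat k * g) i) ∂haarK

/-! ### Invariant differential operators

A function on `G` is given by a function on matrices, of which only the values on `G` matter. -/

/-- Conjugation of `𝔰𝔩(4,ℂ)` with respect to the real form `𝔰𝔲(2,2)`. -/
def sigma (Z : Mat) : Mat := -(J * Zᴴ * J)

/-- The left invariant vector field of `A ∈ 𝔰𝔲(2,2)`: `(A f)(g) = d/dt f(g exp(tA))` at `0`. -/
def realField (A : Mat) (f : Mat → ℂ) (g : Mat) : ℂ :=
  deriv (fun t : ℝ => f (g * NormedSpace.exp ((t : ℂ) • A))) 0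

/-- The action of `Z ∈ 𝔰𝔩(4,ℂ)`, by complex linearity: `Z = A + iB` with
`A = (Z + σZ)/2` and `B = (Z - σZ)/(2i)` in `𝔰𝔲(2,2)`. -/
def field (Z : Mat) (f : Mat → ℂ) (g : Mat) : ℂ :=
  realField ((1 / 2 : ℂ) • (Z + sigma Z)) f g +
    Complex.I * realField ((1 / (2 * Complex.I) : ℂ) • (Z - sigma Z)) f g

/-- Matrix units spanning `𝔭⁺`. -/
def pPlus (i j : Fin 2) : Mat := Matrix.single (Sum.inl i) (Sum.inr j) 1

/-- Matrix units spanning `𝔭⁻`; `pMinus i j = (pPlus i j)*` is also the conjugate of `pPlus i j`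
with respect to the real form `𝔭₀` of `𝔭`. -/
def pMinus (i j : Fin 2) : Mat := Matrix.single (Sum.inr j) (Sum.inl i) 1

/-- The symmetric algebra `S(𝔭⁺)`: the variable `(i,j)` is the basis vector `pPlus i j`. -/
abbrev S := MvPolynomial (Fin 2 × Fin 2) ℂ

/-- The differential operator of a polynomial in four commuting left invariant vector fields. -/
def polyOp (E : Fin 2 → Fin 2 → Mat) (p : S) (f : Mat → ℂ) (g : Mat) : ℂ :=
  ∑ m ∈ p.support, p.coeff m *
    ((field (E 0 0))^[m (0, 0)] ((field (E 0 1))^[m (0, 1)]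
      ((field (E 1 0))^[m (1, 0)] ((field (E 1 1))^[m (1, 1)] f)))) g

/-! ### The `K`-modules `W_λ` and the Shimura operators -/

/-- The action of `k ∈ K` on `S(𝔭⁺)` induced by the adjoint action on `𝔭⁺`. -/
def AdK (k : K) : S →ₐ[ℂ] S :=
  MvPolynomial.aeval fun ij : Fin 2 × Fin 2 =>
    ∑ p : Fin 2, ∑ q : Fin 2,
      MvPolynomial.C ((K.mat k * pPlus ij.1 ij.2 * (K.mat k)ᴴ) (Sum.inl p) (Sum.inr q)) *
        MvPolynomial.X (p, q)

/-- The highest weight vector of weight `λ₁γ₁ + λ₂γ₂` in `S(𝔭⁺)`, where `γ_j` is the root of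
`e_j⁺` (for `l.2 ≤ l.1`, `λ = l`). -/
def hwVec (l : ℕ × ℕ) : S :=
  MvPolynomial.X (0, 0) ^ (l.1 - l.2) *
    (MvPolynomial.X (0, 0) * MvPolynomial.X (1, 1) -
      MvPolynomial.X (0, 1) * MvPolynomial.X (1, 0)) ^ l.2

/-- `W_λ`: the irreducible `K`-submodule of `S(𝔭⁺)` of highest weight `λ₁γ₁ + λ₂γ₂`. -/
def W (l : ℕ × ℕ) : Submodule ℂ S :=
  Submodule.span ℂ (Set.range fun k : K => AdK k (hwVec l))

/-- The Fock inner product on `S(𝔭⁺)`, antilinear in the first variable. -/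
def fock (p q : S) : ℂ :=
  ∑ m ∈ p.support, (∏ ij, ((m ij)! : ℂ)) * (conj (p.coeff m) * q.coeff m)

/-- `ξ` is an orthonormal basis of `U` for the Fock inner product. -/
def IsONB {N : ℕ} (ξ : Fin N → S) (U : Submodule ℂ S) : Prop :=
  Submodule.span ℂ (Set.range ξ) = U ∧ ∀ a b, fock (ξ a) (ξ b) = if a = b then 1 else 0

lemma fock_eq_sum (p q : S) (s : Finset (Fin 2 × Fin 2 →₀ ℕ)) (hs : p.support ⊆ s) :
    fock p q = ∑ m ∈ s, (∏ ij, ((m ij)! : ℂ)) * (conj (p.coeff m) * q.coeff m) := by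
  refine Finset.sum_subset hs fun m _ hm => ?_
  rw [MvPolynomial.notMem_support_iff.1 hm]
  simp

lemma fock_self (p : S) :
    fock p p = ((∑ m ∈ p.support, (∏ ij, ((m ij)! : ℝ)) * ‖p.coeff m‖ ^ 2 : ℝ) : ℂ) := by
  unfold fock
  push_cast
  refine Finset.sum_congr rfl fun m _ => ?_
  rw [Complex.conj_mul']

/-- The Fock inner product is a positive definite Hermitian form. -/
@[reducible]
def fockCore : InnerProductSpace.Core ℂ S where
  inner := fock
  conj_inner_symm p q := by
    change conj (fock q p) = fock p q
    rw [fock_eq_sum q p (p.support ∪ q.support) Finset.subset_union_right,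
      fock_eq_sum p q (p.support ∪ q.support) Finset.subset_union_left, map_sum]
    refine Finset.sum_congr rfl fun m _ => ?_
    simp only [map_mul, map_prod, Complex.conj_conj, map_natCast]
    ring
  re_inner_nonneg p := by
    rw [fock_self]
    simp only [RCLike.re_eq_complex_re, Complex.ofReal_re]
    positivity
  add_left p q r := by
    change fock (p + q) r = fock p r + fock q r
    rw [fock_eq_sum (p + q) r (p.support ∪ q.support) MvPolynomial.support_add,
      fock_eq_sum p r (p.support ∪ q.support) Finset.subset_union_left,
      fock_eq_sum q r (p.support ∪ q.support) Finset.subset_union_right,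
      ← Finset.sum_add_distrib]
    refine Finset.sum_congr rfl fun m _ => ?_
    simp only [MvPolynomial.coeff_add, map_add]
    ring
  smul_left p q c := by
    change fock (c • p) q = conj c * fock p q
    rw [fock_eq_sum (c • p) q p.support MvPolynomial.support_smul, fock, Finset.mul_sum]
    refine Finset.sum_congr rfl fun m _ => ?_
    simp only [MvPolynomial.coeff_smul, smul_eq_mul, map_mul]
    ring
  definite p hp := by
    change fock p p = 0 at hp
    rw [fock_self, Complex.ofReal_eq_zero, Finset.sum_eq_zero_iff_of_nonneg
      (fun m _ => by positivity)] at hp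
    by_contra hne
    obtain ⟨m, hm⟩ := MvPolynomial.support_nonempty.2 hne
    have h1 := hp m hm
    have h2 : (0 : ℝ) < ∏ ij, ((m ij)! : ℝ) :=
      Finset.prod_pos fun ij _ => by positivity
    have h3 : ‖p.coeff m‖ ^ 2 = 0 := by
      rcases mul_eq_zero.1 h1 with h | h
      · exact absurd h h2.ne'
      · exact h
    exact MvPolynomial.mem_support_iff.1 hm (by simpa using h3)

lemma hwVec_homogeneous (l : ℕ × ℕ) : (hwVec l).IsHomogeneous ((l.1 - l.2) + 2 * l.2) := by
  have hX : ∀ i, (MvPolynomial.X i : S).IsHomogeneous 1 := fun i =>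
    MvPolynomial.isHomogeneous_X ℂ i
  have h1 := (hX (0, 0)).pow (l.1 - l.2)
  have h2 := (((hX (0, 0)).mul (hX (1, 1))).sub ((hX (0, 1)).mul (hX (1, 0)))).pow l.2
  have h3 := h1.mul h2
  rw [one_mul] at h3
  exact h3

lemma W_finite (l : ℕ × ℕ) : FiniteDimensional ℂ (W l) := by
  have hle : W l ≤ MvPolynomial.homogeneousSubmodule (Fin 2 × Fin 2) ℂ
      (1 * ((l.1 - l.2) + 2 * l.2)) := by
    refine Submodule.span_le.2 ?_
    rintro _ ⟨k, rfl⟩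
    refine (hwVec_homogeneous l).aeval _ fun ij => ?_
    refine MvPolynomial.IsHomogeneous.sum _ _ _ fun p _ =>
      MvPolynomial.IsHomogeneous.sum _ _ _ fun q _ => ?_
    have h := (MvPolynomial.isHomogeneous_C (Fin 2 × Fin 2)
      ((K.mat k * pPlus ij.1 ij.2 * (K.mat k)ᴴ) (Sum.inl p) (Sum.inr q))).mul
        (MvPolynomial.isHomogeneous_X ℂ (p, q))
    rwa [zero_add] at h
  have hfin : FiniteDimensional ℂ (MvPolynomial.homogeneousSubmodule (Fin 2 × Fin 2) ℂ
      (1 * ((l.1 - l.2) + 2 * l.2))) :=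
    Module.Finite.iff_fg.2 (MvPolynomial.homogeneousSubmodule_fg _ _ _)
  exact Submodule.finiteDimensional_of_le hle

lemma exists_isONB (l : ℕ × ℕ) : ∃ (N : ℕ) (ξ : Fin N → S), IsONB ξ (W l) := by
  let _ : NormedAddCommGroup S := fockCore.toNormedAddCommGroup
  let _ : InnerProductSpace ℂ S := InnerProductSpace.ofCore fockCore.toCore
  have := W_finite l
  let b := stdOrthonormalBasis ℂ (W l)
  refine ⟨_, fun a => (b a : S), ?_, ?_⟩
  · have h := congrArg (Submodule.map (W l).subtype) b.toBasis.span_eq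
    rw [Submodule.map_span, Submodule.map_top, Submodule.range_subtype, ← Set.range_comp] at h
    simpa [Function.comp_def] using h
  · intro a c
    have h := orthonormal_iff_ite.1 b.orthonormal a c
    exact h

/-- The dimension of `W_λ`. -/
def basisCard (l : ℕ × ℕ) : ℕ := (exists_isONB l).choose

/-- A chosen orthonormal basis of `W_λ`. -/
def basisW (l : ℕ × ℕ) : Fin (basisCard l) → S := (exists_isONB l).choose_spec.choose

lemma basisW_isONB (l : ℕ × ℕ) : IsONB (basisW l) (W l) :=
  (exists_isONB l).choose_spec.choose_spec

/-- The Shimura operator `L_λ = ∑_α ξ_α* ξ_α`, where `ξ_α` is an orthonormal basis of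
`W_λ ⊆ S(𝔭⁺)` and `ξ_α* ∈ S(𝔭⁻)` is its conjugate; it does not depend on the basis. -/
def shimuraOp (l : ℕ × ℕ) (f : Mat → ℂ) (g : Mat) : ℂ :=
  ∑ a, polyOp pMinus (MvPolynomial.map (starRingEnd ℂ) (basisW l a))
    (polyOp pPlus (basisW l a) f) g

/-- `c` is the eigenvalue of `(-1)^{|λ|} L_λ` on the spherical function `Φ_x`. -/
def IsEigenvalue (l : ℕ × ℕ) (x : Fin 2 → ℂ) (c : ℂ) : Prop :=
  ∀ g ∈ G, (-1 : ℂ) ^ (l.1 + l.2) * shimuraOp l (Phi x) (g : Mat) = c * Phi x (g : Mat)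

/-- The Shimura set `𝒜 ⊆ 𝔞* = ℂ²`: the eigenvalues of `(-1)^{|λ|} L_λ` on `Φ_x` are real and
nonnegative, for all partitions `λ = (λ₁ ≥ λ₂ ≥ 0)`. -/
def shimuraSet : Set (Fin 2 → ℂ) :=
  {x | ∀ l : ℕ × ℕ, l.2 ≤ l.1 → ∃ c : ℝ, 0 ≤ c ∧ IsEigenvalue l x c}

/-- The Weyl chamber `x₁ ≥ x₂ ≥ 0`. -/
def chamber : Set (Fin 2 → ℝ) := {x | x 1 ≤ x 0 ∧ 0 ≤ x 1}

/-- `𝒜₀ = 𝒜 ∩ 𝒞`. -/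
def shimuraSet₀ : Set (Fin 2 → ℝ) :=
  {x | x ∈ chamber ∧ (fun i => (x i : ℂ)) ∈ shimuraSet}

end

end Shimura

namespace Shimura
noncomputable section
open scoped Matrix BigOperators ComplexConjugate Nat
open MeasureTheory MvPolynomial

/-! ### Polynomials in commuting elements -/

/-! Write λ = (k + m, k), yᵢ for the squares of the two parameters and c_j = (j + 1/2)². The theorem
rests on an explicit eigenvalue: up to a positive constant, (-1)^|λ| L_λ acts on Φ_x by the product
of (c_j - y₁)(c_j - y₂) over j < k, times the divided difference (P(y₂) - P(y₁))/(y₁ - y₂) of P(y) =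
∏ (c_j - y), k ≤ j ≤ k + m (`exists_isEigenvalue_iff`, `neg_one_pow_mul_symbEigen`).

The symbol. Put 𝔭⁻ to the left of 𝔭⁺ and replace both by commuting variables v, z. The symbol of L_λ
is then the Fock reproducing kernel of W_λ, a positive multiple of det^k h_m, where h_m is the
complete symmetric polynomial in the eigenvalues of z vᵀ (`exists_symbol_eq`). This uses the Cayley
identity for det and the reading of h_m as a trace on a symmetric power.

The eigenvalue. Let v₀ be a vector killed by 𝔨. The second order operator ∑ Y X acts on vectors
Op(κ) v₀ as tr(z vᵀ) + T on symbols, with T an explicit second order differential operator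
(`casimir_op`), and det^k h_m is an eigenvector of T (`symbT_detS_pow_hSym`). With tr · h_{m+1} =
h_{m+2} + det · h_m this gives a recursion in m (`op_invariant`). It starts from the symbols det^k,
which are computed on the power functions Δ₁^a Δ₂^b by a Cayley identity
(`op_detS_pow_sphericalPower`). The power functions are made holomorphic on an open set of matrices
containing G. There left invariant fields are complex derivations, and Φ_x is the average over K of
left translates of one power function, so it has the same eigenvalues (`IsAverage.field`).

Positivity. Let x₁ ≥ x₂ ≥ 0. The cases (k, m) = (1, 0) and (0, 1) force either x₁ ≤ 1/2, or x₂ ≥ 1/2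
and x₁ ≤ 3/2. If x₁ ≤ 1/2, all factors are nonnegative. Otherwise k = 0 decides, and a regrouping of
P expresses it through (x - 1)² and a prefactor increasing in x (`nodeProd_sq`). For x₁ + x₂ ≤ 2 the
point x₁ is at least as close to 1 as x₂, so the divided difference is nonnegative. For x₁ + x₂ > 2
it is negative for large m, since the ratio of the prefactors tends to 1; the diagonal x₁ = x₂ needs
a separate estimate (`exists_nodeDiff_self_neg`). -/

open scoped IsMulCommutative in
/-- Evaluation of polynomials at a commuting family of elements of a noncommutative algebra. -/
theorem exists_algHom_of_commute {σ R A : Type*} [CommRing R] [Ring A] [Algebra R A]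
    (x : σ → A) (h : ∀ i j, Commute (x i) (x j)) :
    ∃ f : MvPolynomial σ R →ₐ[R] A, ∀ i, f (X i) = x i := by
  have hc : ∀ a ∈ Set.range x, ∀ b ∈ Set.range x, a * b = b * a := by
    rintro _ ⟨i, rfl⟩ _ ⟨j, rfl⟩
    exact h i j
  have := Algebra.isMulCommutative_adjoin R hc
  let y : σ → Algebra.adjoin R (Set.range x) := fun i =>
    ⟨x i, Algebra.subset_adjoin ⟨i, rfl⟩⟩
  refine ⟨(Algebra.adjoin R (Set.range x)).val.comp (aeval y), fun i => ?_⟩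
  simp [y]

/-- Index set of the coordinates of `2 × 2` matrices. -/
abbrev Ix := Fin 2 × Fin 2

/-- Normally ordered symbols: polynomials in commuting variables for `𝔭⁺` and `𝔭⁻`. -/
abbrev Symb := MvPolynomial (Ix ⊕ Ix) ℂ

/-- The variable of a symbol that stands for `pPlus i j`. -/
def zv (i j : Fin 2) : Symb := X (Sum.inl (i, j))

/-- The variable of a symbol that stands for `pMinus i j`. -/
def vv (i j : Fin 2) : Symb := X (Sum.inr (i, j))

/-- The derivative with respect to `zv i j`. -/
def dz (i j : Fin 2) : Derivation ℂ Symb Symb := pderiv (Sum.inl (i, j))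

/-- The derivative with respect to `vv i j`. -/
def dv (i j : Fin 2) : Derivation ℂ Symb Symb := pderiv (Sum.inr (i, j))

lemma dz_zv (i j k l : Fin 2) : dz i j (zv k l) = if i = k ∧ j = l then 1 else 0 := by
  simp [dz, zv, pderiv_X, Pi.single_apply, eq_comm]

lemma dz_vv (i j k l : Fin 2) : dz i j (vv k l) = 0 := by
  simp [dz, vv, pderiv_X]

lemma dv_vv (i j k l : Fin 2) : dv i j (vv k l) = if i = k ∧ j = l then 1 else 0 := by
  simp [dv, vv, pderiv_X, Pi.single_apply, eq_comm]

lemma dv_zv (i j k l : Fin 2) : dv i j (zv k l) = 0 := by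
  simp [dv, zv, pderiv_X]

/-- Induction on symbols: the variables of `𝔭⁻` are multiplied from the left. -/
theorem Symb.induction {P : Symb → Prop} (h0 : ∀ p : S, P (rename Sum.inl p))
    (hadd : ∀ p q, P p → P q → P (p + q)) (hv : ∀ i j p, P p → P (vv i j * p)) (κ : Symb) :
    P κ := by
  have h : ∀ p : S, P (κ * rename Sum.inl p) := by
    induction κ using MvPolynomial.induction_on with
    | C a =>
      intro p
      have := h0 (C a * p)
      rwa [map_mul, rename_C] at this
    | add a b ha hb =>
      intro p
      rw [add_mul]
      exact hadd _ _ (ha p) (hb p)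
    | mul_X a i ha =>
      intro p
      rcases i with i | i
      · have := ha (X i * p)
        rwa [map_mul, rename_X, ← mul_assoc] at this
      · have := hv i.1 i.2 _ (ha p)
        rwa [vv, ← mul_assoc, mul_comm (X _) a] at this
  simpa using h 1

/-! ### Modules over the complexified Lie algebra -/

/-- Operators `X i j`, `Y i j`, `L i k`, `R l j` satisfying the commutation relations of the
matrix units of `𝔭⁺`, `𝔭⁻` and of the two diagonal blocks of `𝔤𝔩(4)`. -/
structure BlockRelations {M : Type*} [AddCommGroup M] [Module ℂ M]
    (X Y L R : Fin 2 → Fin 2 → Module.End ℂ M) : Prop where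
  XX : ∀ i j k l, X i j * X k l = X k l * X i j
  YY : ∀ i j k l, Y i j * Y k l = Y k l * Y i j
  XY : ∀ i j k l, X i j * Y k l =
    Y k l * X i j + ((if j = l then L i k else 0) - if i = k then R l j else 0)
  LX : ∀ i k a b, L i k * X a b = X a b * L i k + if k = a then X i b else 0
  LY : ∀ i k a b, L i k * Y a b = Y a b * L i k - if a = i then Y k b else 0
  RX : ∀ l j a b, R l j * X a b = X a b * R l j - if b = l then X a j else 0
  RY : ∀ l j a b, R l j * Y a b = Y a b * R l j + if j = b then Y a l else 0

/-- The operators of normally ordered symbols. -/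
theorem BlockRelations.exists_op {M : Type*} [AddCommGroup M] [Module ℂ M]
    {X Y L R : Fin 2 → Fin 2 → Module.End ℂ M} (h : BlockRelations X Y L R) :
    ∃ Op : Symb →ₗ[ℂ] Module.End ℂ M, Op 1 = 1 ∧
      (∀ i j κ, Op (vv i j * κ) = Y i j * Op κ) ∧
      (∀ i j κ, Op (zv i j * κ) = Op κ * X i j) := by
  let x : Ix ⊕ Ix → Module.End ℂ (Module.End ℂ M) := Sum.elim
    (fun i => LinearMap.mulRight ℂ (X i.1 i.2)) (fun i => LinearMap.mulLeft ℂ (Y i.1 i.2))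
  have hc : ∀ i j, Commute (x i) (x j) := by
    rintro (i | i) (j | j) <;> refine LinearMap.ext fun T => ?_
    · simp [x, mul_assoc, h.XX i.1 i.2]
    · simp [x, mul_assoc]
    · simp [x, mul_assoc]
    · simp [x, ← mul_assoc, h.YY i.1 i.2]
  obtain ⟨Θ, hΘ⟩ := exists_algHom_of_commute (R := ℂ) x hc
  refine ⟨(LinearMap.applyₗ (1 : Module.End ℂ M)).comp Θ.toLinearMap, ?_, ?_, ?_⟩
  · simp
  · intro i j κ
    simp [vv, hΘ, x]
  · intro i j κ
    simp [zv, hΘ, x]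

/-- The action of the upper left diagonal block on symbols. -/
def symbL (i k : Fin 2) (κ : Symb) : Symb :=
  ∑ b, zv i b * dz k b κ - ∑ b, vv k b * dv i b κ

/-- The action of the lower right diagonal block on symbols. -/
def symbR (l j : Fin 2) (κ : Symb) : Symb :=
  ∑ a, vv a l * dv a j κ - ∑ a, zv a j * dz a l κ

/-- The correction to the product with `zv i j` in the action of `𝔭⁺` on symbols. -/
def symbD (i j : Fin 2) (κ : Symb) : Symb :=
  ∑ k, ∑ b, zv i b * dv k j (dz k b κ) + ∑ a, ∑ l, zv a j * dv i l (dz a l κ) -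
    ∑ k, ∑ b, vv k b * dv k j (dv i b κ)

section SymbolAction

lemma symbL_add (i k : Fin 2) (p q : Symb) : symbL i k (p + q) = symbL i k p + symbL i k q := by
  simp only [symbL, map_add, mul_add, Finset.sum_add_distrib]
  ring

lemma symbR_add (i k : Fin 2) (p q : Symb) : symbR i k (p + q) = symbR i k p + symbR i k q := by
  simp only [symbR, map_add, mul_add, Finset.sum_add_distrib]
  ring

lemma symbD_add (i k : Fin 2) (p q : Symb) : symbD i k (p + q) = symbD i k p + symbD i k q := by
  simp only [symbD, map_add, mul_add, Finset.sum_add_distrib]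
  ring

/-- `symbL` is a first order operator, so its commutator with a multiplication is multiplication by
its value on the variable. This copies the relation `LY`; the next three lemmas copy `LX`, `RY` and
`RX`. -/
lemma symbL_vv (i k a b : Fin 2) (κ : Symb) :
    symbL i k (vv a b * κ) = vv a b * symbL i k κ - (if a = i then vv k b else 0) * κ := by
  simp only [symbL, Derivation.leibniz, dz_vv, dv_vv, smul_eq_mul, Fin.sum_univ_two]
  fin_cases i <;> fin_cases a <;> fin_cases b <;> simp <;> ring

lemma symbL_zv (i k a b : Fin 2) (κ : Symb) :
    symbL i k (zv a b * κ) = zv a b * symbL i k κ + (if k = a then zv i b else 0) * κ := by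
  simp only [symbL, Derivation.leibniz, dz_zv, dv_zv, smul_eq_mul, Fin.sum_univ_two]
  fin_cases k <;> fin_cases a <;> fin_cases b <;> simp <;> ring

lemma symbR_vv (l j a b : Fin 2) (κ : Symb) :
    symbR l j (vv a b * κ) = vv a b * symbR l j κ + (if j = b then vv a l else 0) * κ := by
  simp only [symbR, Derivation.leibniz, dz_vv, dv_vv, smul_eq_mul, Fin.sum_univ_two]
  fin_cases j <;> fin_cases a <;> fin_cases b <;> simp <;> ring

lemma symbR_zv (l j a b : Fin 2) (κ : Symb) :
    symbR l j (zv a b * κ) = zv a b * symbR l j κ - (if b = l then zv a j else 0) * κ := by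
  simp only [symbR, Derivation.leibniz, dz_zv, dv_zv, smul_eq_mul, Fin.sum_univ_two]
  fin_cases l <;> fin_cases a <;> fin_cases b <;> simp <;> ring

lemma dv_rename_inl (i j : Fin 2) (p : S) : dv i j (rename Sum.inl p) = 0 := by
  induction p using MvPolynomial.induction_on with
  | C a => simp [dv]
  | add p q hp hq => simp [hp, hq]
  | mul_X p n hp =>
    rw [map_mul, rename_X, ← zv, Derivation.leibniz, hp, dv_zv]
    simp

lemma dv_dz_rename_inl (i j k l : Fin 2) (p : S) : dv i j (dz k l (rename Sum.inl p)) = 0 := by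
  induction p using MvPolynomial.induction_on with
  | C a => simp [dz]
  | add p q hp hq => simp [hp, hq]
  | mul_X p n hp =>
    rw [map_mul, rename_X, ← zv, Derivation.leibniz, dz_zv, map_add, smul_eq_mul, smul_eq_mul,
      Derivation.leibniz, Derivation.leibniz, hp, dv_zv, dv_rename_inl]
    split_ifs <;> simp

/-- The induction in `L_op` needs a symbol free of `vv` here, because a `zv` can be moved to the
front of an operator only past symbols in the `zv` alone. -/
lemma symbL_rename_inl (i k : Fin 2) (p : S) :
    ∃ q : S, symbL i k (rename Sum.inl p) = rename Sum.inl q := by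
  refine ⟨∑ b, X (i, b) * pderiv (k, b) p, ?_⟩
  simp [symbL, dv_rename_inl, dz, zv, pderiv_rename Sum.inl_injective]

lemma symbR_rename_inl (l j : Fin 2) (p : S) :
    ∃ q : S, symbR l j (rename Sum.inl p) = rename Sum.inl q := by
  refine ⟨-∑ a, X (a, j) * pderiv (a, l) p, ?_⟩
  simp [symbR, dv_rename_inl, dz, zv, pderiv_rename Sum.inl_injective]

lemma symbD_rename_inl (i j : Fin 2) (p : S) : symbD i j (rename Sum.inl p) = 0 := by
  simp [symbD, dv_rename_inl, dv_dz_rename_inl]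

/-- This is the relation `XY` on symbols: commuting the second order operator `symbD` with a
multiplication leaves a first order operator, the action of the bracket. The three sums in `symbD`
are chosen to make this true. -/
lemma symbD_vv (i j k l : Fin 2) (κ : Symb) :
    symbD i j (vv k l * κ) = vv k l * symbD i j κ +
      ((if j = l then symbL i k κ else 0) - if i = k then symbR l j κ else 0) := by
  simp only [symbD, symbL, symbR, Derivation.leibniz, dz_vv, dv_vv, smul_eq_mul, Fin.sum_univ_two,
    map_add]
  fin_cases j <;> fin_cases i <;> fin_cases k <;> fin_cases l <;> simp <;> ring

end SymbolAction

/-! ### The action of the Lie algebra in terms of symbols -/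

namespace BlockRelations

variable {M : Type*} [AddCommGroup M] [Module ℂ M] {X Y L R : Fin 2 → Fin 2 → Module.End ℂ M}
  {Op : Symb →ₗ[ℂ] Module.End ℂ M} {v₀ : M}

lemma op_rename_comm (h : BlockRelations X Y L R) (h1 : Op 1 = 1)
    (hz : ∀ i j κ, Op (zv i j * κ) = Op κ * X i j) (a b : Fin 2) (p : S) :
    Op (rename Sum.inl p) * X a b = X a b * Op (rename Sum.inl p) := by
  induction p using MvPolynomial.induction_on with
  | C c => rw [rename_C, C_eq_smul_one, LinearMap.map_smul, h1]; simp
  | add p q hp hq => simp only [map_add, add_mul, mul_add, hp, hq]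
  | mul_X p n hp =>
    rw [map_mul, rename_X, ← zv, mul_comm, hz, mul_assoc, h.XX, ← mul_assoc, hp, mul_assoc]

lemma op_rename_zv (h : BlockRelations X Y L R) (h1 : Op 1 = 1)
    (hz : ∀ i j κ, Op (zv i j * κ) = Op κ * X i j) (a b : Fin 2) (p : S) :
    Op (zv a b * rename Sum.inl p) = X a b * Op (rename Sum.inl p) := by
  rw [hz, h.op_rename_comm h1 hz]

/-- Since `L i k` kills `v₀`, it acts on `Op κ v₀` only through its commutators with the factors of
`Op κ`, and `symbL` satisfies the same recursion. -/
lemma L_op (h : BlockRelations X Y L R) (h1 : Op 1 = 1)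
    (hv : ∀ i j κ, Op (vv i j * κ) = Y i j * Op κ)
    (hz : ∀ i j κ, Op (zv i j * κ) = Op κ * X i j) (hL : ∀ i k, L i k v₀ = 0)
    (i k : Fin 2) (κ : Symb) : L i k (Op κ v₀) = Op (symbL i k κ) v₀ := by
  induction κ using Symb.induction with
  | h0 p =>
    induction p using MvPolynomial.induction_on with
    | C c =>
      have : symbL i k (C c) = 0 := by simp [symbL, dz, dv]
      rw [rename_C, this, C_eq_smul_one, LinearMap.map_smul, h1]
      simp [hL]
    | add p q hp hq => simp only [map_add, LinearMap.add_apply, hp, hq, symbL_add]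
    | mul_X p n hp =>
      obtain ⟨q, hq⟩ := symbL_rename_inl i k p
      rw [map_mul, rename_X, ← zv, mul_comm, symbL_zv, hq, map_add, h.op_rename_zv h1 hz,
        h.op_rename_zv h1 hz, ← Module.End.mul_apply, ← mul_assoc, h.LX]
      simp only [add_mul, LinearMap.add_apply, Module.End.mul_apply, hp, hq]
      split_ifs <;> simp [h.op_rename_zv h1 hz]
  | hadd p q hp hq => simp only [map_add, LinearMap.add_apply, hp, hq, symbL_add]
  | hv a b p hp =>
    rw [symbL_vv, hv, map_sub, hv, ← Module.End.mul_apply, ← mul_assoc, h.LY]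
    simp only [sub_mul, LinearMap.sub_apply, Module.End.mul_apply, hp]
    split_ifs <;> simp [hv]

lemma R_op (h : BlockRelations X Y L R) (h1 : Op 1 = 1)
    (hv : ∀ i j κ, Op (vv i j * κ) = Y i j * Op κ)
    (hz : ∀ i j κ, Op (zv i j * κ) = Op κ * X i j) (hR : ∀ l j, R l j v₀ = 0)
    (l j : Fin 2) (κ : Symb) : R l j (Op κ v₀) = Op (symbR l j κ) v₀ := by
  induction κ using Symb.induction with
  | h0 p =>
    induction p using MvPolynomial.induction_on with
    | C c =>
      have : symbR l j (C c) = 0 := by simp [symbR, dz, dv]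
      rw [rename_C, this, C_eq_smul_one, LinearMap.map_smul, h1]
      simp [hR]
    | add p q hp hq => simp only [map_add, LinearMap.add_apply, hp, hq, symbR_add]
    | mul_X p n hp =>
      obtain ⟨q, hq⟩ := symbR_rename_inl l j p
      rw [map_mul, rename_X, ← zv, mul_comm, symbR_zv, hq, map_sub, h.op_rename_zv h1 hz,
        h.op_rename_zv h1 hz, ← Module.End.mul_apply, ← mul_assoc, h.RX]
      simp only [sub_mul, LinearMap.sub_apply, Module.End.mul_apply, hp, hq]
      split_ifs <;> simp [h.op_rename_zv h1 hz]
  | hadd p q hp hq => simp only [map_add, LinearMap.add_apply, hp, hq, symbR_add]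
  | hv a b p hp =>
    rw [symbR_vv, hv, map_add, hv, ← Module.End.mul_apply, ← mul_assoc, h.RY]
    simp only [add_mul, LinearMap.add_apply, Module.End.mul_apply, hp]
    split_ifs <;> simp [hv]

/-- The action of `𝔭⁺` on a vector given by a symbol. -/
theorem X_op (h : BlockRelations X Y L R) (h1 : Op 1 = 1)
    (hv : ∀ i j κ, Op (vv i j * κ) = Y i j * Op κ)
    (hz : ∀ i j κ, Op (zv i j * κ) = Op κ * X i j) (hL : ∀ i k, L i k v₀ = 0)
    (hR : ∀ l j, R l j v₀ = 0) (i j : Fin 2) (κ : Symb) :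
    X i j (Op κ v₀) = Op (zv i j * κ + symbD i j κ) v₀ := by
  induction κ using Symb.induction with
  | h0 p => rw [symbD_rename_inl, add_zero, h.op_rename_zv h1 hz, Module.End.mul_apply]
  | hadd p q hp hq =>
    simp only [map_add, LinearMap.add_apply, hp, hq, symbD_add, mul_add]
    abel
  | hv k l p hp =>
    rw [symbD_vv, hv, mul_left_comm, ← add_assoc, ← mul_add, map_add, hv,
      ← Module.End.mul_apply, ← mul_assoc, h.XY]
    simp only [add_mul, sub_mul, LinearMap.add_apply, LinearMap.sub_apply, Module.End.mul_apply,
      hp, map_sub]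
    congr 2
    · split_ifs <;> simp [h.L_op h1 hv hz hL]
    · split_ifs <;> simp [h.R_op h1 hv hz hR]

end BlockRelations

end
end Shimura

namespace Shimura
noncomputable section
open scoped Matrix BigOperators ComplexConjugate Nat
open MeasureTheory MvPolynomial


/-! ### Invariant symbols -/

/-- The symbol `tr(z vᵀ)`. -/
def trS : Symb := ∑ i, ∑ j, zv i j * vv i j

/-- The symbol `det z`. -/
def detZ : Symb := zv 0 0 * zv 1 1 - zv 0 1 * zv 1 0

/-- The symbol `det v`. -/
def detV : Symb := vv 0 0 * vv 1 1 - vv 0 1 * vv 1 0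

/-- The symbol `det(z vᵀ)`. -/
def detS : Symb := detZ * detV

/-- The correction to the product with `trS` in the action of `∑ Y i j * X i j` on symbols. -/
def symbT (κ : Symb) : Symb := ∑ i, ∑ j, vv i j * symbD i j κ

/-- The bilinear form `(f, g) ↦ symbT (f g) - f symbT g - g symbT f`. -/
def symbΓ (f : Symb) : Derivation ℂ Symb Symb :=
  ∑ i, ∑ j, vv i j • (
    (∑ k, ∑ b, zv i b • (dv k j f • dz k b + dz k b f • dv k j)) +
    (∑ a, ∑ l, zv a j • (dv i l f • dz a l + dz a l f • dv i l)) -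
    ∑ k, ∑ b, vv k b • (dv k j f • dv i b + dv i b f • dv k j))

/-- `symbT` is purely of second order, so its defect from the product rule is a derivation in each
argument. Hence its values on polynomials in `trS` and `detS` follow from finitely many
computations. -/
lemma symbT_mul (f g : Symb) : symbT (f * g) = f * symbT g + g * symbT f + symbΓ f g := by
  simp only [symbT, symbΓ, symbD, Derivation.leibniz, smul_eq_mul, Fin.sum_univ_two, map_add,
    Derivation.add_apply, Derivation.sub_apply, Derivation.smul_apply]
  ring

lemma symbT_sub (f g : Symb) : symbT (f - g) = symbT f - symbT g := by
  simp only [symbT, symbD, Fin.sum_univ_two, map_sub]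
  ring

lemma symbT_one : symbT 1 = 0 := by simp [symbT, symbD]

lemma symbT_trS : symbT trS = 4 * trS := by
  simp [symbT, symbD, trS, Fin.sum_univ_two, Derivation.leibniz, dz_zv, dz_vv, dv_zv, dv_vv]
  ring

lemma dz_detZ (i j : Fin 2) : dz i j detZ =
    (if i = 0 ∧ j = 0 then zv 1 1 else 0) - (if i = 0 ∧ j = 1 then zv 1 0 else 0)
    - (if i = 1 ∧ j = 0 then zv 0 1 else 0) + (if i = 1 ∧ j = 1 then zv 0 0 else 0) := by
  simp only [detZ, map_sub, Derivation.leibniz, dz_zv, smul_eq_mul]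
  fin_cases i <;> fin_cases j <;> simp

lemma dv_detV (i j : Fin 2) : dv i j detV =
    (if i = 0 ∧ j = 0 then vv 1 1 else 0) - (if i = 0 ∧ j = 1 then vv 1 0 else 0)
    - (if i = 1 ∧ j = 0 then vv 0 1 else 0) + (if i = 1 ∧ j = 1 then vv 0 0 else 0) := by
  simp only [detV, map_sub, Derivation.leibniz, dv_vv, smul_eq_mul]
  fin_cases i <;> fin_cases j <;> simp

lemma dv_detZ (i j : Fin 2) : dv i j detZ = 0 := by
  simp [detZ, Derivation.leibniz, dv_zv]

lemma dz_detV (i j : Fin 2) : dz i j detV = 0 := by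
  simp [detV, Derivation.leibniz, dz_vv]

lemma symbT_detS : symbT detS = 6 * detS := by
  simp [symbT, symbD, detS, Fin.sum_univ_two, Derivation.leibniz, dz_detZ, dv_detV, dv_detZ,
    dz_detV, dv_zv, dv_vv]
  simp only [detZ, detV]
  ring

/-- Together with the other two brackets, this shows that polynomials in `trS` and `detS` are closed
under `symbΓ`, so all later computations take place in two variables. -/
lemma symbΓ_trS_trS : symbΓ trS trS = 2 * trS ^ 2 - 4 * detS := by
  simp [symbΓ, trS, Fin.sum_univ_two, Derivation.leibniz, dz_zv, dz_vv, dv_zv, dv_vv]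
  simp only [detS, detZ, detV]
  ring

lemma symbΓ_trS_detS : symbΓ trS detS = 2 * trS * detS := by
  simp [symbΓ, trS, detS, Fin.sum_univ_two, Derivation.leibniz, dz_zv, dz_vv, dv_zv, dv_vv,
    dz_detZ, dv_detV, dv_detZ, dz_detV]
  simp only [detZ, detV]
  ring

lemma symbΓ_comm (f g : Symb) : symbΓ f g = symbΓ g f := by
  simp only [symbΓ, smul_eq_mul, Fin.sum_univ_two,
    Derivation.add_apply, Derivation.sub_apply, Derivation.smul_apply]
  ring

lemma symbΓ_detS_detS : symbΓ detS detS = 4 * detS ^ 2 := by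
  have h1 : ∀ i j, dv i j detS = detZ * dv i j detV := fun i j => by
    simp [detS, Derivation.leibniz, dv_detZ]
  have h2 : ∀ i j, dz i j detS = detV * dz i j detZ := fun i j => by
    simp [detS, Derivation.leibniz, dz_detV]
  simp only [symbΓ, Fin.sum_univ_two, Derivation.add_apply, Derivation.sub_apply,
    Derivation.smul_apply, smul_eq_mul, h1, h2, dz_detZ, dv_detV]
  simp only [detS]
  simp
  simp only [detZ, detV]
  ring

/-- The complete homogeneous symmetric polynomials of the eigenvalues of a `2 × 2` matrix with
trace `t` and determinant `d`. -/
def hSym {A : Type*} [CommRing A] (t d : A) : ℕ → A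
  | 0 => 1
  | 1 => t
  | m + 2 => t * hSym t d (m + 1) - d * hSym t d m

/-- On polynomials in `trS` and `detS`, the derivation `symbΓ detS` is `2 * detS` times the Euler
operator that gives these degrees 1 and 2. -/
lemma symbΓ_detS_hSym (m : ℕ) :
    symbΓ detS (hSym trS detS m) = 2 * m * detS * hSym trS detS m := by
  induction m using Nat.twoStepInduction with
  | zero => simp [hSym]
  | one => rw [hSym, symbΓ_comm, symbΓ_trS_detS]; push_cast; ring
  | more m h1 h2 =>
    rw [hSym, map_sub, Derivation.leibniz, Derivation.leibniz, h1, h2, symbΓ_comm detS trS,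
      symbΓ_trS_detS, symbΓ_detS_detS]
    simp only [smul_eq_mul]
    push_cast
    ring

lemma symbΓ_trS_hSym (m : ℕ) :
    symbΓ trS (hSym trS detS (m + 1)) = 2 * (m + 1) * trS * hSym trS detS (m + 1) -
      2 * (m + 2) * detS * hSym trS detS m := by
  induction m using Nat.twoStepInduction with
  | zero => simp only [hSym, symbΓ_trS_trS]; push_cast; ring
  | one =>
    simp only [hSym, map_sub, Derivation.leibniz, symbΓ_trS_trS, symbΓ_trS_detS, smul_eq_mul]
    simp
    ring
  | more m h1 h2 =>
    rw [hSym, map_sub, Derivation.leibniz, Derivation.leibniz, h1, h2, symbΓ_trS_trS,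
      symbΓ_trS_detS]
    simp only [smul_eq_mul, hSym]
    push_cast
    ring

/-- In the recursion of `hSym` both terms acquire the same factor (m + 2)(m + 5); the second needs
the extra term of `symbΓ_trS_hSym`. -/
lemma symbT_hSym (m : ℕ) :
    symbT (hSym trS detS m) = m * (m + 3) * hSym trS detS m := by
  induction m using Nat.twoStepInduction with
  | zero => simp [hSym, symbT_one]
  | one => simp only [hSym, symbT_trS]; push_cast; ring
  | more m h1 h2 =>
    rw [hSym, symbT_sub, symbT_mul, symbT_mul, h1, h2, symbΓ_trS_hSym, symbΓ_detS_hSym, symbT_trS,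
      symbT_detS]
    push_cast
    ring

lemma symbΓ_detS_pow_hSym (k m : ℕ) : symbΓ detS (detS ^ k * hSym trS detS m) =
    2 * (2 * k + m) * detS * (detS ^ k * hSym trS detS m) := by
  rw [Derivation.leibniz, Derivation.leibniz_pow, symbΓ_detS_detS, symbΓ_detS_hSym]
  rcases k with _ | k
  · simp
  · simp only [smul_eq_mul, nsmul_eq_mul, Nat.add_sub_cancel]
    push_cast
    ring

/-- The invariant symbols `det ^ k * hSym m` are eigenvectors of `symbT`. -/
theorem symbT_detS_pow_hSym (k m : ℕ) : symbT (detS ^ k * hSym trS detS m) =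
    ((k + m) * (k + m + 3) + k * (k + 1)) * (detS ^ k * hSym trS detS m) := by
  induction k with
  | zero =>
    rw [pow_zero, one_mul, symbT_hSym]
    push_cast
    ring
  | succ k ih =>
    rw [pow_succ', mul_assoc, symbT_mul, ih, symbT_detS, symbΓ_detS_pow_hSym]
    push_cast
    ring

/-! ### Eigenvalues of invariant symbols -/

/-- The eigenvalue of the invariant symbol `detS ^ k * hSym m`, in terms of the squares `y₁, y₂` of
the parameters. -/
def symbEigen {A : Type*} [Field A] (y₁ y₂ : A) : ℕ → ℕ → A
  | 0, k => ∏ j ∈ Finset.range k, (y₁ - ((j : A) + 1 / 2) ^ 2) * (y₂ - ((j : A) + 1 / 2) ^ 2)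
  | 1, k => (y₁ + y₂ - ((k : A) + 1 + 1 / 2) ^ 2 - ((k : A) + 1 / 2) ^ 2) * symbEigen y₁ y₂ 0 k
  | m + 2, k => (y₁ + y₂ - ((k : A) + m + 2 + 1 / 2) ^ 2 - ((k : A) + 1 / 2) ^ 2) *
      symbEigen y₁ y₂ (m + 1) k - symbEigen y₁ y₂ m (k + 1)

namespace BlockRelations

variable {M : Type*} [AddCommGroup M] [Module ℂ M] {X Y L R : Fin 2 → Fin 2 → Module.End ℂ M}
  {Op : Symb →ₗ[ℂ] Module.End ℂ M} {v₀ : M}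

/-- The second order invariant operator applied to a vector given by a symbol. -/
lemma casimir_op (h : BlockRelations X Y L R) (h1 : Op 1 = 1)
    (hv : ∀ i j κ, Op (vv i j * κ) = Y i j * Op κ)
    (hz : ∀ i j κ, Op (zv i j * κ) = Op κ * X i j) (hL : ∀ i k, L i k v₀ = 0)
    (hR : ∀ l j, R l j v₀ = 0) (κ : Symb) :
    ∑ i, ∑ j, Y i j (X i j (Op κ v₀)) = Op (trS * κ + symbT κ) v₀ := by
  have e : trS * κ + symbT κ = ∑ i, ∑ j, vv i j * (zv i j * κ + symbD i j κ) := by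
    have e' : trS * κ = ∑ i, ∑ j, vv i j * (zv i j * κ) := by
      simp only [trS, Finset.sum_mul]
      refine Finset.sum_congr rfl fun i _ => Finset.sum_congr rfl fun j _ => ?_
      rw [mul_comm (zv i j), mul_assoc]
    simp only [e', symbT, mul_add, Finset.sum_add_distrib]
  rw [e, map_sum, LinearMap.sum_apply]
  refine Finset.sum_congr rfl fun i _ => ?_
  rw [map_sum, LinearMap.sum_apply]
  refine Finset.sum_congr rfl fun j _ => ?_
  rw [hv, Module.End.mul_apply, h.X_op h1 hv hz hL hR]

/-- The recursion for the eigenvalues of invariant symbols. -/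
lemma op_trS_mul (h : BlockRelations X Y L R) (h1 : Op 1 = 1)
    (hv : ∀ i j κ, Op (vv i j * κ) = Y i j * Op κ)
    (hz : ∀ i j κ, Op (zv i j * κ) = Op κ * X i j) (hL : ∀ i k, L i k v₀ = 0)
    (hR : ∀ l j, R l j v₀ = 0) (y₁ y₂ : ℂ)
    (hC : ∑ i, ∑ j, Y i j (X i j v₀) = (y₁ + y₂ - 5 / 2) • v₀) (m k : ℕ) (e : ℂ)
    (he : Op (detS ^ k * hSym trS detS m) v₀ = e • v₀) :
    Op (trS * (detS ^ k * hSym trS detS m)) v₀ =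
      ((y₁ + y₂ - ((k : ℂ) + m + 1 + 1 / 2) ^ 2 - ((k : ℂ) + 1 / 2) ^ 2) * e) • v₀ := by
  -- The second order operator is evaluated twice on `Op κ v₀ = e • v₀`: as a scalar on `v₀`, and
  -- through symbols. The constant 5/2 = (3/2)² + (1/2)² completes the squares.
  have e1 := h.casimir_op h1 hv hz hL hR (detS ^ k * hSym trS detS m)
  have e2 : symbT (detS ^ k * hSym trS detS m) =
      ((k + m) * (k + m + 3) + k * (k + 1) : ℂ) • (detS ^ k * hSym trS detS m) := by
    rw [symbT_detS_pow_hSym, Algebra.smul_def]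
    simp only [map_add, map_mul, map_natCast, map_ofNat, map_one]
  rw [e2, map_add, LinearMap.map_smul, LinearMap.add_apply, LinearMap.smul_apply, he] at e1
  simp only [map_smul, ← Finset.smul_sum, hC] at e1
  rw [← sub_eq_iff_eq_add] at e1
  rw [← e1, smul_smul, smul_smul, ← sub_smul]
  congr 1
  ring

/-- If `v₀` is invariant under the diagonal blocks and is an eigenvector of the second order
invariant operator and of the operators with symbols `detS ^ k`, then it is an eigenvector of all
invariant operators. -/
theorem op_invariant (h : BlockRelations X Y L R) (h1 : Op 1 = 1)
    (hv : ∀ i j κ, Op (vv i j * κ) = Y i j * Op κ)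
    (hz : ∀ i j κ, Op (zv i j * κ) = Op κ * X i j) (hL : ∀ i k, L i k v₀ = 0)
    (hR : ∀ l j, R l j v₀ = 0) (y₁ y₂ : ℂ)
    (hC : ∑ i, ∑ j, Y i j (X i j v₀) = (y₁ + y₂ - 5 / 2) • v₀)
    (hdet : ∀ k, Op (detS ^ k) v₀ = symbEigen y₁ y₂ 0 k • v₀) (m k : ℕ) :
    Op (detS ^ k * hSym trS detS m) v₀ = symbEigen y₁ y₂ m k • v₀ := by
  have key := h.op_trS_mul h1 hv hz hL hR y₁ y₂ hC
  induction m using Nat.twoStepInduction generalizing k with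
  | zero => simpa [hSym] using hdet k
  | one =>
    have := key 0 k _ (by simpa [hSym] using hdet k)
    simp only [hSym, mul_one] at this ⊢
    rw [mul_comm, this, symbEigen.eq_2, Nat.cast_zero, add_zero]
  | more m ih1 ih2 =>
    have := key (m + 1) k _ (ih2 k)
    -- The Pieri rule for two variables: multiplication by the trace produces only the two
    -- neighbouring invariant symbols.
    have e3 : detS ^ k * hSym trS detS (m + 2) = trS * (detS ^ k * hSym trS detS (m + 1)) -
        detS ^ (k + 1) * hSym trS detS m := by
      rw [hSym]
      ring
    rw [e3, map_sub, LinearMap.sub_apply, this, ih1, ← sub_smul, symbEigen]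
    congr 1
    push_cast
    ring

end BlockRelations

end
end Shimura

/-! ### Symbols as products of polynomials in the fields of `𝔭⁻` and of `𝔭⁺` -/

namespace Shimura
noncomputable section
open scoped Matrix BigOperators ComplexConjugate Nat
open MeasureTheory MvPolynomial

/-- The operator of a polynomial in the (commuting) operators `E i j`, with a fixed ordering. -/
def polyEnd {M : Type*} [AddCommGroup M] [Module ℂ M] (E : Fin 2 → Fin 2 → Module.End ℂ M)
    (p : S) : Module.End ℂ M :=
  ∑ m ∈ p.support, p.coeff m • (E 0 0 ^ m (0, 0) * (E 0 1 ^ m (0, 1) *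
    (E 1 0 ^ m (1, 0) * E 1 1 ^ m (1, 1))))

lemma S_eq_sum (p : S) : p = ∑ m ∈ p.support, p.coeff m •
    (X (0, 0) ^ m (0, 0) * (X (0, 1) ^ m (0, 1) *
      (X (1, 0) ^ m (1, 0) * X (1, 1) ^ m (1, 1)))) := by
  conv_lhs => rw [p.as_sum]
  refine Finset.sum_congr rfl fun m _ => ?_
  rw [monomial_eq, Finsupp.prod_fintype _ _ fun _ => pow_zero _, Fintype.prod_prod_type,
    Fin.prod_univ_two, Fin.prod_univ_two, Fin.prod_univ_two, smul_eq_C_mul]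
  simp only [mul_assoc]

namespace BlockRelations

variable {M : Type*} [AddCommGroup M] [Module ℂ M] {X Y L R : Fin 2 → Fin 2 → Module.End ℂ M}
  {Op : Symb →ₗ[ℂ] Module.End ℂ M}

lemma op_vv_pow (hv : ∀ i j κ, Op (vv i j * κ) = Y i j * Op κ) (i j : Fin 2) (n : ℕ) (κ : Symb) :
    Op (vv i j ^ n * κ) = Y i j ^ n * Op κ := by
  induction n generalizing κ with
  | zero => simp
  | succ n ih => rw [pow_succ, mul_assoc, ih, hv, pow_succ, mul_assoc]

lemma op_zv_pow (hz : ∀ i j κ, Op (zv i j * κ) = Op κ * X i j) (i j : Fin 2) (n : ℕ) (κ : Symb) :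
    Op (zv i j ^ n * κ) = Op κ * X i j ^ n := by
  induction n generalizing κ with
  | zero => simp
  | succ n ih => rw [pow_succ, mul_assoc, ih, hz, pow_succ', mul_assoc]

lemma op_rename_inr_mul (hv : ∀ i j κ, Op (vv i j * κ) = Y i j * Op κ) (q : S) (κ : Symb) :
    Op (rename Sum.inr q * κ) = polyEnd Y q * Op κ := by
  conv_lhs => rw [S_eq_sum q]
  rw [map_sum, Finset.sum_mul, map_sum, polyEnd, Finset.sum_mul]
  refine Finset.sum_congr rfl fun m _ => ?_
  rw [map_smul, smul_mul_assoc, map_smul, smul_mul_assoc]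
  simp only [map_mul, map_pow, rename_X, ← vv.eq_def, mul_assoc, op_vv_pow hv]

lemma op_mul_rename_inl (hz : ∀ i j κ, Op (zv i j * κ) = Op κ * X i j) (p : S) (κ : Symb) :
    Op (κ * rename Sum.inl p) = Op κ * polyEnd X p := by
  conv_lhs => rw [S_eq_sum p]
  rw [map_sum, Finset.mul_sum, map_sum, polyEnd, Finset.mul_sum]
  refine Finset.sum_congr rfl fun m _ => ?_
  rw [map_smul, mul_smul_comm, map_smul, mul_smul_comm]
  congr 1
  -- A `zv` multiplied last puts its `X` furthest to the right, so the variables are stacked in the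
  -- order opposite to that of `polyEnd`.
  have e : κ * rename Sum.inl (MvPolynomial.X (0, 0) ^ m (0, 0) * (MvPolynomial.X (0, 1) ^ m (0, 1) *
      (MvPolynomial.X (1, 0) ^ m (1, 0) * MvPolynomial.X (1, 1) ^ m (1, 1)))) =
      zv 1 1 ^ m (1, 1) * (zv 1 0 ^ m (1, 0) * (zv 0 1 ^ m (0, 1) * (zv 0 0 ^ m (0, 0) * κ))) := by
    simp only [map_mul, map_pow, rename_X, zv]
    ring
  rw [e]
  simp only [op_zv_pow hz, mul_assoc]

/-- `detV` collects on the left and `detZ` on the right; the factors `X` appear reversed because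
`zv` multiplies operators from the right. -/
lemma op_detS_pow (h1 : Op 1 = 1) (hv : ∀ i j κ, Op (vv i j * κ) = Y i j * Op κ)
    (hz : ∀ i j κ, Op (zv i j * κ) = Op κ * X i j) (k : ℕ) :
    Op (detS ^ k) = (Y 0 0 * Y 1 1 - Y 0 1 * Y 1 0) ^ k *
      (X 1 1 * X 0 0 - X 1 0 * X 0 1) ^ k := by
  have hV : ∀ (k : ℕ) (κ : Symb), Op (detV ^ k * κ) = (Y 0 0 * Y 1 1 - Y 0 1 * Y 1 0) ^ k * Op κ := by
    intro k
    induction k with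
    | zero => simp
    | succ k ih =>
      intro κ
      rw [pow_succ, mul_assoc, ih, detV, sub_mul, map_sub, mul_assoc, mul_assoc, hv, hv, hv, hv,
        pow_succ]
      simp only [mul_assoc, sub_mul]
  have hZ : ∀ (k : ℕ) (κ : Symb), Op (detZ ^ k * κ) = Op κ * (X 1 1 * X 0 0 - X 1 0 * X 0 1) ^ k := by
    intro k
    induction k with
    | zero => simp
    | succ k ih =>
      intro κ
      rw [pow_succ, mul_assoc, ih, detZ, sub_mul, map_sub, mul_assoc, mul_assoc, hz, hz, hz, hz,
        pow_succ']
      simp only [mul_assoc, mul_sub, sub_mul]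
  rw [detS, mul_comm, mul_pow, hV, ← mul_one (detZ ^ k), hZ, h1, one_mul]

end BlockRelations

end
end Shimura

namespace Shimura
noncomputable section
open scoped Matrix BigOperators ComplexConjugate Nat
open MeasureTheory MvPolynomial

/-! ### The Fock inner product -/

lemma fock_add_left (p q r : S) : fock (p + q) r = fock p r + fock q r := fockCore.add_left p q r

lemma fock_smul_left (c : ℂ) (p q : S) : fock (c • p) q = conj c * fock p q :=
  fockCore.smul_left p q c

lemma fock_conj (p q : S) : conj (fock q p) = fock p q := fockCore.conj_inner_symm p q

lemma fock_add_right (p q r : S) : fock p (q + r) = fock p q + fock p r := by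
  rw [← fock_conj, fock_add_left, map_add, fock_conj, fock_conj]

lemma fock_smul_right (c : ℂ) (p q : S) : fock p (c • q) = c * fock p q := by
  rw [← fock_conj, fock_smul_left, map_mul, fock_conj, Complex.conj_conj]

lemma fock_zero_right (p : S) : fock p 0 = 0 := by
  simpa using fock_smul_right 0 p 0

lemma fock_sub_left (p q r : S) : fock (p - q) r = fock p r - fock q r := by
  rw [sub_eq_add_neg, ← neg_one_smul ℂ q, fock_add_left, fock_smul_left]
  simp
  ring

lemma fock_sub_right (p q r : S) : fock p (q - r) = fock p q - fock p r := by
  rw [← fock_conj, fock_sub_left, map_sub, fock_conj, fock_conj]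

lemma fock_monomial (m : Ix →₀ ℕ) (a : ℂ) (q : S) :
    fock (monomial m a) q = (∏ ij, ((m ij)! : ℂ)) * (conj a * q.coeff m) := by
  rw [fock_eq_sum _ _ {m} support_monomial_subset]
  simp

/-- Multiplication by a variable is adjoint to differentiation. -/
lemma fock_X_mul (n : Ix) (p q : S) : fock (X n * p) q = fock p (pderiv n q) := by
  induction p using MvPolynomial.induction_on' with
  | monomial m a =>
    rw [X, monomial_mul, one_mul, fock_monomial, fock_monomial, coeff_pderiv, add_comm m]
    have h : (∏ ij, ((((Finsupp.single n 1 + m : Ix →₀ ℕ) ij)! : ℕ) : ℂ)) = (m n + 1) * ∏ ij, ((m ij)! : ℂ) := by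
      rw [← Finset.mul_prod_erase _ _ (Finset.mem_univ n),
        ← Finset.mul_prod_erase _ (fun ij => ((m ij)! : ℂ)) (Finset.mem_univ n), ← mul_assoc]
      congr 1
      · simp [add_comm 1 (m n), Nat.factorial_succ]
      · refine Finset.prod_congr rfl fun i hi => ?_
        simp [(Finset.ne_of_mem_erase hi).symm]
    rw [h]
    ring
  | add p q hp hq => rw [mul_add, fock_add_left, hp, hq, fock_add_left]

lemma fock_one (q : S) : fock 1 q = eval 0 q := by
  have h := fock_monomial 0 1 q
  rw [show monomial 0 (1 : ℂ) = (1 : S) from rfl] at h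
  rw [h, ← constantCoeff_eq, ← eval_zero]
  simp

/-- The linear form `∑ c i j X (i, j)`. -/
def linForm (c : Fin 2 → Fin 2 → ℂ) : S := ∑ i, ∑ j, c i j • X (i, j)

/-- The derivative in the direction `c`. -/
def dirDeriv (c : Fin 2 → Fin 2 → ℂ) : Derivation ℂ S S := ∑ i, ∑ j, c i j • pderiv (i, j)

lemma fock_linForm_mul (c : Fin 2 → Fin 2 → ℂ) (p q : S) :
    fock (linForm c * p) q = fock p (dirDeriv (fun i j => conj (c i j)) q) := by
  simp only [linForm, dirDeriv, Fin.sum_univ_two, add_mul, smul_mul_assoc, fock_add_left,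
    fock_smul_left, fock_X_mul, Derivation.add_apply, Derivation.smul_apply, fock_add_right,
    fock_smul_right]

lemma dirDeriv_linForm (c b : Fin 2 → Fin 2 → ℂ) :
    dirDeriv c (linForm b) = C (eval (fun ij => c ij.1 ij.2) (linForm b)) := by
  simp [dirDeriv, linForm, Fin.sum_univ_two, pderiv_X, smul_eq_C_mul]
  ring

/-- The Fock inner product with the power of a linear form is evaluation at a point. -/
lemma fock_linForm_pow (c b : Fin 2 → Fin 2 → ℂ) (m : ℕ) :
    fock (linForm c ^ m) (linForm b ^ m) =
      m ! * eval (fun ij => conj (c ij.1 ij.2)) (linForm b ^ m) := by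
  induction m with
  | zero => simp [fock_one]
  | succ m ih =>
    rw [pow_succ', fock_linForm_mul, Derivation.leibniz_pow, dirDeriv_linForm, Nat.add_sub_cancel,
      smul_eq_mul, mul_comm (linForm b ^ m), ← smul_eq_C_mul, ← Nat.cast_smul_eq_nsmul ℂ,
      fock_smul_right, fock_smul_right, ih, Nat.factorial_succ, pow_succ, map_mul]
    push_cast
    ring

/-! ### The Cayley identity for the determinant -/

/-- The determinant as a polynomial. -/
def detX : S := X (0, 0) * X (1, 1) - X (0, 1) * X (1, 0)

/-- The constant coefficient operator with symbol `detX`. -/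
def detD (q : S) : S := pderiv (0, 0) (pderiv (1, 1) q) - pderiv (0, 1) (pderiv (1, 0) q)

lemma fock_detX_mul (p q : S) : fock (detX * p) q = fock p (detD q) := by
  rw [detX, detD, sub_mul, fock_sub_left, fock_sub_right, mul_comm (X (0, 0)),
    mul_comm (X (0, 1)), mul_assoc, mul_assoc, fock_X_mul, fock_X_mul, fock_X_mul, fock_X_mul]

lemma fock_detX_pow_mul (k : ℕ) (p q : S) : fock (detX ^ k * p) q = fock p (detD^[k] q) := by
  induction k generalizing p q with
  | zero => simp
  | succ k ih => rw [pow_succ', mul_assoc, fock_detX_mul, ih, Function.iterate_succ_apply]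

lemma pderiv_detX (i j : Fin 2) : pderiv (i, j) detX =
    (if i = 0 ∧ j = 0 then X (1, 1) else 0) - (if i = 0 ∧ j = 1 then X (1, 0) else 0)
    - (if i = 1 ∧ j = 0 then X (0, 1) else 0) + (if i = 1 ∧ j = 1 then X (0, 0) else 0) := by
  fin_cases i <;> fin_cases j <;> simp [detX, Derivation.leibniz, pderiv_X]

lemma detD_smul (c : ℂ) (q : S) : detD (c • q) = c • detD q := by
  simp [detD, smul_sub]

/-- The Euler operator. -/
def euler : Derivation ℂ S S := ∑ i, ∑ j, (X (i, j) : S) • pderiv (i, j)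

/-- The commutator of `detD` and `detX` is `euler + 2`. Up to scaling the three form an `𝔰𝔩₂`
triple, from which the Cayley constants arise. -/
lemma detD_detX_mul (F : S) : detD (detX * F) = detX * detD F + 2 * F + euler F := by
  simp only [detD, Derivation.leibniz, smul_eq_mul, map_add, pderiv_detX, euler,
    Fin.sum_univ_two, Derivation.add_apply, Derivation.smul_apply]
  simp [pderiv_X]
  ring

lemma euler_detX : euler detX = 2 * detX := by
  simp only [euler, Fin.sum_univ_two, Derivation.add_apply, Derivation.smul_apply, pderiv_detX,
    smul_eq_mul]
  simp
  simp only [detX]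
  ring

lemma euler_linForm_pow (c : Fin 2 → Fin 2 → ℂ) (m : ℕ) :
    euler (linForm c ^ m) = m * linForm c ^ m := by
  have h : euler (linForm c) = linForm c := by
    simp [euler, linForm, Fin.sum_univ_two, pderiv_X, smul_eq_C_mul]
    ring
  rw [Derivation.leibniz_pow, h]
  rcases m with _ | m
  · simp
  · rw [Nat.add_sub_cancel, smul_eq_mul, pow_succ, nsmul_eq_mul]

/-- A linear form with matrix of rank one. -/
def rankOne (α β : Fin 2 → ℂ) : S := linForm fun i j => α i * β j

/-- The second derivatives of the power produce the determinant of the coefficient matrix, which has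
rank at most one. -/
lemma detD_rankOne_pow (α β : Fin 2 → ℂ) (m : ℕ) : detD (rankOne α β ^ m) = 0 := by
  have h : ∀ i j, pderiv (i, j) (rankOne α β) = C (α i * β j) := by
    intro i j
    fin_cases i <;> fin_cases j <;>
      simp [rankOne, linForm, Fin.sum_univ_two, pderiv_X, smul_eq_C_mul]
  simp only [detD, Derivation.leibniz_pow, h, Derivation.leibniz, smul_eq_mul,
    pderiv_C, nsmul_eq_mul, map_mul, Derivation.map_natCast]
  ring

/-- The constant in the Cayley identity for `detX ^ k` times a harmonic polynomial of degree `m`. -/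
def cayleyConst (k m : ℕ) : ℝ := ∏ j ∈ Finset.range k, ((j : ℝ) + 1) * (j + m + 2)

lemma cayleyConst_pos (k m : ℕ) : 0 < cayleyConst k m :=
  Finset.prod_pos fun _ _ => by positivity

lemma euler_detX_pow_mul {F : S} {m : ℕ} (hE : euler F = m * F) (k : ℕ) :
    euler (detX ^ k * F) = (2 * k + m) * (detX ^ k * F) := by
  induction k with
  | zero => simp [hE]
  | succ k ih =>
    rw [pow_succ', mul_assoc, Derivation.leibniz, ih, euler_detX, smul_eq_mul, smul_eq_mul]
    push_cast
    ring

/-- Moving `detD` past the factors `detX` contributes 2j + m + 2 for each j ≤ k, by the commutator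
with `euler + 2`; the sum is (k + 1)(k + m + 2). -/
lemma detD_detX_pow_succ_mul {F : S} {m : ℕ} (hE : euler F = m * F) (hD : detD F = 0) (k : ℕ) :
    detD (detX ^ (k + 1) * F) = (((k : ℂ) + 1) * (k + m + 2)) • (detX ^ k * F) := by
  induction k with
  | zero =>
    rw [zero_add, pow_one, detD_detX_mul, hE, hD, smul_eq_C_mul]
    simp only [Nat.cast_zero, zero_add, one_mul, pow_zero, map_add, map_natCast, map_ofNat]
    ring
  | succ k ih =>
    rw [pow_succ', mul_assoc, detD_detX_mul, ih, euler_detX_pow_mul hE, smul_eq_C_mul,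
      smul_eq_C_mul]
    push_cast
    simp only [map_mul, map_add, map_natCast, map_one, map_ofNat]
    ring

lemma detD_iterate_detX_pow_mul {F : S} {m : ℕ} (hE : euler F = m * F) (hD : detD F = 0) (k : ℕ) :
    detD^[k] (detX ^ k * F) = (cayleyConst k m : ℂ) • F := by
  have hs : ∀ (k : ℕ) (c : ℂ) (q : S), detD^[k] (c • q) = c • detD^[k] q := by
    intro k c
    induction k with
    | zero => simp
    | succ k ih => intro q; rw [Function.iterate_succ_apply, detD_smul, ih,
        Function.iterate_succ_apply]
  induction k with
  | zero => simp [cayleyConst]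
  | succ k ih =>
    rw [Function.iterate_succ_apply, detD_detX_pow_succ_mul hE hD, hs, ih, smul_smul, cayleyConst,
      cayleyConst, Finset.prod_range_succ]
    push_cast
    congr 1
    ring

end
end Shimura

namespace Shimura
noncomputable section
open scoped Matrix BigOperators ComplexConjugate Nat
open MeasureTheory MvPolynomial

/-! ### The kernel of an irreducible submodule -/

/-- Vectors are linear combinations of the values of a polynomial curve with these coefficients. -/
lemma mem_of_curve_mem {M : Type*} [AddCommGroup M] [Module ℂ M] (V : Submodule ℂ M) (n : ℕ)
    (p : ℕ → M) (h : ∀ r : ℂ, ∑ i ∈ Finset.range n, r ^ i • p i ∈ V) {i : ℕ} (hi : i < n) :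
    p i ∈ V := by
  by_contra hp
  -- A functional that vanishes on `V` but not at `p i` turns the curve into a scalar polynomial
  -- that is identically zero, so its coefficient `f (p i)` is zero.
  obtain ⟨f, hf, hV⟩ := Submodule.exists_le_ker_of_notMem hp
  let P : Polynomial ℂ := ∑ i ∈ Finset.range n, Polynomial.monomial i (f (p i))
  have hP : P = 0 := by
    refine Polynomial.funext fun r => ?_
    have := hV (h r)
    rw [LinearMap.mem_ker, map_sum] at this
    rw [Polynomial.eval_zero, ← this, Polynomial.eval_finsetSum]
    refine Finset.sum_congr rfl fun i _ => ?_
    rw [Polynomial.eval_monomial, map_smul, smul_eq_mul, mul_comm]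
  refine hf ?_
  have := congrArg (fun q => q.coeff i) hP
  simpa [P, Polynomial.finsetSum_coeff, Polynomial.coeff_monomial, hi] using this

/-! ### Complete symmetric polynomials as traces on symmetric powers -/

section Trace

variable {A : Type*} [CommRing A]

/-- The complete homogeneous symmetric polynomials of the eigenvalues as traces on the symmetric
powers. -/
theorem sum_coeff_eq_hSym (a b c d : A) (m : ℕ) :
    ∑ i ∈ Finset.range (m + 1),
      ((Polynomial.C a + Polynomial.C c * Polynomial.X) ^ (m - i) *
        (Polynomial.C b + Polynomial.C d * Polynomial.X) ^ i).coeff i =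
      hSym (a + d) (a * d - b * c) m := by
  set u : Polynomial A := Polynomial.C a + Polynomial.C c * Polynomial.X with hu
  set w : Polynomial A := Polynomial.C b + Polynomial.C d * Polynomial.X with hw
  induction m using Nat.twoStepInduction with
  | zero => simp [hSym]
  | one => simp [hSym, Finset.sum_range_succ, hu, hw]
  | more m h1 h2 =>
    rw [hSym, ← h1, ← h2]
    -- `F i` is the diagonal entry number `i` of the symmetric power of degree m + 2. `P` and `Q`
    -- collect the contributions of the off-diagonal entries `c` and `b`; they cancel when `e1` and
    -- `e2` are summed.
    set F : ℕ → A := fun i => (u ^ (m + 2 - i) * w ^ i).coeff i with hF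
    set P : ℕ → A := fun i => c * (Polynomial.X * (u ^ (m + 1 - i) * w ^ i)).coeff i with hP
    set Q : ℕ → A := fun i => b * (u ^ (m + 1 - i) * w ^ i).coeff (i + 1) with hQ
    have e1 : ∀ i ∈ Finset.range (m + 1 + 1), (a + d) * (u ^ (m + 1 - i) * w ^ i).coeff i =
        F i + F (i + 1) - P i - Q i := by
      intro i hi
      have hi' : i < m + 2 := Finset.mem_range.1 hi
      obtain ⟨n, hn⟩ : ∃ n, m + 1 - i = n := ⟨_, rfl⟩
      have hn1 : m + 2 - i = n + 1 := by omega
      have hn2 : m + 2 - (i + 1) = n := by omega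
      simp only [hF, hP, hQ, hn, hn1, hn2]
      have ea : (u ^ (n + 1) * w ^ i).coeff i =
          a * (u ^ n * w ^ i).coeff i + c * (Polynomial.X * (u ^ n * w ^ i)).coeff i := by
        rw [← Polynomial.coeff_C_mul, ← Polynomial.coeff_C_mul, ← Polynomial.coeff_add]
        congr 1
        rw [hu]
        ring
      have ed : (u ^ n * w ^ (i + 1)).coeff (i + 1) =
          b * (u ^ n * w ^ i).coeff (i + 1) + d * (u ^ n * w ^ i).coeff i := by
        rw [← Polynomial.coeff_C_mul, ← Polynomial.coeff_C_mul,
          ← Polynomial.coeff_X_mul (Polynomial.C d * _), ← Polynomial.coeff_add]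
        congr 1
        rw [hw]
        ring
      rw [ea, ed]
      ring
    have e2 : ∀ j ∈ Finset.range (m + 1), F (j + 1) =
        P (j + 1) + Q j + (a * d - b * c) * (u ^ (m - j) * w ^ j).coeff j := by
      intro j hj
      have hj' : j < m + 1 := Finset.mem_range.1 hj
      obtain ⟨n, hn⟩ : ∃ n, m - j = n := ⟨_, rfl⟩
      have hn1 : m + 2 - (j + 1) = n + 1 := by omega
      have hn2 : m + 1 - (j + 1) = n := by omega
      have hn3 : m + 1 - j = n + 1 := by omega
      simp only [hF, hP, hQ, hn, hn1, hn2, hn3]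
      rw [← Polynomial.coeff_C_mul, ← Polynomial.coeff_C_mul, ← Polynomial.coeff_C_mul,
        ← Polynomial.coeff_X_mul (_ * (u ^ n * w ^ j)), ← Polynomial.coeff_add,
        ← Polynomial.coeff_add]
      congr 1
      rw [hu, hw]
      simp only [map_sub, map_mul]
      ring
    -- The two boundary terms of the cancellation vanish: a multiple of the variable has no constant
    -- term, and `w ^ (m + 1)` has degree at most m + 1.
    have e3 : P 0 = 0 := by simp [hP]
    have e4 : Q (m + 1) = 0 := by
      have : (w ^ (m + 1)).coeff (m + 1 + 1) = 0 := by
        refine Polynomial.coeff_eq_zero_of_natDegree_lt ?_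
        have h1 : w.natDegree ≤ 1 := by
          rw [hw, add_comm]
          exact Polynomial.natDegree_linear_le
        have h2 := Polynomial.natDegree_pow_le_of_le (m + 1) h1
        omega
      simp [hQ, this]
    rw [Finset.mul_sum, Finset.sum_congr rfl e1, Finset.mul_sum]
    simp only [Finset.sum_sub_distrib, Finset.sum_add_distrib]
    have e5 := Finset.sum_congr rfl e2
    simp only [Finset.sum_add_distrib] at e5
    rw [Finset.sum_range_succ F (m + 2), Finset.sum_range_succ (fun i => F (i + 1)) (m + 1), e5,
      Finset.sum_range_succ' P (m + 1), Finset.sum_range_succ Q (m + 1), e3, e4]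
    ring

end Trace

lemma AdK_X (k : K) (i j : Fin 2) : AdK k (X (i, j)) =
    ∑ p, ∑ q, (K.mat k (Sum.inl p) (Sum.inl i) * conj (K.mat k (Sum.inr q) (Sum.inr j))) •
      (X (p, q) : S) := by
  simp only [AdK, aeval_X, smul_eq_C_mul]
  refine Finset.sum_congr rfl fun p _ => Finset.sum_congr rfl fun q _ => ?_
  congr 2
  simp [pPlus, Matrix.mul_apply, Matrix.single, ite_and]

/-- Translates of the highest weight vector. -/
lemma AdK_hwVec (k : K) (l : ℕ × ℕ) : ∃ c : ℂ, AdK k (hwVec l) = c • (detX ^ l.2 *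
    rankOne (fun p => K.mat k (Sum.inl p) (Sum.inl 0))
      (fun q => conj (K.mat k (Sum.inr q) (Sum.inr 0))) ^ (l.1 - l.2)) ∧
    c = ((K.mat k (Sum.inl 0) (Sum.inl 0) * K.mat k (Sum.inl 1) (Sum.inl 1) -
      K.mat k (Sum.inl 0) (Sum.inl 1) * K.mat k (Sum.inl 1) (Sum.inl 0)) *
      conj (K.mat k (Sum.inr 0) (Sum.inr 0) * K.mat k (Sum.inr 1) (Sum.inr 1) -
      K.mat k (Sum.inr 0) (Sum.inr 1) * K.mat k (Sum.inr 1) (Sum.inr 0))) ^ l.2 := by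
  refine ⟨_, ?_, rfl⟩
  -- The image of `X (0, 0)` is the rank one form built from the first columns of the two blocks of
  -- `k`, while the determinant is only scaled.
  simp only [hwVec, map_mul, map_pow, map_sub, AdK_X]
  rw [mul_comm, rankOne, linForm, ← smul_mul_assoc, ← smul_pow]
  congr 2
  simp only [detX, Fin.sum_univ_two, smul_eq_C_mul, map_mul, map_sub]
  ring

/-- A matrix in `SU(2)` with given first column. -/
def su2 (α : Fin 2 → ℂ) : Matrix (Fin 2) (Fin 2) ℂ := !![α 0, -conj (α 1); α 1, conj (α 0)]

lemma su2_conjTranspose_mul {α : Fin 2 → ℂ} (h : ‖α 0‖ ^ 2 + ‖α 1‖ ^ 2 = 1) :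
    (su2 α)ᴴ * su2 α = 1 := by
  have h' : conj (α 0) * α 0 + conj (α 1) * α 1 = 1 := by
    rw [Complex.conj_mul', Complex.conj_mul']
    exact_mod_cast h
  ext i j
  fin_cases i <;> fin_cases j <;> simp [su2, Matrix.mul_apply, Fin.sum_univ_two]
  · exact h'
  · ring
  · ring
  · linear_combination h'

lemma su2_det {α : Fin 2 → ℂ} (h : ‖α 0‖ ^ 2 + ‖α 1‖ ^ 2 = 1) : (su2 α).det = 1 := by
  have h' : conj (α 0) * α 0 + conj (α 1) * α 1 = 1 := by
    rw [Complex.conj_mul', Complex.conj_mul']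
    exact_mod_cast h
  rw [Matrix.det_fin_two]
  simp [su2]
  linear_combination h'

lemma exists_K_of_unit {α β : Fin 2 → ℂ} (hα : ‖α 0‖ ^ 2 + ‖α 1‖ ^ 2 = 1)
    (hβ : ‖β 0‖ ^ 2 + ‖β 1‖ ^ 2 = 1) :
    ∃ k : K, K.mat k = Matrix.fromBlocks (su2 α) 0 0 (su2 β) := by
  have hd : (Matrix.fromBlocks (su2 α) 0 0 (su2 β)).det = 1 := by
    rw [Matrix.det_fromBlocks_zero₂₁, su2_det hα, su2_det hβ, one_mul]
  refine ⟨⟨⟨Matrix.fromBlocks (su2 α) 0 0 (su2 β), hd⟩, ?_, ?_⟩, rfl⟩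
  · change (Matrix.fromBlocks (su2 α) 0 0 (su2 β))ᴴ * J * Matrix.fromBlocks (su2 α) 0 0 (su2 β) = J
    rw [Matrix.fromBlocks_conjTranspose, J, Matrix.fromBlocks_multiply,
      Matrix.fromBlocks_multiply]
    simp [su2_conjTranspose_mul hα, su2_conjTranspose_mul hβ]
  · change (Matrix.fromBlocks (su2 α) 0 0 (su2 β))ᴴ * Matrix.fromBlocks (su2 α) 0 0 (su2 β) = 1
    rw [Matrix.fromBlocks_conjTranspose, Matrix.fromBlocks_multiply]
    simp [su2_conjTranspose_mul hα, su2_conjTranspose_mul hβ]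

/-- Only unit vectors occur as first columns of `SU(2)` matrices. Homogeneity of powers of rank one
forms removes this restriction; the zero vector takes the scalar 0. -/
lemma exists_unit_smul (α : Fin 2 → ℂ) : ∃ (r : ℂ) (α' : Fin 2 → ℂ), α = r • α' ∧
    ‖α' 0‖ ^ 2 + ‖α' 1‖ ^ 2 = 1 := by
  by_cases h : ‖α 0‖ ^ 2 + ‖α 1‖ ^ 2 = 0
  · refine ⟨0, ![1, 0], ?_, by simp⟩
    have h0 : ‖α 0‖ ^ 2 = 0 := by nlinarith [sq_nonneg ‖α 0‖, sq_nonneg ‖α 1‖]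
    have h1 : ‖α 1‖ ^ 2 = 0 := by nlinarith [sq_nonneg ‖α 0‖, sq_nonneg ‖α 1‖]
    funext i
    fin_cases i
    · simpa using h0
    · simpa using h1
  · have hp : 0 < ‖α 0‖ ^ 2 + ‖α 1‖ ^ 2 := lt_of_le_of_ne (by positivity) (Ne.symm h)
    set s := Real.sqrt (‖α 0‖ ^ 2 + ‖α 1‖ ^ 2) with hs
    have hs0 : 0 < s := Real.sqrt_pos.2 hp
    have hs2 : s ^ 2 = ‖α 0‖ ^ 2 + ‖α 1‖ ^ 2 := Real.sq_sqrt hp.le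
    refine ⟨s, (s : ℂ)⁻¹ • α, ?_, ?_⟩
    · rw [smul_smul, mul_inv_cancel₀ (by exact_mod_cast hs0.ne'), one_smul]
    · simp only [Pi.smul_apply, smul_eq_mul, norm_mul, norm_inv, Complex.norm_real,
        Real.norm_eq_abs, abs_of_pos hs0, mul_pow, inv_pow, ← mul_add, ← hs2]
      exact inv_mul_cancel₀ (by positivity)

/-- `W l` is spanned by products of powers of the determinant and of linear forms of rank one. -/
theorem W_eq_span (l : ℕ × ℕ) : W l = Submodule.span ℂ (Set.range fun p : (Fin 2 → ℂ) × (Fin 2 → ℂ) =>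
    detX ^ l.2 * rankOne p.1 p.2 ^ (l.1 - l.2)) := by
  refine le_antisymm (Submodule.span_le.2 ?_) (Submodule.span_le.2 ?_)
  · rintro _ ⟨k, rfl⟩
    obtain ⟨c, hc, -⟩ := AdK_hwVec k l
    change AdK k (hwVec l) ∈ _
    rw [hc]
    exact Submodule.smul_mem _ _ (Submodule.subset_span ⟨(_, _), rfl⟩)
  · rintro _ ⟨⟨α, β⟩, rfl⟩
    obtain ⟨r, α', hr, hα⟩ := exists_unit_smul α
    obtain ⟨s, β', hs, hβ⟩ := exists_unit_smul β
    -- The second vector is conjugated because the lower block acts through its conjugate; with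
    -- determinant one blocks the scalar of `AdK_hwVec` is 1.
    obtain ⟨k, hk⟩ := exists_K_of_unit (β := fun q => conj (β' q)) hα (by simpa using hβ)
    obtain ⟨c, hc, hc'⟩ := AdK_hwVec k l
    have hc1 : c = 1 := by
      have h1 := su2_det hα
      have h2 := su2_det (α := fun q => conj (β' q)) (by simpa using hβ)
      rw [Matrix.det_fin_two] at h1 h2
      rw [hc', hk]
      simp only [Matrix.fromBlocks_apply₁₁, Matrix.fromBlocks_apply₂₂]
      rw [h1, h2]
      simp
    have e : rankOne α β = (r * s) • rankOne α' β' := by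
      simp only [rankOne, linForm, Finset.smul_sum, smul_smul, hr, hs, Pi.smul_apply, smul_eq_mul]
      refine Finset.sum_congr rfl fun i _ => Finset.sum_congr rfl fun j _ => ?_
      congr 1
      ring
    have e' : rankOne (fun p => K.mat k (Sum.inl p) (Sum.inl 0))
        (fun q => conj (K.mat k (Sum.inr q) (Sum.inr 0))) = rankOne α' β' := by
      rw [hk]
      congr 1
      · funext i
        fin_cases i <;> simp [su2]
      · funext i
        fin_cases i <;> simp [su2]
    rw [hc1, one_smul, e'] at hc
    change detX ^ l.2 * rankOne α β ^ (l.1 - l.2) ∈ _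
    rw [e, smul_pow, mul_smul_comm, ← hc]
    exact Submodule.smul_mem _ _ (Submodule.subset_span ⟨k, rfl⟩)

end
end Shimura

/-! ### Reproducing kernels and the symbols of the Shimura operators -/

namespace Shimura
noncomputable section
open scoped Matrix BigOperators ComplexConjugate Nat
open MeasureTheory MvPolynomial

lemma map_hSym {A B : Type*} [CommRing A] [CommRing B] (f : A →+* B) (t d : A) (m : ℕ) :
    f (hSym t d m) = hSym (f t) (f d) m := by
  induction m using Nat.twoStepInduction with
  | zero => simp [hSym]
  | one => simp [hSym]
  | more m h1 h2 => simp [hSym, h1, h2]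

lemma hSym_zero_right {A : Type*} [CommRing A] (t : A) (m : ℕ) : hSym t 0 m = t ^ m := by
  induction m using Nat.twoStepInduction with
  | zero => simp [hSym]
  | one => simp [hSym]
  | more m h1 h2 =>
    rw [hSym, h2]
    ring

/-- The span of the `m`-th powers of linear forms of rank one. -/
def rankOneSpan (m : ℕ) : Submodule ℂ S :=
  Submodule.span ℂ (Set.range fun p : (Fin 2 → ℂ) × (Fin 2 → ℂ) => rankOne p.1 p.2 ^ m)

/-- The polynomial `hSym` of the eigenvalues of `z wᵀ`. -/
def kern (w : Fin 2 → Fin 2 → ℂ) (m : ℕ) : S :=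
  hSym (linForm w) ((w 0 0 * w 1 1 - w 0 1 * w 1 0) • detX) m

/-- With A = z wᵀ, the kernel is the trace of A on a symmetric power. By `sum_coeff_eq_hSym` this is
a sum of coefficients of ((A₀₀ + r A₁₀) + s (A₀₁ + r A₁₁))^m, and for all numbers r, s this is a
power of a rank one form. -/
theorem kern_mem (w : Fin 2 → Fin 2 → ℂ) (m : ℕ) : kern w m ∈ rankOneSpan m := by
  set A : Fin 2 → Fin 2 → S := fun i j => ∑ b, w j b • X (i, b) with hA
  have h1 : ∀ r s : ℂ, ((A 0 0 + r • A 1 0) + s • (A 0 1 + r • A 1 1)) ^ m ∈ rankOneSpan m := by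
    intro r s
    have : (A 0 0 + r • A 1 0) + s • (A 0 1 + r • A 1 1) =
        rankOne ![1, r] (fun b => w 0 b + s * w 1 b) := by
      simp only [hA, rankOne, linForm, Fin.sum_univ_two, smul_eq_C_mul, map_mul, map_add]
      simp
      ring
    rw [this]
    exact Submodule.subset_span ⟨(_, _), rfl⟩
  -- Coefficients are extracted first in s, here, and then in r, in `h4`; the binomial coefficient
  -- is invertible.
  have h2 : ∀ r : ℂ, ∀ i ∈ Finset.range (m + 1),
      (A 0 0 + r • A 1 0) ^ (m - i) * (A 0 1 + r • A 1 1) ^ i ∈ rankOneSpan m := by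
    intro r i hi
    have h3 := mem_of_curve_mem (rankOneSpan m) (m + 1)
      (fun i => (m.choose i : ℂ) • ((A 0 0 + r • A 1 0) ^ (m - i) * (A 0 1 + r • A 1 1) ^ i))
      (fun s => by
        convert h1 r s using 1
        rw [add_comm (A 0 0 + r • A 1 0), add_pow]
        refine Finset.sum_congr rfl fun i _ => ?_
        simp only [smul_eq_C_mul, mul_pow, map_pow, map_natCast]
        ring) (Finset.mem_range.1 hi)
    have hc : (m.choose i : ℂ) ≠ 0 :=
      Nat.cast_ne_zero.2 (Nat.choose_pos (Nat.lt_succ_iff.1 (Finset.mem_range.1 hi))).ne'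
    exact (Submodule.smul_mem_iff _ hc).1 h3
  set P : ℕ → Polynomial S := fun i =>
    (Polynomial.C (A 0 0) + Polynomial.C (A 1 0) * Polynomial.X) ^ (m - i) *
      (Polynomial.C (A 0 1) + Polynomial.C (A 1 1) * Polynomial.X) ^ i with hP
  have h4 : ∀ i ∈ Finset.range (m + 1), (P i).coeff i ∈ rankOneSpan m := by
    intro i hi
    have hd : (P i).natDegree < m + 1 := by
      have e1 := Polynomial.natDegree_pow_le_of_le (m - i)
        (Polynomial.natDegree_linear_le (a := A 1 0) (b := A 0 0))
      have e2 := Polynomial.natDegree_pow_le_of_le i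
        (Polynomial.natDegree_linear_le (a := A 1 1) (b := A 0 1))
      have e3 := Polynomial.natDegree_mul_le_of_le e1 e2
      have := Finset.mem_range.1 hi
      simp only [hP]
      rw [add_comm (Polynomial.C (A 0 0)), add_comm (Polynomial.C (A 0 1))]
      omega
    refine mem_of_curve_mem (rankOneSpan m) (m + 1) (fun j => (P i).coeff j) (fun r => ?_)
      (Finset.mem_range.1 hi)
    have e : (P i).eval (C r) = (A 0 0 + r • A 1 0) ^ (m - i) * (A 0 1 + r • A 1 1) ^ i := by
      simp only [hP, Polynomial.eval_mul, Polynomial.eval_pow, Polynomial.eval_add,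
        Polynomial.eval_C, Polynomial.eval_X, smul_eq_C_mul]
      ring
    rw [Polynomial.eval_eq_sum_range' hd] at e
    convert h2 r i hi using 1
    rw [← e]
    refine Finset.sum_congr rfl fun j _ => ?_
    rw [smul_eq_C_mul, map_pow, mul_comm]
  have h5 := sum_coeff_eq_hSym (A 0 0) (A 0 1) (A 1 0) (A 1 1) m
  have h6 : kern w m = hSym (A 0 0 + A 1 1) (A 0 0 * A 1 1 - A 0 1 * A 1 0) m := by
    rw [kern]
    congr 1
    · simp [hA, linForm, Fin.sum_univ_two]
    · simp only [hA, Fin.sum_univ_two, smul_eq_C_mul, map_sub, map_mul, detX]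
      ring
  rw [h6, ← h5]
  exact Submodule.sum_mem _ h4

lemma detD_of_mem {m : ℕ} {F : S} (hF : F ∈ rankOneSpan m) : detD F = 0 ∧ euler F = m * F := by
  induction hF using Submodule.span_induction with
  | mem x hx =>
    obtain ⟨⟨α, β⟩, rfl⟩ := hx
    exact ⟨detD_rankOne_pow α β m, euler_linForm_pow _ m⟩
  | zero => simp [detD]
  | add x y _ _ hx hy =>
    refine ⟨?_, by rw [map_add, hx.2, hy.2]; ring⟩
    have := hx.1
    have := hy.1
    simp only [detD, map_add] at *
    linear_combination hx.1 + hy.1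
  | smul c x _ hx => exact ⟨by rw [detD_smul, hx.1, smul_zero],
      by rw [Derivation.map_smul, hx.2, mul_smul_comm]⟩

lemma fock_linForm_pow_of_mem {m : ℕ} {F : S} (hF : F ∈ rankOneSpan m) (c : Fin 2 → Fin 2 → ℂ) :
    fock (linForm c ^ m) F = m ! * eval (fun ij => conj (c ij.1 ij.2)) F := by
  induction hF using Submodule.span_induction with
  | mem x hx =>
    obtain ⟨⟨α, β⟩, rfl⟩ := hx
    exact fock_linForm_pow c _ m
  | zero => simp [fock_zero_right]
  | add x y _ _ hx hy => rw [fock_add_right, hx, hy, map_add, mul_add]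
  | smul a x _ hx => rw [fock_smul_right, hx, smul_eval]; ring

/-- The reproducing kernel of `W l`, at the point `w` in antilinear coordinates. -/
def reproKernel (l : ℕ × ℕ) (w : Fin 2 → Fin 2 → ℂ) : S :=
  (w 0 0 * w 1 1 - w 0 1 * w 1 0) ^ l.2 • (detX ^ l.2 * kern w (l.1 - l.2))

lemma reproKernel_mem (l : ℕ × ℕ) (w : Fin 2 → Fin 2 → ℂ) : reproKernel l w ∈ W l := by
  refine Submodule.smul_mem _ _ ?_
  rw [W_eq_span]
  have h := kern_mem w (l.1 - l.2)
  generalize kern w (l.1 - l.2) = F at h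
  induction h using Submodule.span_induction with
  | mem x hx =>
    obtain ⟨⟨α, β⟩, rfl⟩ := hx
    exact Submodule.subset_span ⟨(α, β), rfl⟩
  | zero => simp
  | add x y _ _ hx hy => rw [mul_add]; exact add_mem hx hy
  | smul a x _ hx => rw [mul_smul_comm]; exact Submodule.smul_mem _ _ hx

/-- On a spanning vector the power of `detX` moves across as `detD`, and the Cayley identity turns
it into a constant. The remaining product with a power of a rank one form is an evaluation of
`kern`. -/
lemma fock_reproKernel (l : ℕ × ℕ) (w : Fin 2 → Fin 2 → ℂ) {f : S} (hf : f ∈ W l) :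
    fock f (reproKernel l w) = (cayleyConst l.2 (l.1 - l.2) * (l.1 - l.2)! : ℂ) *
      conj (eval (fun ij => conj (w ij.1 ij.2)) f) := by
  rw [W_eq_span] at hf
  induction hf using Submodule.span_induction with
  | mem x hx =>
    obtain ⟨⟨α, β⟩, rfl⟩ := hx
    have h := detD_of_mem (kern_mem w (l.1 - l.2))
    simp only
    rw [reproKernel, fock_smul_right, fock_detX_pow_mul, detD_iterate_detX_pow_mul h.2 h.1,
      fock_smul_right, rankOne, fock_linForm_pow_of_mem (kern_mem w _), kern, map_hSym]
    -- At a matrix of rank at most one the determinant vanishes, so `hSym` reduces to a power of the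
    -- trace.
    have e1 : eval (fun ij : Ix => conj (α ij.1 * β ij.2))
        ((w 0 0 * w 1 1 - w 0 1 * w 1 0) • detX) = 0 := by
      simp [detX, smul_eval]
      right
      ring
    have e2 : eval (fun ij : Ix => conj (α ij.1 * β ij.2)) (linForm w) =
        conj (eval (fun ij : Ix => conj (w ij.1 ij.2)) (linForm fun i j => α i * β j)) := by
      simp [linForm, Fin.sum_univ_two, smul_eval]
      ring
    have e3 : conj (eval (fun ij : Ix => conj (w ij.1 ij.2)) detX) =
        w 0 0 * w 1 1 - w 0 1 * w 1 0 := by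
      simp [detX]
    rw [e1, hSym_zero_right, e2, map_mul, map_mul, map_pow, map_pow, map_pow, map_pow, e3]
    ring
  | zero => simp [fock]
  | add x y _ _ hx hy => rw [fock_add_left, hx, hy, map_add, map_add, mul_add]
  | smul a x _ hx =>
    rw [fock_smul_left, hx, smul_eval, map_mul]
    ring

lemma IsONB.eq_sum {N : ℕ} {ξ : Fin N → S} {U : Submodule ℂ S} (h : IsONB ξ U) {f : S}
    (hf : f ∈ U) : f = ∑ a, fock (ξ a) f • ξ a := by
  rw [← h.1] at hf
  induction hf using Submodule.span_induction with
  | mem x hx =>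
    obtain ⟨b, rfl⟩ := hx
    simp [h.2]
  | zero => simp [fock_zero_right]
  | add x y _ _ hx hy =>
    simp only [fock_add_right, add_smul, Finset.sum_add_distrib]
    rw [← hx, ← hy]
  | smul a x _ hx =>
    simp only [fock_smul_right, mul_smul, ← Finset.smul_sum]
    rw [← hx]

/-- The normally ordered symbol of the Shimura operator. -/
theorem exists_symbol_eq (l : ℕ × ℕ) {N : ℕ} {ξ : Fin N → S} (h : IsONB ξ (W l)) :
    ∃ c : ℝ, 0 < c ∧ ∑ a, rename Sum.inr (map (starRingEnd ℂ) (ξ a)) * rename Sum.inl (ξ a) =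
      (c : ℂ) • (detS ^ l.2 * hSym trS detS (l.1 - l.2)) := by
  have hpos : 0 < cayleyConst l.2 (l.1 - l.2) * (l.1 - l.2)! :=
    mul_pos (cayleyConst_pos _ _) (by positivity)
  refine ⟨(cayleyConst l.2 (l.1 - l.2) * (l.1 - l.2)!)⁻¹, inv_pos.2 hpos, ?_⟩
  refine MvPolynomial.funext fun x => ?_
  set w : Fin 2 → Fin 2 → ℂ := fun i j => x (Sum.inr (i, j)) with hw
  -- Freeze the variables of `𝔭⁻` as `w` and expand the kernel at `w` in the orthonormal basis. By
  -- `fock_reproKernel` the coefficients are, up to the constant, the values at `w` of the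
  -- conjugated basis.
  have h1 := congrArg (eval fun ij => x (Sum.inl ij)) (h.eq_sum (reproKernel_mem l w))
  have h2 : eval x (detS ^ l.2 * hSym trS detS (l.1 - l.2)) =
      eval (fun ij => x (Sum.inl ij)) (reproKernel l w) := by
    have e1 : eval x trS = eval (fun ij => x (Sum.inl ij)) (linForm w) := by
      simp [trS, linForm, zv, vv, Fin.sum_univ_two, smul_eval, hw]
      ring
    have e2 : eval x detS = eval (fun ij => x (Sum.inl ij))
        ((w 0 0 * w 1 1 - w 0 1 * w 1 0) • detX) := by
      simp [detS, detZ, detV, detX, zv, vv, smul_eval, hw]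
      ring
    rw [reproKernel, kern, ← smul_mul_assoc, ← smul_pow, map_mul, map_mul, map_hSym, map_hSym,
      map_pow, map_pow, e1, e2]
  have h3 : ∀ a, eval (fun ij => x (Sum.inr ij)) (map (starRingEnd ℂ) (ξ a)) =
      conj (eval (fun ij : Ix => conj (w ij.1 ij.2)) (ξ a)) := by
    intro a
    rw [eval_map, eval, coe_eval₂Hom, eval₂_comp_left]
    congr 1
    funext ij
    simp [hw]
  rw [smul_eval, h2, h1, map_sum, map_sum, Finset.mul_sum]
  refine Finset.sum_congr rfl fun a _ => ?_
  have hm : ξ a ∈ W l := h.1 ▸ Submodule.subset_span ⟨a, rfl⟩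
  rw [smul_eval, fock_reproKernel l w hm, map_mul, eval_rename, eval_rename]
  change eval (fun ij => x (Sum.inr ij)) _ * eval (fun ij => x (Sum.inl ij)) _ = _
  rw [h3, ← mul_assoc, ← mul_assoc]
  have hc : (cayleyConst l.2 (l.1 - l.2) * (l.1 - l.2)! : ℂ) ≠ 0 := by exact_mod_cast hpos.ne'
  push_cast
  rw [inv_mul_cancel₀ hc, one_mul]

end
end Shimura

namespace Shimura
noncomputable section
open scoped Matrix BigOperators ComplexConjugate Nat ContDiff Topology
open MeasureTheory TopologicalSpace

/-! ### Left invariant vector fields on an open subset of a Banach algebra -/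

section InvariantFields

variable {𝔸 : Type*} [NormedRing 𝔸] [NormedAlgebra ℂ 𝔸] (U : Opens 𝔸)

/-- The algebra of holomorphic functions on an open subset of a Banach algebra. -/
def holo : Subalgebra ℂ (U → ℂ) where
  carrier := {f | ∃ F : 𝔸 → ℂ, ContDiffOn ℂ ∞ F U ∧ ∀ u : U, f u = F u}
  mul_mem' := by
    rintro f g ⟨F, hF, hf⟩ ⟨G, hG, hg⟩
    exact ⟨F * G, hF.mul hG, fun u => by simp [hf, hg]⟩
  add_mem' := by
    rintro f g ⟨F, hF, hf⟩ ⟨G, hG, hg⟩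
    exact ⟨F + G, hF.add hG, fun u => by simp [hf, hg]⟩
  algebraMap_mem' c := ⟨fun _ => c, contDiffOn_const, fun u => rfl⟩

variable {U}

/-- Extension of a function by zero. -/
def ext0 (f : U → ℂ) : 𝔸 → ℂ := Function.extend Subtype.val f 0

@[simp] lemma ext0_coe {𝔸 : Type*} [NormedRing 𝔸] {U : Opens 𝔸} (f : U → ℂ) (u : U) : ext0 f u = f u :=
  Subtype.val_injective.extend_apply _ _ _

lemma ext0_eq {𝔸 : Type*} [NormedRing 𝔸] {U : Opens 𝔸} (f : U → ℂ) {u : 𝔸} (hu : u ∈ U) :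
    ext0 f u = f ⟨u, hu⟩ := ext0_coe f ⟨u, hu⟩

lemma contDiffOn_ext0 (f : holo U) : ContDiffOn ℂ ∞ (ext0 (f : U → ℂ)) U := by
  obtain ⟨F, hF, hf⟩ := f.2
  exact hF.congr fun u hu => by rw [ext0_eq _ hu, hf]

lemma ext0_eventuallyEq {𝔸 : Type*} [NormedRing 𝔸] {U : Opens 𝔸} {f : U → ℂ} {F : 𝔸 → ℂ}
    (h : ∀ u : U, f u = F u) (u : U) :
    ext0 f =ᶠ[𝓝 (u : 𝔸)] F := by
  filter_upwards [U.isOpen.mem_nhds u.2] with v hv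
  rw [ext0_eq f hv, h]

lemma differentiableAt_ext0 (f : holo U) (u : U) : DifferentiableAt ℂ (ext0 (f : U → ℂ)) u :=
  ((contDiffOn_ext0 f).contDiffAt (U.isOpen.mem_nhds u.2)).differentiableAt (by simp)

/-- The left invariant vector field of `Z` on holomorphic functions. -/
def leftDeriv (Z : 𝔸) : Derivation ℂ (holo U) (holo U) :=
  Derivation.mk'
    { toFun := fun f => ⟨fun u => fderiv ℂ (ext0 (f : U → ℂ)) u (u * Z),
        fun v => fderiv ℂ (ext0 (f : U → ℂ)) v (v * Z),
        ((contDiffOn_ext0 f).fderiv_of_isOpen U.isOpen le_rfl).clm_apply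
          (contDiffOn_id.mul contDiffOn_const), fun _ => rfl⟩
      map_add' := fun f g => by
        ext u
        have h : ext0 ((f + g : holo U) : U → ℂ) =ᶠ[𝓝 (u : 𝔸)]
            ext0 (f : U → ℂ) + ext0 (g : U → ℂ) := ext0_eventuallyEq (by simp) u
        simp only [Subalgebra.coe_add, Pi.add_apply]
        rw [← Subalgebra.coe_add, h.fderiv_eq,
          fderiv_add (differentiableAt_ext0 f u) (differentiableAt_ext0 g u)]
        rfl
      map_smul' := fun c f => by
        ext u
        have h : ext0 ((c • f : holo U) : U → ℂ) =ᶠ[𝓝 (u : 𝔸)] c • ext0 (f : U → ℂ) :=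
          ext0_eventuallyEq (by simp) u
        simp only [SetLike.val_smul, Pi.smul_apply, RingHom.id_apply]
        rw [← SetLike.val_smul, h.fderiv_eq, fderiv_const_smul (differentiableAt_ext0 f u)]
        rfl }
    fun f g => by
      ext u
      have h : ext0 ((f * g : holo U) : U → ℂ) =ᶠ[𝓝 (u : 𝔸)]
          ext0 (f : U → ℂ) * ext0 (g : U → ℂ) := ext0_eventuallyEq (by simp) u
      simp only [LinearMap.coe_mk, AddHom.coe_mk, smul_eq_mul, Subalgebra.coe_add,
        Subalgebra.coe_mul, Pi.add_apply, Pi.mul_apply]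
      rw [← Subalgebra.coe_mul, h.fderiv_eq,
        fderiv_mul (differentiableAt_ext0 f u) (differentiableAt_ext0 g u)]
      simp

lemma leftDeriv_apply (Z : 𝔸) (f : holo U) (u : U) :
    (leftDeriv Z f : U → ℂ) u = fderiv ℂ (ext0 (f : U → ℂ)) u (u * Z) := rfl

lemma leftDeriv_eq (Z : 𝔸) (f : holo U) (u : U) {F : 𝔸 → ℂ} (h : ∀ u : U, (f : U → ℂ) u = F u)
    {F' : 𝔸 →L[ℂ] ℂ} (hF : HasFDerivAt F F' u) : (leftDeriv Z f : U → ℂ) u = F' (u * Z) := by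
  rw [leftDeriv_apply, (ext0_eventuallyEq h u).fderiv_eq, hF.fderiv]

lemma leftDeriv_add (Z Z' : 𝔸) (f : holo U) :
    leftDeriv (Z + Z') f = leftDeriv Z f + leftDeriv Z' f := by
  ext u
  simp [leftDeriv_apply, mul_add]

lemma leftDeriv_smul (c : ℂ) (Z : 𝔸) (f : holo U) :
    leftDeriv (c • Z) f = c • leftDeriv Z f := by
  ext u
  simp [leftDeriv_apply]

lemma leftDeriv_sub (Z Z' : 𝔸) (f : holo U) :
    leftDeriv (Z - Z') f = leftDeriv Z f - leftDeriv Z' f := by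
  ext u
  simp [leftDeriv_apply, mul_sub]

lemma leftDeriv_zero (f : holo U) : leftDeriv (0 : 𝔸) f = 0 := by
  ext u
  simp [leftDeriv_apply]

/-- The commutator of left invariant vector fields. -/
theorem leftDeriv_comm (Z Z' : 𝔸) (f : holo U) : leftDeriv Z (leftDeriv Z' f) =
    leftDeriv Z' (leftDeriv Z f) + leftDeriv (Z * Z' - Z' * Z) f := by
  ext u
  have hf := (contDiffOn_ext0 f).contDiffAt (U.isOpen.mem_nhds u.2)
  have hd : DifferentiableAt ℂ (fderiv ℂ (ext0 (f : U → ℂ))) u :=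
    (hf.fderiv_right (m := 1) (by norm_cast)).differentiableAt (by simp)
  have h2 : ∀ Z Z' : 𝔸, (leftDeriv Z (leftDeriv Z' f) : U → ℂ) u =
      fderiv ℂ (fderiv ℂ (ext0 (f : U → ℂ))) u (u * Z) (u * Z') +
        fderiv ℂ (ext0 (f : U → ℂ)) u (u * Z * Z') := by
    intro Z Z'
    have hm : HasFDerivAt (fun v : 𝔸 => v * Z') ((ContinuousLinearMap.mul ℂ 𝔸).flip Z') (u : 𝔸) :=
      ((ContinuousLinearMap.mul ℂ 𝔸).flip Z').hasFDerivAt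
    rw [leftDeriv_eq Z (leftDeriv Z' f) u (fun v => leftDeriv_apply Z' f v)
      (hd.hasFDerivAt.clm_apply hm)]
    simp
    ring
  -- The symmetric second derivative cancels in the commutator; only the derivative of the moving
  -- direction `u * Z` survives.
  have hs := (hf.isSymmSndFDerivAt (by
    rw [minSmoothness_of_isRCLikeNormedField]; exact WithTop.coe_le_coe.2 le_top)).eq (u * Z) (u * Z')
  have e : (leftDeriv (Z * Z' - Z' * Z) f : U → ℂ) u =
      fderiv ℂ (ext0 (f : U → ℂ)) u (u * Z * Z') - fderiv ℂ (ext0 (f : U → ℂ)) u (u * Z' * Z) := by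
    rw [leftDeriv_apply, mul_sub, map_sub, mul_assoc, mul_assoc]
  simp only [Subalgebra.coe_add, Pi.add_apply]
  rw [e, h2, h2, hs]
  ring

end InvariantFields

end
end Shimura

namespace Shimura
noncomputable section
open scoped Matrix BigOperators ComplexConjugate Nat ContDiff Topology
open MeasureTheory TopologicalSpace

/-! ### The power functions as eigenvectors: algebra -/

section Frames

variable {A : Type*} [CommRing A] [Algebra ℂ A]

/-- The Cayley identity for power functions of `2 × 2` matrices. -/
lemma cayley_power (E : Fin 2 → Fin 2 → Derivation ℂ A A) (m p q : Fin 2 → Fin 2 → A)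
    (i₁ i₂ f : A) (a b : ℂ) (hm : ∀ i j s t, E i j (m s t) = p s i * q j t)
    (hp : ∀ i j s t, E i j (p s t) = 0) (hq : ∀ i j s t, E i j (q s t) = 0)
    (h₁ : m 0 0 * i₁ = 1) (h₂ : (m 0 0 * m 1 1 - m 0 1 * m 1 0) * i₂ = 1)
    (hf : ∀ i j, E i j f =
      f * (a • (i₁ * E i j (m 0 0)) + b • (i₂ * E i j (m 0 0 * m 1 1 - m 0 1 * m 1 0)))) :
    E 0 0 (E 1 1 f) - E 0 1 (E 1 0 f) = (b * (a + b + 1)) •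
      ((p 0 0 * p 1 1 - p 0 1 * p 1 0) * (q 0 0 * q 1 1 - q 0 1 * q 1 0) * i₂ * f) := by
  have hi : ∀ (D : Derivation ℂ A A) {x y : A}, x * y = 1 → D y = -(y ^ 2 * D x) := by
    intro D x y h
    have h0 := congrArg D h
    rw [Derivation.leibniz, Derivation.map_one_eq_zero, smul_eq_mul, smul_eq_mul] at h0
    linear_combination y * h0 - (D y) * h
  have hΔ : ∀ i j, E i j (m 0 0 * m 1 1 - m 0 1 * m 1 0) = p 0 i * q j 0 * m 1 1 +
      m 0 0 * (p 1 i * q j 1) - p 0 i * q j 1 * m 1 0 - m 0 1 * (p 1 i * q j 0) := by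
    intro i j
    simp only [map_sub, Derivation.leibniz, hm, smul_eq_mul]
    ring
  have h1 := fun i j => hi (E i j) h₁
  have h2 := fun i j => hi (E i j) h₂
  simp only [hm, hΔ] at h1 h2 hf
  simp only [hf, Derivation.leibniz, map_add, map_sub, hm, hp, hq, h1, h2,
    smul_eq_mul, Algebra.smul_def, map_mul, map_add, map_one, mul_zero, add_zero,
    zero_add, Derivation.map_algebraMap]
  set a' := algebraMap ℂ A a
  set b' := algebraMap ℂ A b
  set P := p 0 0 * p 1 1 - p 0 1 * p 1 0 with hP
  set Q := q 0 0 * q 1 1 - q 0 1 * q 1 0 with hQ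
  linear_combination (a' * b' * i₂ * P * Q * f) * h₁ + ((b' ^ 2 - b') * i₂ * P * Q * f) * h₂

/-- Two pairs of `2 × 2` matrices `B₁`, `B₂` and `C₁`, `C₂` of functions, and derivations `X i j`,
`Y i j` that act on them like the matrix units of `𝔭⁺` and `𝔭⁻`. -/
structure FrameDerivations (X Y : Fin 2 → Fin 2 → Derivation ℂ A A)
    (B₁ B₂ C₁ C₂ : Fin 2 → Fin 2 → A) : Prop where
  XB₁ : ∀ i j s t, X i j (B₁ s t) = 0
  XC₁ : ∀ i j s t, X i j (C₁ s t) = -(if i = s then C₂ j t else 0)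
  XC₂ : ∀ i j s t, X i j (C₂ s t) = 0
  YB₁ : ∀ i j s t, Y i j (B₁ s t) = if i = t then B₂ s j else 0
  YB₂ : ∀ i j s t, Y i j (B₂ s t) = 0
  YC₁ : ∀ i j s t, Y i j (C₁ s t) = 0
  YC₂ : ∀ i j s t, Y i j (C₂ s t) = -(if j = s then C₁ i t else 0)
  rel : ∀ s t, B₁ s 0 * C₁ 0 t + B₁ s 1 * C₁ 1 t = -(B₂ s 0 * C₂ 0 t + B₂ s 1 * C₂ 1 t)

/-- The product of two `2 × 2` matrices. -/
def frameMul (B C : Fin 2 → Fin 2 → A) (s t : Fin 2) : A := B s 0 * C 0 t + B s 1 * C 1 t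

/-- The determinant of a `2 × 2` matrix. -/
def frameDet (m : Fin 2 → Fin 2 → A) : A := m 0 0 * m 1 1 - m 0 1 * m 1 0

lemma frameDet_mul {A : Type*} [CommRing A] (B C : Fin 2 → Fin 2 → A) :
    frameDet (frameMul B C) = frameDet B * frameDet C := by
  simp only [frameDet, frameMul]
  ring

namespace FrameDerivations

variable {X Y : Fin 2 → Fin 2 → Derivation ℂ A A} {B₁ B₂ C₁ C₂ : Fin 2 → Fin 2 → A}

lemma X_mul (h : FrameDerivations X Y B₁ B₂ C₁ C₂) (i j s t : Fin 2) :
    X i j (frameMul B₁ C₁ s t) = -(B₁ s i * C₂ j t) := by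
  simp only [frameMul, map_add, Derivation.leibniz, h.XB₁, h.XC₁, smul_eq_mul]
  fin_cases i <;> simp

lemma Y_mul (h : FrameDerivations X Y B₁ B₂ C₁ C₂) (i j s t : Fin 2) :
    Y i j (frameMul B₁ C₁ s t) = B₂ s j * C₁ i t := by
  simp only [frameMul, map_add, Derivation.leibniz, h.YB₁, h.YC₁, smul_eq_mul]
  fin_cases i <;> simp [mul_comm]

lemma mul_eq (h : FrameDerivations X Y B₁ B₂ C₁ C₂) (s t : Fin 2) :
    frameMul B₁ C₁ s t = -frameMul B₂ C₂ s t := h.rel s t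

lemma det_eq (h : FrameDerivations X Y B₁ B₂ C₁ C₂) :
    frameDet (frameMul B₁ C₁) = frameDet B₂ * frameDet C₂ := by
  rw [← frameDet_mul]
  simp only [frameDet, h.mul_eq]
  ring

lemma X_det (h : FrameDerivations X Y B₁ B₂ C₁ C₂) (i j : Fin 2) :
    X i j (frameDet (frameMul B₁ C₁)) =
      -(B₁ 0 i * C₂ j 0 * frameMul B₁ C₁ 1 1 + frameMul B₁ C₁ 0 0 * (B₁ 1 i * C₂ j 1) -
        B₁ 0 i * C₂ j 1 * frameMul B₁ C₁ 1 0 - frameMul B₁ C₁ 0 1 * (B₁ 1 i * C₂ j 0)) := by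
  simp only [frameDet, map_sub, Derivation.leibniz, h.X_mul, smul_eq_mul]
  ring

lemma Y_det (h : FrameDerivations X Y B₁ B₂ C₁ C₂) (i j : Fin 2) :
    Y i j (frameDet (frameMul B₁ C₁)) =
      B₂ 0 j * C₁ i 0 * frameMul B₁ C₁ 1 1 + frameMul B₁ C₁ 0 0 * (B₂ 1 j * C₁ i 1) -
        B₂ 0 j * C₁ i 1 * frameMul B₁ C₁ 1 0 - frameMul B₁ C₁ 0 1 * (B₂ 1 j * C₁ i 0) := by
  simp only [frameDet, map_sub, Derivation.leibniz, h.Y_mul, smul_eq_mul]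
  ring

/-- This and the next four lemmas are the first and second order data of the two minors used in
`casimir_power`. The sums produce both `B₁ C₁` and `-B₂ C₂`, which `rel` identifies. -/
lemma sum_YX_mul (h : FrameDerivations X Y B₁ B₂ C₁ C₂) :
    ∑ i, ∑ j, Y i j (X i j (frameMul B₁ C₁ 0 0)) = 4 * frameMul B₁ C₁ 0 0 := by
  have e : ∑ i, ∑ j, Y i j (X i j (frameMul B₁ C₁ 0 0)) =
      2 * frameMul B₁ C₁ 0 0 + 2 * -frameMul B₂ C₂ 0 0 := by
    simp only [h.X_mul, map_neg, Derivation.leibniz, h.YB₁, h.YC₂, Fin.sum_univ_two, smul_eq_mul]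
    simp [frameMul]
    ring
  rw [e, ← h.mul_eq]
  ring

lemma sum_Y_mul_X_mul (h : FrameDerivations X Y B₁ B₂ C₁ C₂) :
    ∑ i, ∑ j, Y i j (frameMul B₁ C₁ 0 0) * X i j (frameMul B₁ C₁ 0 0) =
      frameMul B₁ C₁ 0 0 ^ 2 := by
  have e : ∑ i, ∑ j, Y i j (frameMul B₁ C₁ 0 0) * X i j (frameMul B₁ C₁ 0 0) =
      frameMul B₁ C₁ 0 0 * -frameMul B₂ C₂ 0 0 := by
    simp only [h.X_mul, h.Y_mul, Fin.sum_univ_two]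
    simp only [frameMul]
    ring
  rw [e, ← h.mul_eq]
  ring

lemma sum_Y_mul_X_det (h : FrameDerivations X Y B₁ B₂ C₁ C₂) :
    ∑ i, ∑ j, (Y i j (frameMul B₁ C₁ 0 0) * X i j (frameDet (frameMul B₁ C₁)) +
      Y i j (frameDet (frameMul B₁ C₁)) * X i j (frameMul B₁ C₁ 0 0)) =
      2 * frameMul B₁ C₁ 0 0 * frameDet (frameMul B₁ C₁) := by
  have e : ∑ i, ∑ j, (Y i j (frameMul B₁ C₁ 0 0) * X i j (frameDet (frameMul B₁ C₁)) +
      Y i j (frameDet (frameMul B₁ C₁)) * X i j (frameMul B₁ C₁ 0 0)) =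
      2 * -frameMul B₂ C₂ 0 0 * frameDet (frameMul B₁ C₁) := by
    simp only [h.X_mul, h.Y_mul, h.X_det, h.Y_det, Fin.sum_univ_two]
    simp only [frameMul, frameDet]
    ring
  rw [e, ← h.mul_eq]

lemma sum_Y_det_mul_X_det (h : FrameDerivations X Y B₁ B₂ C₁ C₂) :
    ∑ i, ∑ j, Y i j (frameDet (frameMul B₁ C₁)) * X i j (frameDet (frameMul B₁ C₁)) =
      2 * frameDet (frameMul B₁ C₁) ^ 2 := by
  have e : ∑ i, ∑ j, Y i j (frameDet (frameMul B₁ C₁)) * X i j (frameDet (frameMul B₁ C₁)) =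
      frameDet (frameMul B₁ C₁) * (-frameMul B₂ C₂ 0 0 * frameMul B₁ C₁ 1 1 +
        frameMul B₁ C₁ 0 0 * -frameMul B₂ C₂ 1 1 - -frameMul B₂ C₂ 0 1 * frameMul B₁ C₁ 1 0 -
        frameMul B₁ C₁ 0 1 * -frameMul B₂ C₂ 1 0) := by
    simp only [h.X_det, h.Y_det, Fin.sum_univ_two]
    simp only [frameMul, frameDet]
    ring
  rw [e]
  simp only [← h.mul_eq, frameDet]
  ring

lemma sum_YX_det (h : FrameDerivations X Y B₁ B₂ C₁ C₂) :
    ∑ i, ∑ j, Y i j (X i j (frameDet (frameMul B₁ C₁))) = 6 * frameDet (frameMul B₁ C₁) := by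
  have e : ∑ i, ∑ j, Y i j (X i j (frameDet (frameMul B₁ C₁))) =
      4 * frameDet (frameMul B₁ C₁) + (-frameMul B₂ C₂ 0 0 * frameMul B₁ C₁ 1 1 +
        frameMul B₁ C₁ 0 0 * -frameMul B₂ C₂ 1 1 - -frameMul B₂ C₂ 0 1 * frameMul B₁ C₁ 1 0 -
        frameMul B₁ C₁ 0 1 * -frameMul B₂ C₂ 1 0) := by
    simp only [h.X_det, map_neg, map_sub, map_add, Derivation.leibniz, h.YB₁, h.YC₂, h.Y_mul,
      Fin.sum_univ_two, smul_eq_mul]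
    simp [frameMul, frameDet]
    ring
  rw [e]
  simp only [← h.mul_eq, frameDet]
  ring

/-- The second order invariant operator on power functions. -/
theorem casimir_power (h : FrameDerivations X Y B₁ B₂ C₁ C₂) (i₁ i₂ f : A) (a b : ℂ)
    (h₁ : frameMul B₁ C₁ 0 0 * i₁ = 1) (h₂ : frameDet (frameMul B₁ C₁) * i₂ = 1)
    (hX : ∀ i j, X i j f = f * (a • (i₁ * X i j (frameMul B₁ C₁ 0 0)) +
      b • (i₂ * X i j (frameDet (frameMul B₁ C₁)))))
    (hY : ∀ i j, Y i j f = f * (a • (i₁ * Y i j (frameMul B₁ C₁ 0 0)) +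
      b • (i₂ * Y i j (frameDet (frameMul B₁ C₁))))) :
    ∑ i, ∑ j, Y i j (X i j f) =
      ((a + b) * (a + b + 3) + b * (b + 1)) • f := by
  have hi : ∀ (D : Derivation ℂ A A) {x y : A}, x * y = 1 → D y = -(y ^ 2 * D x) := by
    intro D x y h
    have h0 := congrArg D h
    rw [Derivation.leibniz, Derivation.map_one_eq_zero, smul_eq_mul, smul_eq_mul] at h0
    linear_combination y * h0 - (D y) * h
  have k1 := h.sum_YX_mul
  have k2 := h.sum_Y_mul_X_mul
  have k3 := h.sum_Y_mul_X_det
  have k4 := h.sum_Y_det_mul_X_det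
  have k5 := h.sum_YX_det
  set m := frameMul B₁ C₁ 0 0
  set d := frameDet (frameMul B₁ C₁)
  -- The second derivative of Δ₁^a Δ₂^b, sorted by powers of `i₁` and `i₂` so that the five sums can
  -- be inserted.
  have e : ∀ i j, Y i j (X i j f) = f * (algebraMap ℂ A a * i₁ * Y i j (X i j m) +
      (algebraMap ℂ A a ^ 2 - algebraMap ℂ A a) * i₁ ^ 2 * (Y i j m * X i j m) +
      algebraMap ℂ A a * algebraMap ℂ A b * i₁ * i₂ * (Y i j m * X i j d + Y i j d * X i j m) +
      (algebraMap ℂ A b ^ 2 - algebraMap ℂ A b) * i₂ ^ 2 * (Y i j d * X i j d) +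
      algebraMap ℂ A b * i₂ * Y i j (X i j d)) := by
    intro i j
    have e1 := hi (Y i j) h₁
    have e2 := hi (Y i j) h₂
    simp only [hX, Derivation.leibniz, map_add, hY, e1, e2, smul_eq_mul, Algebra.smul_def,
      Derivation.map_algebraMap]
    ring
  simp only [e, ← Finset.mul_sum, Finset.sum_add_distrib] at k3 ⊢
  rw [k1, k2, k3, k4, k5, Algebra.smul_def]
  simp only [map_add, map_mul, map_ofNat, map_one]
  set a' := algebraMap ℂ A a
  set b' := algebraMap ℂ A b
  linear_combination (f * (4 * a' + (a' ^ 2 - a') * (m * i₁ + 1) + 2 * a' * b' * d * i₂)) * h₁ +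
    (f * (6 * b' + (b' ^ 2 - b') * 2 * (d * i₂ + 1) + 2 * a' * b')) * h₂

/-- The quotient of determinants that is shifted by the operators with symbol a determinant. -/
def shift (B₁ C₂ : Fin 2 → Fin 2 → A) (i₂ : A) : A := frameDet B₁ * frameDet C₂ * i₂

lemma derivation_frameDet_eq_zero (D : Derivation ℂ A A) {m : Fin 2 → Fin 2 → A}
    (hm : ∀ s t, D (m s t) = 0) : D (frameDet m) = 0 := by
  simp [frameDet, Derivation.leibniz, hm]

/-- The fields of `𝔭⁺` kill `frameDet B₁` and `frameDet C₂`, so for them `shift` behaves like the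
inverse of the second minor. -/
lemma X_shift (h : FrameDerivations X Y B₁ B₂ C₁ C₂) {i₂ : A}
    (h₂ : frameDet (frameMul B₁ C₁) * i₂ = 1) (i j : Fin 2) : X i j (shift B₁ C₂ i₂) =
      -(shift B₁ C₂ i₂ * (i₂ * X i j (frameDet (frameMul B₁ C₁)))) := by
  have h0 := congrArg (X i j) h₂
  rw [Derivation.leibniz, Derivation.map_one_eq_zero, smul_eq_mul, smul_eq_mul] at h0
  rw [shift, Derivation.leibniz, Derivation.leibniz, derivation_frameDet_eq_zero _ (h.XB₁ i j),
    derivation_frameDet_eq_zero _ (h.XC₂ i j)]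
  simp only [smul_eq_mul]
  linear_combination (frameDet B₁ * frameDet C₂ * i₂) * h0 -
    (frameDet B₁ * frameDet C₂ * X i j i₂) * h₂

/-- The second minor equals both det B₁ det C₁ and det B₂ det C₂. Hence `shift` is also the minor
divided by det C₁ det B₂, stated here without division. -/
lemma shift_mul (h : FrameDerivations X Y B₁ B₂ C₁ C₂) {i₂ : A}
    (h₂ : frameDet (frameMul B₁ C₁) * i₂ = 1) :
    shift B₁ C₂ i₂ * (frameDet C₁ * frameDet B₂) = frameDet (frameMul B₁ C₁) := by
  have e1 := frameDet_mul B₁ C₁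
  have e2 := h.det_eq
  rw [shift]
  set d := frameDet (frameMul B₁ C₁)
  linear_combination (-(i₂ * frameDet B₂ * frameDet C₂)) * e1 - d * i₂ * e2 + d * h₂

/-- In the form of `shift_mul`, the other factors are killed by the fields of `𝔭⁻`, so for them
`shift` behaves like the second minor itself. This asymmetry makes the exponents move in opposite
directions. -/
lemma Y_shift (h : FrameDerivations X Y B₁ B₂ C₁ C₂) {i₂ : A}
    (h₂ : frameDet (frameMul B₁ C₁) * i₂ = 1) (i j : Fin 2) : Y i j (shift B₁ C₂ i₂) =
      shift B₁ C₂ i₂ * (i₂ * Y i j (frameDet (frameMul B₁ C₁))) := by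
  have h0 := congrArg (Y i j) (h.shift_mul h₂)
  rw [Derivation.leibniz, Derivation.leibniz, derivation_frameDet_eq_zero _ (h.YB₂ i j),
    derivation_frameDet_eq_zero _ (h.YC₁ i j)] at h0
  simp only [smul_eq_mul] at h0
  linear_combination (shift B₁ C₂ i₂ * i₂) * h0 - (i₂ * Y i j (shift B₁ C₂ i₂)) * h.shift_mul h₂ -
    Y i j (shift B₁ C₂ i₂) * h₂

lemma derivation_shift_pow_mul (D : Derivation ℂ A A) {θ f u v : A} {a b c : ℂ}
    (hθ : D θ = θ * (c • v)) (hf : D f = f * (a • u + b • v)) (k : ℕ) :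
    D (θ ^ k * f) = θ ^ k * f * (a • u + (b + k * c) • v) := by
  rw [Derivation.leibniz, Derivation.leibniz_pow, hθ, hf]
  rcases k with _ | k
  · simp
  · rw [nsmul_eq_mul]
    simp only [smul_eq_mul, Algebra.smul_def, map_add, map_mul, Nat.add_sub_cancel, map_natCast]
    ring

/-- The operator with symbol `detZ ^ k` on power functions. -/
theorem detX_pow_power (h : FrameDerivations X Y B₁ B₂ C₁ C₂) (i₁ i₂ f : A) (a b : ℂ)
    (h₁ : frameMul B₁ C₁ 0 0 * i₁ = 1) (h₂ : frameDet (frameMul B₁ C₁) * i₂ = 1)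
    (hX : ∀ i j, X i j f = f * (a • (i₁ * X i j (frameMul B₁ C₁ 0 0)) +
      b • (i₂ * X i j (frameDet (frameMul B₁ C₁))))) (k : ℕ) :
    X 0 0 (X 1 1 (shift B₁ C₂ i₂ ^ k * f)) - X 0 1 (X 1 0 (shift B₁ C₂ i₂ ^ k * f)) =
      ((b - k) * (a + b + 1 - k)) • (shift B₁ C₂ i₂ ^ (k + 1) * f) := by
  have hf : ∀ i j, X i j (shift B₁ C₂ i₂ ^ k * f) = shift B₁ C₂ i₂ ^ k * f *
      (a • (i₁ * X i j (frameMul B₁ C₁ 0 0)) +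
        (b + k * (-1)) • (i₂ * X i j (frameDet (frameMul B₁ C₁)))) := fun i j =>
    derivation_shift_pow_mul (X i j) (by rw [h.X_shift h₂]; simp) (hX i j) k
  -- The minus sign of `X_mul` goes into `B₁`; a 2 × 2 determinant does not see it.
  have hp : ∀ i j s t, X i j ((fun s t => -B₁ s t) s t) = 0 := fun i j s t => by simp [h.XB₁]
  have := cayley_power X (frameMul B₁ C₁) (fun s t => -B₁ s t) C₂ i₁ i₂ _ a (b + k * (-1))
    (fun i j s t => by rw [h.X_mul]; ring) hp h.XC₂ h₁ h₂ hf
  rw [this]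
  have e : (-B₁ 0 0 * -B₁ 1 1 - -B₁ 0 1 * -B₁ 1 0) * (C₂ 0 0 * C₂ 1 1 - C₂ 0 1 * C₂ 1 0) * i₂ *
      (shift B₁ C₂ i₂ ^ k * f) = shift B₁ C₂ i₂ ^ (k + 1) * f := by
    rw [pow_succ']
    simp only [shift, frameDet]
    ring
  rw [e]
  congr 1
  ring

/-- The operator with symbol `detV ^ k` on power functions. -/
theorem detY_pow_power (h : FrameDerivations X Y B₁ B₂ C₁ C₂) (i₁ i₂ f : A) (a b : ℂ)
    (h₁ : frameMul B₁ C₁ 0 0 * i₁ = 1) (h₂ : frameDet (frameMul B₁ C₁) * i₂ = 1)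
    (hY : ∀ i j, Y i j f = f * (a • (i₁ * Y i j (frameMul B₁ C₁ 0 0)) +
      b • (i₂ * Y i j (frameDet (frameMul B₁ C₁))))) (k : ℕ) :
    Y 0 0 (Y 1 1 (shift B₁ C₂ i₂ ^ (k + 1) * f)) - Y 1 0 (Y 0 1 (shift B₁ C₂ i₂ ^ (k + 1) * f)) =
      ((b + (k + 1)) * (a + b + 1 + (k + 1))) • (shift B₁ C₂ i₂ ^ k * f) := by
  have hf : ∀ i j, Y j i (shift B₁ C₂ i₂ ^ (k + 1) * f) = shift B₁ C₂ i₂ ^ (k + 1) * f *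
      (a • (i₁ * Y j i (frameMul B₁ C₁ 0 0)) +
        (b + (k + 1 : ℕ) * 1) • (i₂ * Y j i (frameDet (frameMul B₁ C₁)))) := fun i j =>
    derivation_shift_pow_mul (Y j i) (by rw [h.Y_shift h₂]; simp) (hY j i) (k + 1)
  -- `Y i j` replaces column `i` of `B₁` by column `j` of `B₂`, so the indices are transposed
  -- relative to `X`.
  have := cayley_power (fun i j => Y j i) (frameMul B₁ C₁) B₂ C₁ i₁ i₂ _ a (b + (k + 1 : ℕ) * 1)
    (fun i j s t => by rw [h.Y_mul]) (fun i j => h.YB₂ j i) (fun i j => h.YC₁ j i) h₁ h₂ hf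
  rw [this]
  have e : (B₂ 0 0 * B₂ 1 1 - B₂ 0 1 * B₂ 1 0) * (C₁ 0 0 * C₁ 1 1 - C₁ 0 1 * C₁ 1 0) * i₂ *
      (shift B₁ C₂ i₂ ^ (k + 1) * f) = shift B₁ C₂ i₂ ^ k * f := by
    have h3 := h.shift_mul h₂
    rw [pow_succ]
    simp only [frameDet] at h3 h₂ ⊢
    linear_combination (i₂ * shift B₁ C₂ i₂ ^ k * f) * h3 + (shift B₁ C₂ i₂ ^ k * f) * h₂
  rw [e]
  congr 1
  push_cast
  ring

end FrameDerivations

end Frames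

end
end Shimura

namespace Shimura
noncomputable section
open scoped Matrix BigOperators ComplexConjugate Nat ContDiff Topology Matrix.Norms.Operator
open MeasureTheory TopologicalSpace

/-! ### Composition with holomorphic functions of one variable -/

section Composition

variable {𝔸 : Type*} [NormedRing 𝔸] [NormedAlgebra ℂ 𝔸] {U : Opens 𝔸}

lemma comp_mem_holo (f : holo U) {h : ℂ → ℂ} {s : Set ℂ} (hh : ContDiffOn ℂ ∞ h s)
    (hf : ∀ u, (f : U → ℂ) u ∈ s) : (fun u => h ((f : U → ℂ) u)) ∈ holo U :=
  ⟨fun v => h (ext0 (f : U → ℂ) v), hh.comp (contDiffOn_ext0 f) fun u hu => by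
    rw [ext0_eq _ hu]; exact hf _, fun u => by simp⟩

lemma leftDeriv_comp (Z : 𝔸) (f g : holo U) {h : ℂ → ℂ} (hg : ∀ u, (g : U → ℂ) u = h ((f : U → ℂ) u))
    {h' : ℂ} (u : U) (hh : HasDerivAt h h' ((f : U → ℂ) u)) :
    (leftDeriv Z g : U → ℂ) u = h' * (leftDeriv Z f : U → ℂ) u := by
  have h1 : HasDerivAt h h' (ext0 (f : U → ℂ) u) := by rwa [ext0_coe]
  rw [leftDeriv_eq Z g u (F := fun v => h (ext0 (f : U → ℂ) v)) (fun u => by rw [hg, ext0_coe])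
    (h1.comp_hasFDerivAt (u : 𝔸) (differentiableAt_ext0 f u).hasFDerivAt), leftDeriv_apply]
  simp

end Composition

/-! ### The frames of `SU(2,2)` -/

/-- Open sets of matrices, for the topology of the operator norm. -/
abbrev MatOpens := @Opens Mat PseudoMetricSpace.toUniformSpace.toTopologicalSpace

section MatrixFunctions

variable {U : MatOpens}

/-- A linear function, as an element of the algebra of holomorphic functions. -/
def holoLin (U : MatOpens) (ℓ : Mat →ₗ[ℂ] ℂ) : holo U :=
  ⟨fun u => ℓ u, fun u => ℓ u, (LinearMap.toContinuousLinearMap ℓ).contDiff.contDiffOn,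
    fun _ => rfl⟩

lemma leftDeriv_holoLin (Z : Mat) (ℓ : Mat →ₗ[ℂ] ℂ) (u : U) :
    (leftDeriv Z (holoLin U ℓ) : U → ℂ) u = ℓ (u * Z) :=
  leftDeriv_eq Z _ u (fun _ => rfl) (LinearMap.toContinuousLinearMap ℓ).hasFDerivAt

lemma contDiffAt_matrix_inv {u : Mat} (hu : IsUnit u) : ContDiffAt ℂ ∞ (fun v : Mat => v⁻¹) u := by
  obtain ⟨w, rfl⟩ := hu
  have := contDiffAt_ringInverse (n := ∞) ℂ w
  simpa only [Matrix.nonsing_inv_eq_ringInverse] using this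

lemma hasFDerivAt_matrix_inv {u : Mat} (hu : IsUnit u) : HasFDerivAt (fun v : Mat => v⁻¹)
    (-ContinuousLinearMap.mulLeftRight ℂ Mat u⁻¹ u⁻¹) u := by
  obtain ⟨w, rfl⟩ := hu
  have := hasFDerivAt_ringInverse (𝕜 := ℂ) w
  simpa only [Matrix.nonsing_inv_eq_ringInverse, Ring.inverse_unit] using this

/-- A linear function of the inverse matrix. -/
def holoInv (hU : ∀ u ∈ U, IsUnit u) (ℓ : Mat →ₗ[ℂ] ℂ) : holo U :=
  ⟨fun u => ℓ (u : Mat)⁻¹, fun u => ℓ u⁻¹, fun u hu =>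
    ((LinearMap.toContinuousLinearMap ℓ).contDiff.contDiffAt.comp u
      (contDiffAt_matrix_inv (hU u hu))).contDiffWithinAt, fun _ => rfl⟩

lemma leftDeriv_holoInv (hU : ∀ u ∈ U, IsUnit u) (Z : Mat) (ℓ : Mat →ₗ[ℂ] ℂ) (u : U) :
    (leftDeriv Z (holoInv hU ℓ) : U → ℂ) u = -ℓ (Z * (u : Mat)⁻¹) := by
  rw [leftDeriv_eq Z (holoInv hU ℓ) u (F := fun v : Mat => ℓ v⁻¹) (fun _ => rfl)
    ((LinearMap.toContinuousLinearMap ℓ).hasFDerivAt.comp (u : Mat)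
      (hasFDerivAt_matrix_inv (hU u u.2)))]
  have := Matrix.nonsing_inv_mul (u : Mat) ((Matrix.isUnit_iff_isUnit_det _).1 (hU u u.2))
  change ℓ (-((u : Mat)⁻¹ * ((u : Mat) * Z) * (u : Mat)⁻¹)) = _
  rw [map_neg, ← mul_assoc, this, one_mul]

end MatrixFunctions

/-- The matrix of the power functions: on `SU(2,2)` it is the Gram matrix, and it is holomorphic
in `g`. -/
def powerMat (g : Mat) : Matrix (Fin 2) (Fin 2) ℂ :=
  (Vᴴ * J * g).toCols₁ * (g⁻¹ * V).toRows₁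

lemma contDiffAt_powerMat {g : Mat} (hg : IsUnit g) (s t : Fin 2) :
    ContDiffAt ℂ ∞ (fun v => powerMat v s t) g := by
  have h1 : ∀ i j, ContDiffAt ℂ ∞ (fun v : Mat => v i j) g := fun i j =>
    (LinearMap.toContinuousLinearMap (Matrix.entryLinearMap ℂ ℂ i j)).contDiff.contDiffAt
  have h2 : ∀ i j, ContDiffAt ℂ ∞ (fun v : Mat => v⁻¹ i j) g := fun i j =>
    (LinearMap.toContinuousLinearMap (Matrix.entryLinearMap ℂ ℂ i j)).contDiff.contDiffAt.comp g
      (contDiffAt_matrix_inv hg)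
  simp only [powerMat, Matrix.mul_apply (M := Matrix.toCols₁ _), Matrix.toCols₁_apply,
    Matrix.toRows₁_apply]
  refine ContDiffAt.sum fun i _ => ContDiffAt.mul ?_ ?_
  · simp only [Matrix.mul_apply (M := Vᴴ * J)]
    exact ContDiffAt.sum fun j _ => contDiffAt_const.mul (h1 _ _)
  · simp only [Matrix.mul_apply]
    exact ContDiffAt.sum fun j _ => (h2 _ _).mul contDiffAt_const

/-- The open set of matrices on which the holomorphic power functions are defined. -/
def dom : MatOpens where
  carrier := {g | IsUnit g} ∩ (fun g => (powerMat g 0 0, (powerMat g).det)) ⁻¹'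
    (Complex.slitPlane ×ˢ Complex.slitPlane)
  is_open' := by
    refine ContinuousOn.isOpen_inter_preimage (fun g hg => ?_) Units.isOpen
      (Complex.isOpen_slitPlane.prod Complex.isOpen_slitPlane)
    have h := fun s t => (contDiffAt_powerMat hg s t).continuousAt
    refine (ContinuousAt.prodMk (h 0 0) ?_).continuousWithinAt
    simp only [Matrix.det_fin_two]
    exact ((h 0 0).mul (h 1 1)).sub ((h 0 1).mul (h 1 0))

lemma dom_isUnit : ∀ u ∈ dom, IsUnit u := fun _ h => h.1

/-- Entries of `V* J g`. -/
def bra (s : Fin 2) (n : Idx) : holo dom :=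
  holoLin dom (Matrix.entryLinearMap ℂ ℂ s n ∘ₗ mulLeftLinearMap Idx ℂ (Vᴴ * J))

/-- Entries of `g⁻¹ V`. -/
def ket (n : Idx) (t : Fin 2) : holo dom :=
  holoInv dom_isUnit (Matrix.entryLinearMap ℂ ℂ n t ∘ₗ mulRightLinearMap Idx ℂ V)

lemma bra_apply (s : Fin 2) (n : Idx) (u : dom) :
    (bra s n : dom → ℂ) u = (Vᴴ * J * (u : Mat)) s n := rfl

lemma ket_apply (n : Idx) (t : Fin 2) (u : dom) :
    (ket n t : dom → ℂ) u = ((u : Mat)⁻¹ * V) n t := rfl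

lemma leftDeriv_bra (p q n : Idx) (s : Fin 2) :
    leftDeriv (Matrix.single p q 1) (bra s n) = if q = n then bra s p else 0 := by
  ext u
  rw [bra, leftDeriv_holoLin]
  change (Vᴴ * J * ((u : Mat) * Matrix.single p q 1) : Matrix (Fin 2) Idx ℂ) s n = _
  rw [← Matrix.mul_assoc]
  split_ifs with h
  · subst h
    simp [bra_apply]
  · rw [Matrix.mul_single_apply_of_ne _ _ _ _ _ (Ne.symm h)]
    rfl

lemma leftDeriv_ket (p q n : Idx) (t : Fin 2) :
    leftDeriv (Matrix.single p q 1) (ket n t) = -(if p = n then ket q t else 0) := by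
  ext u
  rw [ket, leftDeriv_holoInv]
  change -(Matrix.single p q 1 * (u : Mat)⁻¹ * V : Matrix Idx (Fin 2) ℂ) n t = _
  rw [Matrix.mul_assoc]
  split_ifs with h
  · subst h
    simp [ket_apply]
  · rw [Matrix.single_mul_apply_of_ne _ _ _ _ _ (Ne.symm h)]
    rfl

lemma V_J_V : Vᴴ * J * V = 0 := by
  ext i j
  fin_cases i <;> fin_cases j <;> simp [V, J, Matrix.mul_apply, Matrix.fromBlocks, Matrix.one_apply]

/-- The factors `g` and `g⁻¹` cancel, leaving the form on the isotropic span of `V`. This is the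
relation `rel` of the frames. -/
lemma sum_bra_mul_ket (s t : Fin 2) : ∑ n, bra s n * ket n t = 0 := by
  ext u
  have h1 : (∑ n, bra s n * ket n t : holo dom).1 u =
      (Vᴴ * J * (u : Mat) * ((u : Mat)⁻¹ * V)) s t := by
    simp [Matrix.mul_apply (M := Vᴴ * J * (u : Mat)), ← bra_apply, ← ket_apply]
  have h2 := Matrix.mul_nonsing_inv (u : Mat)
    ((Matrix.isUnit_iff_isUnit_det _).1 (dom_isUnit u u.2))
  change (∑ n, bra s n * ket n t : holo dom).1 u = 0
  rw [h1, ← Matrix.mul_assoc, Matrix.mul_assoc (Vᴴ * J), h2, Matrix.mul_one, V_J_V]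
  rfl

/-- The action of `𝔭⁺` and `𝔭⁻` on the frames. -/
theorem frameDerivations : FrameDerivations (fun i j => leftDeriv (U := dom) (pPlus i j))
    (fun i j => leftDeriv (pMinus i j)) (fun s j => bra s (Sum.inl j)) (fun s j => bra s (Sum.inr j))
    (fun i t => ket (Sum.inl i) t) (fun i t => ket (Sum.inr i) t) where
  XB₁ i j s t := by simp [pPlus, leftDeriv_bra]
  XC₁ i j s t := by simp [pPlus, leftDeriv_ket]
  XC₂ i j s t := by simp [pPlus, leftDeriv_ket]
  YB₁ i j s t := by simp [pMinus, leftDeriv_bra]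
  YB₂ i j s t := by simp [pMinus, leftDeriv_bra]
  YC₁ i j s t := by simp [pMinus, leftDeriv_ket]
  YC₂ i j s t := by simp [pMinus, leftDeriv_ket]
  rel s t := by
    have := sum_bra_mul_ket s t
    simp only [Fintype.sum_sum_type, Fin.sum_univ_two] at this
    exact eq_neg_of_add_eq_zero_left this

lemma powerMat_apply (u : dom) (s t : Fin 2) : powerMat u s t =
    (frameMul (fun s j => bra s (Sum.inl j)) (fun i t => ket (Sum.inl i) t) s t : dom → ℂ) u := by
  simp [frameMul, bra_apply, ket_apply, powerMat, Matrix.mul_apply (M := Matrix.toCols₁ _),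
    Fin.sum_univ_two]

lemma det_powerMat_apply (u : dom) : (powerMat u).det = (frameDet (frameMul
    (fun s j => bra s (Sum.inl j)) (fun i t => ket (Sum.inl i) t)) : holo dom).1 u := by
  rw [Matrix.det_fin_two]
  simp only [powerMat_apply]
  rfl

/-- The first minor. -/
def minorOne : holo dom :=
  frameMul (fun s j => bra s (Sum.inl j)) (fun i t => ket (Sum.inl i) t) 0 0

/-- The second minor. -/
def minorTwo : holo dom :=
  frameDet (frameMul (fun s j => bra s (Sum.inl j)) (fun i t => ket (Sum.inl i) t))

lemma minorOne_apply (u : dom) : (minorOne : dom → ℂ) u = powerMat u 0 0 :=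
  (powerMat_apply u 0 0).symm

lemma minorTwo_apply (u : dom) : (minorTwo : dom → ℂ) u = (powerMat u).det :=
  (det_powerMat_apply u).symm

lemma minorOne_mem (u : dom) : (minorOne : dom → ℂ) u ∈ Complex.slitPlane := by
  rw [minorOne_apply]; exact u.2.2.1

lemma minorTwo_mem (u : dom) : (minorTwo : dom → ℂ) u ∈ Complex.slitPlane := by
  rw [minorTwo_apply]; exact u.2.2.2

lemma contDiffOn_inv_slitPlane : ContDiffOn ℂ ∞ (fun z : ℂ => z⁻¹) Complex.slitPlane :=
  fun _ hz => (contDiffAt_inv ℂ (Complex.slitPlane_ne_zero hz)).contDiffWithinAt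

lemma contDiffOn_log_slitPlane : ContDiffOn ℂ ∞ Complex.log Complex.slitPlane :=
  fun _ hz => (Complex.contDiffAt_log hz).contDiffWithinAt

/-- The inverse of a function with values in the slit plane. -/
def holoInverse {U : MatOpens} (f : holo U) (hf : ∀ u, (f : U → ℂ) u ∈ Complex.slitPlane) :
    holo U := ⟨_, comp_mem_holo f contDiffOn_inv_slitPlane hf⟩

lemma mul_holoInverse {U : MatOpens} (f : holo U)
    (hf : ∀ u, (f : U → ℂ) u ∈ Complex.slitPlane) : f * holoInverse f hf = 1 := by
  ext u
  exact mul_inv_cancel₀ (Complex.slitPlane_ne_zero (hf u))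

/-- The logarithm of a function with values in the slit plane. -/
def holoLog {U : MatOpens} (f : holo U) (hf : ∀ u, (f : U → ℂ) u ∈ Complex.slitPlane) :
    holo U := ⟨_, comp_mem_holo f contDiffOn_log_slitPlane hf⟩

lemma leftDeriv_holoLog {U : MatOpens} (Z : Mat) (f : holo U)
    (hf : ∀ u, (f : U → ℂ) u ∈ Complex.slitPlane) :
    leftDeriv Z (holoLog f hf) = holoInverse f hf * leftDeriv Z f := by
  ext u
  exact leftDeriv_comp Z f _ (fun _ => rfl) u (Complex.hasDerivAt_log (hf u))

/-- The exponential of a holomorphic function. -/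
def holoExp {U : MatOpens} (f : holo U) : holo U :=
  ⟨_, comp_mem_holo f Complex.contDiff_exp.contDiffOn fun _ => Set.mem_univ _⟩

lemma leftDeriv_holoExp {U : MatOpens} (Z : Mat) (f : holo U) :
    leftDeriv Z (holoExp f) = holoExp f * leftDeriv Z f := by
  ext u
  exact leftDeriv_comp Z f _ (fun _ => rfl) u (Complex.hasDerivAt_exp _)

/-- The power function `Δ₁ ^ a Δ₂ ^ b`. -/
def powerFun (a b : ℂ) : holo dom :=
  holoExp (a • holoLog minorOne minorOne_mem + b • holoLog minorTwo minorTwo_mem)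

lemma leftDeriv_powerFun (Z : Mat) (a b : ℂ) : leftDeriv Z (powerFun a b) = powerFun a b *
    (a • (holoInverse minorOne minorOne_mem * leftDeriv Z minorOne) +
      b • (holoInverse minorTwo minorTwo_mem * leftDeriv Z minorTwo)) := by
  rw [powerFun, leftDeriv_holoExp, map_add, Derivation.map_smul, Derivation.map_smul,
    leftDeriv_holoLog, leftDeriv_holoLog]

/-- Left invariant vector fields, as endomorphisms. -/
def fieldEnd (Z : Mat) : Module.End ℂ (holo dom) := (leftDeriv Z).toLinearMap

lemma fieldEnd_apply (Z : Mat) (f : holo dom) : fieldEnd Z f = leftDeriv Z f := rfl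

lemma fieldEnd_comm {Z Z' B : Mat} (h : Z * Z' - Z' * Z = B) :
    fieldEnd Z * fieldEnd Z' = fieldEnd Z' * fieldEnd Z + fieldEnd B := by
  ext1 f
  exact (leftDeriv_comm Z Z' f).trans (by rw [h]; rfl)

lemma fieldEnd_comm_sub {Z Z' B : Mat} (h : Z * Z' - Z' * Z = -B) :
    fieldEnd Z * fieldEnd Z' = fieldEnd Z' * fieldEnd Z - fieldEnd B := by
  ext1 f
  refine (leftDeriv_comm Z Z' f).trans ?_
  rw [h, ← zero_sub, leftDeriv_sub, leftDeriv_zero, zero_sub, ← sub_eq_add_neg]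
  rfl

lemma fieldEnd_sub (Z Z' : Mat) : fieldEnd (Z - Z') = fieldEnd Z - fieldEnd Z' :=
  LinearMap.ext fun f => leftDeriv_sub Z Z' f

lemma fieldEnd_zero : fieldEnd 0 = 0 := LinearMap.ext fun f => leftDeriv_zero f

lemma fieldEnd_ite (p : Prop) [Decidable p] (Z : Mat) :
    fieldEnd (if p then Z else 0) = if p then fieldEnd Z else 0 := by
  split_ifs <;> simp [fieldEnd_zero]

lemma single_mul_single_ite (p q r s : Idx) : (Matrix.single p q 1 * Matrix.single r s 1 : Mat) =
    if q = r then Matrix.single p s 1 else 0 := by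
  split_ifs with h
  · subst h; simp
  · simp [h]

/-- The commutation relations of the left invariant vector fields. -/
theorem blockRelations : BlockRelations (fun i j => fieldEnd (pPlus i j))
    (fun i j => fieldEnd (pMinus i j))
    (fun i k => fieldEnd (Matrix.single (Sum.inl i) (Sum.inl k) 1))
    (fun l j => fieldEnd (Matrix.single (Sum.inr l) (Sum.inr j) 1)) where
  XX i j k l := by
    rw [fieldEnd_comm rfl]
    simp [pPlus, fieldEnd_zero]
  YY i j k l := by
    rw [fieldEnd_comm rfl]
    simp [pMinus, fieldEnd_zero]
  XY i j k l := by
    rw [fieldEnd_comm rfl]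
    simp [pPlus, pMinus, single_mul_single_ite, fieldEnd_sub, fieldEnd_ite, eq_comm]
  LX i k a b := by
    rw [fieldEnd_comm rfl]
    simp [pPlus, single_mul_single_ite, fieldEnd_ite]
  LY i k a b := by
    rw [fieldEnd_comm_sub (B := if a = i then pMinus k b else 0), fieldEnd_ite]
    simp [pMinus, single_mul_single_ite]
  RX l j a b := by
    rw [fieldEnd_comm_sub (B := if b = l then pPlus a j else 0), fieldEnd_ite]
    simp [pPlus, single_mul_single_ite]
  RY l j a b := by
    rw [fieldEnd_comm rfl]
    simp [pMinus, single_mul_single_ite, fieldEnd_ite]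

end
end Shimura

namespace Shimura
noncomputable section
open scoped Matrix BigOperators ComplexConjugate Nat ContDiff Topology Matrix.Norms.Operator
open MeasureTheory TopologicalSpace

/-! ### The power functions as eigenvectors -/

/-- A diagonal block acts on the inner index of both factors with opposite signs, so the product is
invariant. -/
lemma derivation_frameMul_eq_zero {A : Type*} [CommRing A] [Algebra ℂ A] (D : Derivation ℂ A A)
    {B C : Fin 2 → Fin 2 → A} (i k : Fin 2) (hB : ∀ s j, D (B s j) = if k = j then B s i else 0)
    (hC : ∀ j t, D (C j t) = -(if i = j then C k t else 0)) (s t : Fin 2) :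
    D (frameMul B C s t) = 0 := by
  simp only [frameMul, map_add, Derivation.leibniz, hB, hC, smul_eq_mul]
  fin_cases i <;> fin_cases k <;> simp <;> ring

lemma leftDeriv_inl_frameMul (i k s t : Fin 2) :
    leftDeriv (Matrix.single (Sum.inl i) (Sum.inl k) 1) (frameMul
      (fun s j => bra s (Sum.inl j)) (fun i t => ket (Sum.inl i) t) s t) = 0 :=
  derivation_frameMul_eq_zero _ i k (fun s j => by simp [leftDeriv_bra])
    (fun j t => by simp [leftDeriv_ket]) s t

lemma leftDeriv_inr_frameMul (i k s t : Fin 2) :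
    leftDeriv (Matrix.single (Sum.inr i) (Sum.inr k) 1) (frameMul
      (fun s j => bra s (Sum.inl j)) (fun i t => ket (Sum.inl i) t) s t) = 0 := by
  simp [frameMul, leftDeriv_bra, leftDeriv_ket]

lemma fieldEnd_powerFun_eq_zero {Z : Mat} (h : ∀ s t, leftDeriv Z (frameMul
      (fun s j => bra s (Sum.inl j)) (fun i t => ket (Sum.inl i) t) s t) = 0) (a b : ℂ) :
    fieldEnd Z (powerFun a b) = 0 := by
  have h1 : leftDeriv Z minorOne = 0 := h 0 0
  have h2 : leftDeriv Z minorTwo = 0 := FrameDerivations.derivation_frameDet_eq_zero _ h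
  rw [fieldEnd_apply, leftDeriv_powerFun, h1, h2]
  simp

/-- The parameters of the power function in the integral for `Φ_x`. -/
def sphericalPower (x : Fin 2 → ℂ) : holo dom := powerFun (-(x 0 - x 1 + 1)) (-(x 1 + 1 / 2))

/-- The determinant in the `𝔭⁺` fields raises the power of `θ` by one and the one in the `𝔭⁻` fields
lowers it; after `k` steps each way only a scalar is left. -/
theorem op_detS_pow_sphericalPower {Op : Symb →ₗ[ℂ] Module.End ℂ (holo dom)} (h1 : Op 1 = 1)
    (hv : ∀ i j κ, Op (vv i j * κ) = fieldEnd (pMinus i j) * Op κ)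
    (hz : ∀ i j κ, Op (zv i j * κ) = Op κ * fieldEnd (pPlus i j)) (x : Fin 2 → ℂ) (k : ℕ) :
    Op (detS ^ k) (sphericalPower x) = symbEigen (x 0 ^ 2) (x 1 ^ 2) 0 k • sphericalPower x := by
  rw [BlockRelations.op_detS_pow h1 hv hz]
  set ψ := sphericalPower x with hψ
  set a : ℂ := -(x 0 - x 1 + 1)
  set b : ℂ := -(x 1 + 1 / 2)
  set θ := FrameDerivations.shift (fun s j => bra s (Sum.inl j)) (fun i t => ket (Sum.inr i) t)
    (holoInverse minorTwo minorTwo_mem) with hθ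
  have hX : ∀ k : ℕ, (fieldEnd (pPlus 1 1) * fieldEnd (pPlus 0 0) -
      fieldEnd (pPlus 1 0) * fieldEnd (pPlus 0 1)) (θ ^ k * ψ) =
      ((b - k) * (a + b + 1 - k)) • (θ ^ (k + 1) * ψ) := by
    intro k
    rw [blockRelations.XX, blockRelations.XX 1 0]
    exact frameDerivations.detX_pow_power _ _ _ a b (mul_holoInverse minorOne minorOne_mem)
      (mul_holoInverse minorTwo minorTwo_mem) (fun i j => leftDeriv_powerFun _ _ _) k
  have hY : ∀ k : ℕ, (fieldEnd (pMinus 0 0) * fieldEnd (pMinus 1 1) -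
      fieldEnd (pMinus 0 1) * fieldEnd (pMinus 1 0)) (θ ^ (k + 1) * ψ) =
      ((b + (k + 1)) * (a + b + 1 + (k + 1))) • (θ ^ k * ψ) := by
    intro k
    rw [blockRelations.YY 0 1]
    exact frameDerivations.detY_pow_power _ _ _ a b (mul_holoInverse minorOne minorOne_mem)
      (mul_holoInverse minorTwo minorTwo_mem) (fun i j => leftDeriv_powerFun _ _ _) k
  set DX := fieldEnd (pPlus 1 1) * fieldEnd (pPlus 0 0) -
      fieldEnd (pPlus 1 0) * fieldEnd (pPlus 0 1)
  set DY := fieldEnd (pMinus 0 0) * fieldEnd (pMinus 1 1) -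
      fieldEnd (pMinus 0 1) * fieldEnd (pMinus 1 0)
  have hXk : (DX ^ k) ψ = (∏ j ∈ Finset.range k, ((b - j) * (a + b + 1 - j))) • (θ ^ k * ψ) := by
    induction k with
    | zero => simp
    | succ k ih =>
      rw [pow_succ', Module.End.mul_apply, ih, map_smul, hX, smul_smul, Finset.prod_range_succ]
  have hYk : (DY ^ k) (θ ^ k * ψ) =
      (∏ j ∈ Finset.range k, ((b + (j + 1)) * (a + b + 1 + (j + 1)))) • ψ := by
    clear hXk
    induction k with
    | zero => simp
    | succ k ih =>
      rw [pow_succ, Module.End.mul_apply, hY, map_smul, ih, smul_smul, Finset.prod_range_succ,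
        mul_comm]
  rw [Module.End.mul_apply, hXk, map_smul, hYk, smul_smul, ← Finset.prod_mul_distrib, symbEigen]
  congr 1
  -- With b = -(x₁ + 1/2) and a + b + 1 = -(x₀ + 1/2), for x = (x₀, x₁), the factors pair up: (b -
  -- j)(b + j + 1) = x₁² - (j + 1/2)², and likewise for x₀.
  refine Finset.prod_congr rfl fun j _ => ?_
  simp only [a, b]
  ring

/-- The invariant operators act on the power functions by scalars. -/
theorem exists_op_sphericalPower : ∃ Op : Symb →ₗ[ℂ] Module.End ℂ (holo dom), Op 1 = 1 ∧
    (∀ i j κ, Op (vv i j * κ) = fieldEnd (pMinus i j) * Op κ) ∧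
    (∀ i j κ, Op (zv i j * κ) = Op κ * fieldEnd (pPlus i j)) ∧
    ∀ (x : Fin 2 → ℂ) (m k : ℕ), Op (detS ^ k * hSym trS detS m) (sphericalPower x) =
      symbEigen (x 0 ^ 2) (x 1 ^ 2) m k • sphericalPower x := by
  obtain ⟨Op, h1, hv, hz⟩ := blockRelations.exists_op
  refine ⟨Op, h1, hv, hz, fun x m k => ?_⟩
  refine blockRelations.op_invariant h1 hv hz
    (fun i k => fieldEnd_powerFun_eq_zero (leftDeriv_inl_frameMul i k) _ _)
    (fun i k => fieldEnd_powerFun_eq_zero (leftDeriv_inr_frameMul i k) _ _) _ _ ?_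
    (op_detS_pow_sphericalPower h1 hv hz x) m k
  refine (frameDerivations.casimir_power _ _ _ _ _ (mul_holoInverse minorOne minorOne_mem)
      (mul_holoInverse minorTwo minorTwo_mem) (fun i j => leftDeriv_powerFun _ _ _)
      (fun i j => leftDeriv_powerFun _ _ _)).trans ?_
  -- Here (a + b)(a + b + 3) = x₀² - 9/4 and b (b + 1) = x₁² - 1/4.
  exact congrArg (· • sphericalPower x) (by ring)

end
end Shimura

namespace Shimura
noncomputable section
open scoped Matrix BigOperators ComplexConjugate Nat ContDiff Topology Matrix.Norms.Operator
open MeasureTheory TopologicalSpace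

/-! ### The group `G` inside the domain of the power functions -/

lemma J_mul_J : J * J = 1 := by
  simp [J, Matrix.fromBlocks_multiply]

lemma J_conjTranspose : Jᴴ = J := by
  simp [J, Matrix.fromBlocks_conjTranspose]

lemma det_coe (g : Matrix.SpecialLinearGroup Idx ℂ) : IsUnit (g : Mat).det := by
  rw [g.2]; exact isUnit_one

lemma inv_eq_of_mem_G {g : Matrix.SpecialLinearGroup Idx ℂ} (hg : g ∈ G) :
    (g : Mat)⁻¹ = J * (g : Mat)ᴴ * J := by
  refine Matrix.inv_eq_left_inv ?_
  have h : (g : Mat)ᴴ * J * (g : Mat) = J := hg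
  rw [Matrix.mul_assoc, Matrix.mul_assoc, ← Matrix.mul_assoc _ J, h, J_mul_J]

lemma gram_eq (g : Matrix.SpecialLinearGroup Idx ℂ) :
    gram g = (1 / 2 : ℂ) • (((g : Mat)⁻¹ * V)ᴴ * ((g : Mat)⁻¹ * V)) := by
  rw [gram, Matrix.mul_inv_rev, Matrix.conjTranspose_mul, Matrix.conjTranspose_nonsing_inv]
  simp only [Matrix.mul_assoc]

lemma V_mulVec_injective : Function.Injective V.mulVec := by
  intro x y h
  rw [V, Matrix.fromRows_mulVec, Matrix.fromRows_mulVec] at h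
  simpa using congrArg (fun z => z ∘ Sum.inl) h

open scoped ComplexOrder in
lemma gram_posDef (g : Matrix.SpecialLinearGroup Idx ℂ) : (gram g).PosDef := by
  rw [gram_eq]
  refine Matrix.PosDef.smul (Matrix.PosDef.conjTranspose_mul_self _ ?_) (by norm_num)
  intro x y h
  have h2 : ∀ z, (g : Mat).mulVec (((g : Mat)⁻¹ * V).mulVec z) = V.mulVec z := fun z => by
    rw [Matrix.mulVec_mulVec, ← Matrix.mul_assoc, Matrix.mul_nonsing_inv _ (det_coe g),
      Matrix.one_mul]
  exact V_mulVec_injective (by rw [← h2 x, h, h2])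

/-- For g in G, unitarity for `J` turns the Gram matrix of g⁻¹V into half of V*Jg · J · g⁻¹V, the
difference of two block products. Their sum vanishes by isotropy, so half the difference is the
first one. -/
lemma powerMat_eq_gram {g : Matrix.SpecialLinearGroup Idx ℂ} (hg : g ∈ G) :
    powerMat g = gram g := by
  set C := (g : Mat)⁻¹ * V with hC
  have h1 : gram g = (1 / 2 : ℂ) • (Vᴴ * J * (g : Mat) * J * C) := by
    rw [gram_eq, Matrix.conjTranspose_mul, inv_eq_of_mem_G hg, Matrix.conjTranspose_mul,
      Matrix.conjTranspose_mul, Matrix.conjTranspose_conjTranspose, J_conjTranspose]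
    simp only [hC, inv_eq_of_mem_G hg, Matrix.mul_assoc]
  have h2 : Vᴴ * J * (g : Mat) * C = 0 := by
    rw [hC, ← Matrix.mul_assoc, Matrix.mul_assoc _ (g : Mat), Matrix.mul_nonsing_inv _ (det_coe g),
      Matrix.mul_one, V_J_V]
  set B := Vᴴ * J * (g : Mat)
  have h3 : B * C = B.toCols₁ * C.toRows₁ + B.toCols₂ * C.toRows₂ := by
    rw [← Matrix.fromCols_mul_fromRows, Matrix.fromCols_toCols, Matrix.fromRows_toRows]
  have h4 : B * J * C = B.toCols₁ * C.toRows₁ - B.toCols₂ * C.toRows₂ := by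
    conv_lhs => rw [← Matrix.fromCols_toCols B, ← Matrix.fromRows_toRows C, J,
      Matrix.fromCols_mul_fromBlocks, Matrix.fromCols_mul_fromRows]
    simp [sub_eq_add_neg]
  rw [h1, h4]
  rw [h2] at h3
  have h5 : B.toCols₂ * C.toRows₂ = -(B.toCols₁ * C.toRows₁) :=
    eq_neg_of_add_eq_zero_right h3.symm
  rw [h5, sub_neg_eq_add, ← two_smul ℂ, smul_smul]
  norm_num
  rfl

open scoped ComplexOrder in
lemma gram_apply_eq_re (g : Matrix.SpecialLinearGroup Idx ℂ) :
    0 < (gram g 0 0).re ∧ gram g 0 0 = ((gram g 0 0).re : ℂ) :=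
  have h := Complex.pos_iff.1 ((gram_posDef g).diag_pos (i := 0))
  ⟨h.1, Complex.ext rfl (by simp [← h.2])⟩

open scoped ComplexOrder in
lemma det_gram_eq_re (g : Matrix.SpecialLinearGroup Idx ℂ) :
    0 < (gram g).det.re ∧ (gram g).det = ((gram g).det.re : ℂ) :=
  have h := Complex.pos_iff.1 (gram_posDef g).det_pos
  ⟨h.1, Complex.ext rfl (by simp [← h.2])⟩

lemma mem_dom {g : Matrix.SpecialLinearGroup Idx ℂ} (hg : g ∈ G) : (g : Mat) ∈ dom := by
  refine ⟨(Matrix.isUnit_iff_isUnit_det _).2 (det_coe g), ?_, ?_⟩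
  · simp only [powerMat_eq_gram hg]
    exact Or.inl (gram_apply_eq_re g).1
  · simp only [powerMat_eq_gram hg]
    exact Or.inl (det_gram_eq_re g).1

/-- On G both minors are positive, so the complex logarithms are the real ones of `iwasawaA`; the
exponents of `sphericalPower` come from sorting the exponent of Φ_x by these logarithms. -/
lemma sphericalPower_apply (x : Fin 2 → ℂ) {g : Matrix.SpecialLinearGroup Idx ℂ} (hg : g ∈ G) :
    ext0 (sphericalPower x : dom → ℂ) (g : Mat) =
      Complex.exp (∑ i, 2 * (x i + rho i) * iwasawaA g i) := by
  rw [ext0_eq _ (mem_dom hg)]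
  change Complex.exp (-(x 0 - x 1 + 1) * Complex.log ((minorOne : dom → ℂ) ⟨g, mem_dom hg⟩) +
    -(x 1 + 1 / 2) * Complex.log ((minorTwo : dom → ℂ) ⟨g, mem_dom hg⟩)) = _
  rw [minorOne_apply, minorTwo_apply]
  simp only [powerMat_eq_gram hg]
  rw [(gram_apply_eq_re g).2, (det_gram_eq_re g).2, ← Complex.ofReal_log (gram_apply_eq_re g).1.le,
    ← Complex.ofReal_log (det_gram_eq_re g).1.le]
  congr 1
  simp only [Fin.sum_univ_two, iwasawaA, rho, Matrix.cons_val_zero, Matrix.cons_val_one]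
  push_cast
  ring

/-! ### One-parameter subgroups -/

lemma J_mul_exp_mul_J {A : Mat} (hJ : J * A * J = -A) :
    J * NormedSpace.exp A * J = NormedSpace.exp (-A) := by
  have hu : IsUnit J := IsUnit.of_mul_eq_one _ J_mul_J
  have hi : J⁻¹ = J := Matrix.inv_eq_left_inv J_mul_J
  have := Matrix.exp_conj J A hu
  rw [hi, hJ] at this
  exact this.symm

lemma exp_mul_exp_neg (A : Mat) : NormedSpace.exp A * NormedSpace.exp (-A) = 1 := by
  rw [← Matrix.exp_add_of_commute _ _ (Commute.neg_right (Commute.refl A)), add_neg_cancel,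
    NormedSpace.exp_zero]

/-- Conjugation by `J` inverts the exponential, so its determinant squares to 1. Applied to A/2,
this gives the determinant 1 for A itself. -/
lemma det_exp_eq_one {A : Mat} (hJ : J * A * J = -A) : (NormedSpace.exp A).det = 1 := by
  have h1 : ∀ B : Mat, J * B * J = -B → (NormedSpace.exp B).det * (NormedSpace.exp B).det = 1 := by
    intro B hB
    have h2 : (NormedSpace.exp (-B)).det = (NormedSpace.exp B).det := by
      rw [← J_mul_exp_mul_J hB, Matrix.det_mul, Matrix.det_mul, mul_right_comm, ← Matrix.det_mul,
        J_mul_J, Matrix.det_one, one_mul]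
    conv_lhs => rw [← h2]
    rw [h2]
    nth_rewrite 2 [← h2]
    rw [← Matrix.det_mul, exp_mul_exp_neg, Matrix.det_one]
  have h3 : A = (1 / 2 : ℂ) • A + (1 / 2 : ℂ) • A := by
    rw [← add_smul]; norm_num
  rw [h3, Matrix.exp_add_of_commute _ _ (Commute.refl _), Matrix.det_mul]
  refine h1 _ ?_
  rw [Matrix.mul_smul, Matrix.smul_mul, hJ, smul_neg]

/-- The elements `exp (tA)` of `G`, for `A ∈ 𝔭₀`. -/
def expG {A : Mat} (hJ : J * A * J = -A) (t : ℝ) : Matrix.SpecialLinearGroup Idx ℂ :=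
  ⟨NormedSpace.exp ((t : ℂ) • A), det_exp_eq_one (by
    rw [Matrix.mul_smul, Matrix.smul_mul, hJ, smul_neg])⟩

lemma expG_mem {A : Mat} (hJ : J * A * J = -A) (hA : Aᴴ = A) (t : ℝ) : expG hJ t ∈ G := by
  change (NormedSpace.exp ((t : ℂ) • A))ᴴ * J * NormedSpace.exp ((t : ℂ) • A) = J
  have hB : J * ((t : ℂ) • A) * J = -((t : ℂ) • A) := by
    rw [Matrix.mul_smul, Matrix.smul_mul, hJ, smul_neg]
  have hH : ((t : ℂ) • A)ᴴ = (t : ℂ) • A := by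
    rw [Matrix.conjTranspose_smul, hA]; simp
  set B := (t : ℂ) • A
  have h1 := exp_mul_exp_neg (-B)
  rw [neg_neg, ← J_mul_exp_mul_J hB] at h1
  rw [← Matrix.exp_conjTranspose, hH]
  calc NormedSpace.exp B * J * NormedSpace.exp B
      = J * (J * NormedSpace.exp B * J * NormedSpace.exp B) := by
        simp only [← Matrix.mul_assoc, J_mul_J, Matrix.one_mul]
    _ = J := by rw [h1, Matrix.mul_one]

end
end Shimura

namespace Shimura
noncomputable section
open scoped Matrix BigOperators ComplexConjugate Nat ContDiff Topology Matrix.Norms.Operator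
open MeasureTheory TopologicalSpace

/-! ### Averages over `K` of holomorphic functions -/

instance : IsProbabilityMeasure haarK := ⟨Measure.haarMeasure_self (K₀ := ⊤)⟩

/-- The product of an element of `K` and an element of `G`. -/
lemma K_mul_mem_G (k : K) {g : Matrix.SpecialLinearGroup Idx ℂ} (hg : g ∈ G) :
    (k : Matrix.SpecialLinearGroup Idx ℂ) * g ∈ G := G.mul_mem k.2.1 hg

lemma K_mul_mem_dom (k : K) {g : Matrix.SpecialLinearGroup Idx ℂ} (hg : g ∈ G) :
    K.mat k * (g : Mat) ∈ dom := mem_dom (K_mul_mem_G k hg)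

lemma continuous_K_mat : Continuous K.mat := continuous_subtype_val.comp continuous_subtype_val

lemma continuous_translate (a : holo dom) {T : Type*} [TopologicalSpace T] {p : T → Mat}
    (hp : Continuous p) (hd : ∀ t, p t ∈ dom) : Continuous fun t => ext0 (a : dom → ℂ) (p t) :=
  continuous_iff_continuousAt.2 fun t =>
    ((contDiffOn_ext0 a).continuousOn.continuousAt (dom.isOpen.mem_nhds (hd t))).comp
      hp.continuousAt

lemma integrable_of_continuous {f : K → ℂ} (hf : Continuous f) : Integrable f haarK :=
  hf.integrable_of_hasCompactSupport (HasCompactSupport.of_compactSpace f)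

/-- `f` is the average over `K` of the left translates of the holomorphic function `a`. -/
def IsAverage (f : Mat → ℂ) (a : holo dom) : Prop :=
  ∀ g : Matrix.SpecialLinearGroup Idx ℂ, g ∈ G →
    f g = ∫ k : K, ext0 (a : dom → ℂ) (K.mat k * g) ∂haarK

lemma integrable_translate (a : holo dom) {g : Matrix.SpecialLinearGroup Idx ℂ} (hg : g ∈ G) :
    Integrable (fun k : K => ext0 (a : dom → ℂ) (K.mat k * g)) haarK :=
  integrable_of_continuous (continuous_translate a (continuous_K_mat.mul continuous_const)
    fun k => K_mul_mem_dom k hg)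

lemma IsAverage.sum {ι : Type*} (s : Finset ι) {f : ι → Mat → ℂ} {a : ι → holo dom}
    (h : ∀ i ∈ s, IsAverage (f i) (a i)) : IsAverage (fun g => ∑ i ∈ s, f i g) (∑ i ∈ s, a i) := by
  intro g hg
  simp only
  rw [Finset.sum_congr rfl fun i hi => h i hi g hg,
    ← integral_finsetSum _ fun i _ => integrable_translate (a i) hg]
  refine integral_congr_ae (.of_forall fun k => ?_)
  simp only [ext0_eq _ (K_mul_mem_dom k hg)]
  simp

lemma IsAverage.const_mul {f : Mat → ℂ} {a : holo dom} (h : IsAverage f a) (c : ℂ) :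
    IsAverage (fun g => c * f g) (c • a) := by
  intro g hg
  simp only
  rw [h g hg, ← integral_const_mul]
  refine integral_congr_ae (.of_forall fun k => ?_)
  simp only [ext0_eq _ (K_mul_mem_dom k hg)]
  simp

lemma IsAverage.add {f f' : Mat → ℂ} {a a' : holo dom} (h : IsAverage f a)
    (h' : IsAverage f' a') : IsAverage (fun g => f g + f' g) (a + a') := by
  intro g hg
  simp only
  rw [h g hg, h' g hg, ← integral_add (integrable_translate a hg) (integrable_translate a' hg)]
  refine integral_congr_ae (.of_forall fun k => ?_)
  simp only [ext0_eq _ (K_mul_mem_dom k hg)]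
  simp

/-- Differentiation along a one-parameter subgroup. -/
theorem IsAverage.realField {f : Mat → ℂ} {a : holo dom} (h : IsAverage f a) {A : Mat}
    (hJ : J * A * J = -A) (hA : Aᴴ = A) : IsAverage (realField A f) (leftDeriv A a) := by
  intro g hg
  have hmem : ∀ t : ℝ, g * expG hJ t ∈ G := fun t => G.mul_mem hg (expG_mem hJ hA t)
  have hcoe : ∀ t : ℝ, ((g * expG hJ t : Matrix.SpecialLinearGroup Idx ℂ) : Mat) =
      (g : Mat) * NormedSpace.exp ((t : ℂ) • A) := fun t => rfl
  have hexp : Continuous fun t : ℝ => NormedSpace.exp ((t : ℂ) • A) :=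
    NormedSpace.exp_continuous.comp (Complex.continuous_ofReal.smul continuous_const)
  have hp : Continuous fun p : ℝ × K =>
      K.mat p.2 * ((g : Mat) * NormedSpace.exp ((p.1 : ℂ) • A)) :=
    (continuous_K_mat.comp continuous_snd).mul (continuous_const.mul (hexp.comp continuous_fst))
  have hd : ∀ p : ℝ × K, K.mat p.2 * ((g : Mat) * NormedSpace.exp ((p.1 : ℂ) • A)) ∈ dom :=
    fun p => by
      rw [← hcoe]
      exact K_mul_mem_dom _ (hmem _)
  -- Compactness of [-1, 1] × K gives a constant bound for the derivative, which allows
  -- differentiation under the integral.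
  obtain ⟨C, hC⟩ := ((isCompact_Icc (a := (-1 : ℝ)) (b := 1)).prod
    (isCompact_univ (X := K))).exists_bound_of_continuousOn
      (continuous_translate (leftDeriv A a) hp hd).continuousOn
  have key := (hasDerivAt_integral_of_dominated_loc_of_deriv_le (μ := haarK) (𝕜 := ℝ)
    (F := fun t k => ext0 (a : dom → ℂ) (K.mat k * ((g : Mat) * NormedSpace.exp ((t : ℂ) • A))))
    (F' := fun t k => ext0 (leftDeriv A a : dom → ℂ)
      (K.mat k * ((g : Mat) * NormedSpace.exp ((t : ℂ) • A))))
    (x₀ := 0) (s := Set.Icc (-1) 1) (bound := fun _ => C) (Icc_mem_nhds (by norm_num) (by norm_num))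
    (.of_forall fun t => ((continuous_translate a hp hd).comp
      (Continuous.prodMk_right t)).aestronglyMeasurable)
    (integrable_of_continuous ((continuous_translate a hp hd).comp (Continuous.prodMk_right 0)))
    ((continuous_translate (leftDeriv A a) hp hd).comp
      (Continuous.prodMk_right 0)).aestronglyMeasurable
    (.of_forall fun k t ht => hC (t, k) ⟨ht, Set.mem_univ _⟩) (integrable_const C)
    (.of_forall fun k t _ => ?_)).2
  · rw [Shimura.realField]
    have e : (fun t : ℝ => f (g * NormedSpace.exp ((t : ℂ) • A))) = fun t : ℝ =>
        ∫ k : K, ext0 (a : dom → ℂ) (K.mat k * ((g : Mat) * NormedSpace.exp ((t : ℂ) • A)))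
          ∂haarK := by
      funext t
      rw [← hcoe, h _ (hmem t)]
    rw [e, key.deriv]
    simp
  · have hu := hd (t, k)
    set u : dom := ⟨_, hu⟩ with hu'
    have h1 : HasDerivAt (fun s : ℝ => NormedSpace.exp ((s : ℂ) • A))
        (NormedSpace.exp ((t : ℂ) • A) * A) t := by
      have := (hasDerivAt_exp_smul_const A (t : ℂ)).scomp t Complex.ofRealCLM.hasDerivAt
      rw [Complex.ofRealCLM_apply, Complex.ofReal_one, one_smul] at this
      exact this
    have h2 : HasDerivAt (fun s : ℝ => K.mat k * ((g : Mat) * NormedSpace.exp ((s : ℂ) • A)))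
        (K.mat k * ((g : Mat) * (NormedSpace.exp ((t : ℂ) • A) * A))) t :=
      (h1.const_mul _).const_mul _
    have h3 := ((differentiableAt_ext0 a u).hasFDerivAt.restrictScalars ℝ).comp_hasDerivAt t h2
    rw [ext0_eq _ hu]
    simp only [leftDeriv_apply]
    have e : (u : Mat) * A =
        K.mat k * ((g : Mat) * (NormedSpace.exp ((t : ℂ) • A) * A)) := by
      simp only [hu', mul_assoc]
    rw [e]
    exact h3

/-- Left invariant vector fields and averages over `K`. -/
theorem IsAverage.field {f : Mat → ℂ} {a : holo dom} (h : IsAverage f a) {Z : Mat}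
    (hJ : J * Z * J = -Z) (hσ : sigma Z = Zᴴ) : IsAverage (field Z f) (fieldEnd Z a) := by
  have hJ' : J * Zᴴ * J = -Zᴴ := by
    have := congrArg Matrix.conjTranspose hJ
    simpa [Matrix.conjTranspose_mul, J_conjTranspose, Matrix.mul_assoc] using this
  have hA := h.realField (A := (1 / 2 : ℂ) • (Z + sigma Z))
    (by rw [hσ, Matrix.mul_smul, Matrix.smul_mul, Matrix.mul_add, Matrix.add_mul, hJ, hJ',
      ← neg_add, smul_neg])
    (by rw [hσ]; simp [add_comm])
  have hB := h.realField (A := (1 / (2 * Complex.I) : ℂ) • (Z - sigma Z))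
    (by rw [hσ, Matrix.mul_smul, Matrix.smul_mul, Matrix.mul_sub, Matrix.sub_mul, hJ, hJ',
      ← smul_neg]; congr 1; abel)
    (by
      rw [hσ, Matrix.conjTranspose_smul, Matrix.conjTranspose_sub,
        Matrix.conjTranspose_conjTranspose, ← neg_sub Z, smul_neg, ← neg_smul]
      simp)
  have hI : Complex.I * (1 / (2 * Complex.I)) = 1 / 2 := by
    field_simp [Complex.I_ne_zero]
  -- Both parts are Hermitian and anticommute with `J`, so the real derivative applies to each, and
  -- complex linearity of `leftDeriv` reassembles `Z`.
  have e : (1 / 2 : ℂ) • (Z + sigma Z) + Complex.I • (1 / (2 * Complex.I) : ℂ) • (Z - sigma Z) =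
      Z := by
    rw [smul_smul, hI, ← smul_add, add_add_sub_cancel, ← two_smul ℂ, smul_smul]
    norm_num
  have e' : fieldEnd Z a = leftDeriv ((1 / 2 : ℂ) • (Z + sigma Z)) a +
      Complex.I • leftDeriv ((1 / (2 * Complex.I) : ℂ) • (Z - sigma Z)) a := by
    rw [← leftDeriv_smul, ← leftDeriv_add, e]
    rfl
  rw [e']
  exact hA.add (hB.const_mul Complex.I)

lemma J_eq_diagonal : J = Matrix.diagonal (Sum.elim 1 (-1)) := by
  ext i j
  rcases i with i | i <;> rcases j with j | j <;> simp [J, Matrix.diagonal_apply, Matrix.one_apply]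
  split_ifs <;> simp

lemma J_pPlus (i j : Fin 2) : J * pPlus i j * J = -pPlus i j := by
  ext p q
  rw [J_eq_diagonal, Matrix.mul_diagonal, Matrix.diagonal_mul]
  rcases p with p | p <;> rcases q with q | q <;> simp [pPlus, Matrix.single_apply]

lemma J_pMinus (i j : Fin 2) : J * pMinus i j * J = -pMinus i j := by
  ext p q
  rw [J_eq_diagonal, Matrix.mul_diagonal, Matrix.diagonal_mul]
  rcases p with p | p <;> rcases q with q | q <;>
    simp [pMinus, Matrix.single_apply]
  split_ifs <;> simp

lemma sigma_pPlus (i j : Fin 2) : sigma (pPlus i j) = (pPlus i j)ᴴ := by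
  have : (pPlus i j)ᴴ = pMinus i j := by simp [pPlus, pMinus]
  rw [sigma, this, J_pMinus, neg_neg]

lemma sigma_pMinus (i j : Fin 2) : sigma (pMinus i j) = (pMinus i j)ᴴ := by
  have : (pMinus i j)ᴴ = pPlus i j := by simp [pPlus, pMinus]
  rw [sigma, this, J_pPlus, neg_neg]

lemma IsAverage.iterate_field {f : Mat → ℂ} {a : holo dom} (h : IsAverage f a) {Z : Mat}
    (hZ : ∀ f a, IsAverage f a → IsAverage (Shimura.field Z f) (fieldEnd Z a)) (n : ℕ) :
    IsAverage ((Shimura.field Z)^[n] f) ((fieldEnd Z ^ n) a) := by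
  induction n with
  | zero => exact h
  | succ n ih =>
    rw [Function.iterate_succ_apply', pow_succ', Module.End.mul_apply]
    exact hZ _ _ ih

lemma IsAverage.polyOp {f : Mat → ℂ} {a : holo dom} (h : IsAverage f a)
    {E : Fin 2 → Fin 2 → Mat}
    (hE : ∀ i j f a, IsAverage f a → IsAverage (Shimura.field (E i j) f) (fieldEnd (E i j) a))
    (p : S) : IsAverage (polyOp E p f) (polyEnd (fun i j => fieldEnd (E i j)) p a) := by
  rw [polyEnd, LinearMap.sum_apply]
  refine IsAverage.sum _ fun m _ => ?_
  simp only [LinearMap.smul_apply, Module.End.mul_apply]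
  exact ((((h.iterate_field (hE 1 1) _).iterate_field (hE 1 0) _).iterate_field
    (hE 0 1) _).iterate_field (hE 0 0) _).const_mul _

lemma isAverage_Phi (x : Fin 2 → ℂ) : IsAverage (Phi x) (sphericalPower x) := by
  intro g hg
  refine integral_congr_ae (.of_forall fun k => ?_)
  exact (sphericalPower_apply x (K_mul_mem_G k hg)).symm

lemma Phi_one (x : Fin 2 → ℂ) : Phi x 1 = 1 := by
  have h1 : ∀ k : K, iwasawaA (K.mat k) = 0 := by
    intro k
    have hk : K.mat k * (K.mat k)ᴴ = 1 := mul_eq_one_comm.1 k.2.2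
    have hV : (1 / 2 : ℂ) • (Vᴴ * V) = 1 := by
      rw [V, Matrix.conjTranspose_fromRows_eq_fromCols_conjTranspose, Matrix.fromCols_mul_fromRows]
      simp only [Matrix.conjTranspose_one, Matrix.one_mul]
      rw [← two_smul ℂ, smul_smul]
      norm_num
    have hg : gram (K.mat k) = 1 := by
      rw [gram, hk, inv_one, Matrix.mul_one, hV]
    funext i
    fin_cases i <;> simp [iwasawaA, hg]
  simp [Phi, h1]

/-- The eigenvalues of the Shimura operators on spherical functions. -/
theorem exists_shimuraOp_Phi (l : ℕ × ℕ) : ∃ c : ℝ, 0 < c ∧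
    ∀ (x : Fin 2 → ℂ) (g : Matrix.SpecialLinearGroup Idx ℂ), g ∈ G → shimuraOp l (Phi x) g =
      c * symbEigen (x 0 ^ 2) (x 1 ^ 2) (l.1 - l.2) l.2 * Phi x g := by
  obtain ⟨c, hc, hκ⟩ := exists_symbol_eq l (basisW_isONB l)
  obtain ⟨Op, h1, hv, hz, hOp⟩ := exists_op_sphericalPower
  refine ⟨c, hc, fun x g hg => ?_⟩
  have key : IsAverage (shimuraOp l (Phi x)) (∑ a, polyEnd (fun i j => fieldEnd (pMinus i j))
      (MvPolynomial.map (starRingEnd ℂ) (basisW l a))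
        (polyEnd (fun i j => fieldEnd (pPlus i j)) (basisW l a) (sphericalPower x))) :=
    IsAverage.sum _ fun a _ => ((isAverage_Phi x).polyOp
      (fun i j f a h => h.field (J_pPlus i j) (sigma_pPlus i j)) _).polyOp
      (fun i j f a h => h.field (J_pMinus i j) (sigma_pMinus i j)) _
  have e : ∑ a, polyEnd (fun i j => fieldEnd (pMinus i j))
      (MvPolynomial.map (starRingEnd ℂ) (basisW l a))
        (polyEnd (fun i j => fieldEnd (pPlus i j)) (basisW l a) (sphericalPower x)) =
      (c * symbEigen (x 0 ^ 2) (x 1 ^ 2) (l.1 - l.2) l.2) • sphericalPower x := by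
    rw [mul_smul, ← hOp, ← LinearMap.smul_apply, ← map_smul, ← hκ, map_sum, LinearMap.sum_apply]
    refine Finset.sum_congr rfl fun a _ => ?_
    rw [BlockRelations.op_rename_inr_mul hv, Module.End.mul_apply, ← one_mul (MvPolynomial.rename _ _),
      BlockRelations.op_mul_rename_inl hz, h1, one_mul]
  rw [e] at key
  exact (key g hg).trans (((isAverage_Phi x).const_mul _) g hg).symm

/-- Since Φ_x is 1 at the identity, the eigenvalue is unique and can be read off there. -/
theorem exists_isEigenvalue_iff (l : ℕ × ℕ) : ∃ c : ℝ, 0 < c ∧ ∀ (x : Fin 2 → ℂ) (d : ℂ),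
    IsEigenvalue l x d ↔
      d = c * ((-1) ^ (l.1 + l.2) * symbEigen (x 0 ^ 2) (x 1 ^ 2) (l.1 - l.2) l.2) := by
  obtain ⟨c, hc, h⟩ := exists_shimuraOp_Phi l
  refine ⟨c, hc, fun x d => ⟨fun hd => ?_, fun hd g hg => ?_⟩⟩
  · have h1 := hd 1 G.one_mem
    rw [h x 1 G.one_mem] at h1
    simp only [Matrix.SpecialLinearGroup.coe_one, Phi_one, mul_one] at h1
    rw [← h1]
    ring
  · rw [h x g hg, hd]
    ring

end
end Shimura

namespace Shimura
noncomputable section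
open scoped Matrix BigOperators ComplexConjugate Nat ContDiff Topology
open MeasureTheory TopologicalSpace

/-! ### Positivity of the eigenvalues -/

/-- The product `∏ (c_j - y)`, where `c_j = (j + 1/2)²` and `k ≤ j < k + n`. -/
def nodeProd (y : ℝ) (k n : ℕ) : ℝ := ∏ j ∈ Finset.range n, ((((k + j : ℕ) : ℝ) + 1 / 2) ^ 2 - y)

lemma nodeProd_succ (y : ℝ) (k n : ℕ) :
    nodeProd y k (n + 1) = nodeProd y k n * ((((k + n : ℕ) : ℝ) + 1 / 2) ^ 2 - y) :=
  Finset.prod_range_succ _ _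

lemma nodeProd_succ' (y : ℝ) (k n : ℕ) :
    nodeProd y k (n + 1) = ((((k : ℕ) : ℝ) + 1 / 2) ^ 2 - y) * nodeProd y (k + 1) n := by
  rw [nodeProd, Finset.prod_range_succ', mul_comm, nodeProd]
  congr 1
  refine Finset.prod_congr rfl fun j _ => ?_
  rw [Nat.add_right_comm, add_assoc]

/-- The divided difference of `nodeProd`. -/
def nodeDiff (y₁ y₂ : ℝ) (k : ℕ) : ℕ → ℝ
  | 0 => 0
  | n + 1 => ((((k + n : ℕ) : ℝ) + 1 / 2) ^ 2 - y₂) * nodeDiff y₁ y₂ k n + nodeProd y₁ k n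

/-- `nodeDiff` is defined by a recursion instead of a quotient, so that it also makes sense for y₁ =
y₂. -/
lemma sub_mul_nodeDiff (y₁ y₂ : ℝ) (k n : ℕ) :
    (y₁ - y₂) * nodeDiff y₁ y₂ k n = nodeProd y₂ k n - nodeProd y₁ k n := by
  induction n with
  | zero => simp [nodeDiff, nodeProd]
  | succ n ih =>
    rw [nodeDiff, nodeProd_succ, nodeProd_succ]
    linear_combination ((((k + n : ℕ) : ℝ) + 1 / 2) ^ 2 - y₂) * ih

/-- Here the first node is split off, whereas the definition splits off the last one. `nodeDiff_rec`
combines both, since the recursion of `symbEigen` changes both ends. -/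
lemma nodeDiff_succ' (y₁ y₂ : ℝ) (k n : ℕ) : nodeDiff y₁ y₂ k (n + 1) =
    ((((k : ℕ) : ℝ) + 1 / 2) ^ 2 - y₁) * nodeDiff y₁ y₂ (k + 1) n + nodeProd y₂ (k + 1) n := by
  induction n with
  | zero => simp [nodeDiff, nodeProd]
  | succ n ih =>
    rw [nodeDiff, ih, nodeDiff, nodeProd_succ', nodeProd_succ, Nat.add_right_comm k 1 n,
      ← Nat.add_assoc]
    ring

lemma nodeDiff_rec (y₁ y₂ : ℝ) (k n : ℕ) : nodeDiff y₁ y₂ k (n + 2) =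
    ((((k + (n + 1) : ℕ) : ℝ) + 1 / 2) ^ 2 - y₂ + ((((k : ℕ) : ℝ) + 1 / 2) ^ 2 - y₁)) *
      nodeDiff y₁ y₂ k (n + 1) - ((((k : ℕ) : ℝ) + 1 / 2) ^ 2 - y₁) *
      ((((k : ℕ) : ℝ) + 1 / 2) ^ 2 - y₂) * nodeDiff y₁ y₂ (k + 1) n := by
  have h := sub_mul_nodeDiff y₁ y₂ (k + 1) n
  rw [nodeDiff, nodeProd_succ', nodeDiff_succ']
  linear_combination ((((k : ℕ) : ℝ) + 1 / 2) ^ 2 - y₁) * h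

lemma neg_one_pow_mul_symbEigen (y₁ y₂ : ℝ) (m k : ℕ) : (-1) ^ m * symbEigen y₁ y₂ m k =
    nodeProd y₁ 0 k * nodeProd y₂ 0 k * nodeDiff y₁ y₂ k (m + 1) := by
  have h0 : ∀ k, symbEigen y₁ y₂ 0 k = nodeProd y₁ 0 k * nodeProd y₂ 0 k := by
    intro k
    rw [symbEigen, nodeProd, nodeProd, ← Finset.prod_mul_distrib]
    refine Finset.prod_congr rfl fun j _ => ?_
    rw [zero_add]
    ring
  induction m using Nat.twoStepInduction generalizing k with
  | zero => simp [h0, nodeDiff, nodeProd]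
  | one =>
    rw [symbEigen, h0]
    simp [nodeDiff, nodeProd]
    ring
  | more m ih1 ih2 =>
    have e1 := ih1 (k + 1)
    have e2 := ih2 k
    rw [nodeProd_succ, nodeProd_succ, zero_add] at e1
    rw [symbEigen, nodeDiff_rec, mul_sub]
    push_cast at e1 e2 ⊢
    linear_combination -(y₁ + y₂ - (k + m + 2 + 1 / 2) ^ 2 - (k + 1 / 2) ^ 2) * e2 - e1

lemma nodeProd_nonneg {y : ℝ} {k n : ℕ} (h : y ≤ ((k : ℝ) + 1 / 2) ^ 2) : 0 ≤ nodeProd y k n := by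
  refine Finset.prod_nonneg fun j _ => ?_
  push_cast
  nlinarith [(Nat.cast_nonneg j : (0 : ℝ) ≤ j), (Nat.cast_nonneg k : (0 : ℝ) ≤ k)]

lemma nodeDiff_nonneg {y₁ y₂ : ℝ} {k n : ℕ} (h₁ : y₁ ≤ ((k : ℝ) + 1 / 2) ^ 2)
    (h₂ : y₂ ≤ ((k : ℝ) + 1 / 2) ^ 2) : 0 ≤ nodeDiff y₁ y₂ k n := by
  induction n with
  | zero => exact le_rfl
  | succ n ih =>
    refine add_nonneg (mul_nonneg ?_ ih) (nodeProd_nonneg h₁)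
    push_cast
    nlinarith [(Nat.cast_nonneg n : (0 : ℝ) ≤ n), (Nat.cast_nonneg k : (0 : ℝ) ≤ k)]

/-- The factorization that shows the symmetry about `1`. -/
lemma nodeProd_sq (x : ℝ) (m : ℕ) : nodeProd (x ^ 2) 0 (m + 1) =
    -((m - 1 / 2 + x) * (m + 1 / 2 + x) *
      ∏ i ∈ Finset.range m, (((i : ℝ) + 1 / 2) ^ 2 - (x - 1) ^ 2)) := by
  -- Passing from x to x - 1 shifts the factors j + 1/2 - x and j + 1/2 + x by one index in opposite
  -- directions, so the two products differ only at the ends.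
  induction m with
  | zero => simp [nodeProd]; ring
  | succ m ih =>
    rw [nodeProd_succ, ih, Finset.prod_range_succ]
    push_cast
    ring

lemma continuous_nodeDiff (k n : ℕ) : Continuous fun y : ℝ × ℝ => nodeDiff y.1 y.2 k n := by
  induction n with
  | zero => exact continuous_const
  | succ n ih =>
    simp only [nodeDiff, nodeProd]
    fun_prop

/-- From x₂ < x₁ and x₁ + x₂ ≤ 2 follows (x₁ - 1)² ≤ (x₂ - 1)². So in `nodeProd_sq` each factor for
x₁ is at least the one for x₂, and so is the prefactor. -/
lemma nodeDiff_nonneg_of_lt {x₁ x₂ : ℝ} (h : x₂ < x₁) (h₂ : 1 / 2 ≤ x₂) (hs : x₁ + x₂ ≤ 2)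
    (m : ℕ) : 0 ≤ nodeDiff (x₁ ^ 2) (x₂ ^ 2) 0 (m + 1) := by
  have hpos : 0 < x₁ ^ 2 - x₂ ^ 2 := by nlinarith
  refine nonneg_of_mul_nonneg_right (a := x₁ ^ 2 - x₂ ^ 2) ?_ hpos
  rw [sub_mul_nodeDiff, nodeProd_sq, nodeProd_sq, neg_sub_neg, sub_nonneg]
  have hm : (0 : ℝ) ≤ m := Nat.cast_nonneg m
  have hf : ∀ i : ℕ, 0 ≤ ((i : ℝ) + 1 / 2) ^ 2 - (x₂ - 1) ^ 2 := fun i => by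
    nlinarith [(Nat.cast_nonneg i : (0 : ℝ) ≤ i)]
  refine mul_le_mul ?_ (Finset.prod_le_prod (fun i _ => hf i) fun i _ => by nlinarith)
    (Finset.prod_nonneg fun i _ => hf i) (mul_nonneg (by linarith) (by linarith))
  exact mul_le_mul (by linarith) (by linarith) (by linarith) (by linarith)

/-- The diagonal is a limit from x₂ < x₁. At the corner x₁ = x₂ = 1/2 there is no room for this
limit, but there all factors are nonnegative. -/
lemma nodeDiff_nonneg_of_le {x₁ x₂ : ℝ} (h : x₂ ≤ x₁) (h₂ : 1 / 2 ≤ x₂) (hs : x₁ + x₂ ≤ 2)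
    (m : ℕ) : 0 ≤ nodeDiff (x₁ ^ 2) (x₂ ^ 2) 0 (m + 1) := by
  rcases h.lt_or_eq with h | rfl
  · exact nodeDiff_nonneg_of_lt h h₂ hs m
  rcases h₂.lt_or_eq with h₂ | h₂
  · have hc : Continuous fun t : ℝ => nodeDiff (x₂ ^ 2) (t ^ 2) 0 (m + 1) :=
      (continuous_nodeDiff 0 (m + 1)).comp (by fun_prop : Continuous fun t : ℝ => (x₂ ^ 2, t ^ 2))
    refine ge_of_tendsto (hc.continuousAt.tendsto.mono_left nhdsWithin_le_nhds :
      Filter.Tendsto _ (𝓝[<] x₂) _) ?_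
    filter_upwards [Ioo_mem_nhdsLT h₂] with t ht
    exact nodeDiff_nonneg_of_lt ht.2 ht.1.le (by linarith [ht.2]) m
  · refine nodeDiff_nonneg ?_ ?_ <;> simp [← h₂]

lemma exists_nodeDiff_neg_of_lt {x₁ x₂ : ℝ} (h : x₂ < x₁) (h₁ : x₁ ≤ 3 / 2) (hs : 2 < x₁ + x₂) :
    ∃ m : ℕ, nodeDiff (x₁ ^ 2) (x₂ ^ 2) 0 (m + 1) < 0 := by
  have hpos : 0 < x₁ ^ 2 - x₂ ^ 2 := by nlinarith
  have hδ : 0 < (x₁ - 1) ^ 2 - (x₂ - 1) ^ 2 := by nlinarith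
  -- The prefactors lie between M² and (M + 2)². As r ≤ 1/4, the inequality (M + 2)² r < M² s
  -- already follows from M (s - r) > 2 and M ≥ 1.
  obtain ⟨m, hm⟩ := exists_nat_gt (2 / ((x₁ - 1) ^ 2 - (x₂ - 1) ^ 2))
  rw [div_lt_iff₀ hδ] at hm
  rcases m with _ | m
  · norm_num at hm
  refine ⟨m + 1, ?_⟩
  refine neg_of_mul_neg_right (a := x₁ ^ 2 - x₂ ^ 2) ?_ hpos.le
  -- The factor with index 0 is split off, since the gap s - r in it alone beats the prefactors; the
  -- other factors are only compared weakly.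
  rw [sub_mul_nodeDiff, nodeProd_sq, nodeProd_sq, neg_sub_neg, sub_neg, Finset.prod_range_succ',
    Finset.prod_range_succ']
  have hf : ∀ i : ℕ, 0 ≤ ((i : ℝ) + 1 / 2) ^ 2 - (x₁ - 1) ^ 2 := fun i => by
    nlinarith [(Nat.cast_nonneg i : (0 : ℝ) ≤ i)]
  have hg : ∀ i : ℕ, 0 < ((i : ℝ) + 1 / 2) ^ 2 - (x₂ - 1) ^ 2 := fun i => by
    nlinarith [(Nat.cast_nonneg i : (0 : ℝ) ≤ i)]
  have hle : ∏ i ∈ Finset.range m, ((((i + 1 : ℕ) : ℝ) + 1 / 2) ^ 2 - (x₁ - 1) ^ 2) ≤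
      ∏ i ∈ Finset.range m, ((((i + 1 : ℕ) : ℝ) + 1 / 2) ^ 2 - (x₂ - 1) ^ 2) :=
    Finset.prod_le_prod (fun i _ => hf (i + 1)) fun i _ => by linarith
  have hp : 0 ≤ ∏ i ∈ Finset.range m, ((((i + 1 : ℕ) : ℝ) + 1 / 2) ^ 2 - (x₁ - 1) ^ 2) :=
    Finset.prod_nonneg fun i _ => hf (i + 1)
  have hgt : 0 < ∏ i ∈ Finset.range m, ((((i + 1 : ℕ) : ℝ) + 1 / 2) ^ 2 - (x₂ - 1) ^ 2) :=
    Finset.prod_pos fun i _ => hg (i + 1)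
  set p₁ := ∏ i ∈ Finset.range m, ((((i + 1 : ℕ) : ℝ) + 1 / 2) ^ 2 - (x₁ - 1) ^ 2)
  set p₂ := ∏ i ∈ Finset.range m, ((((i + 1 : ℕ) : ℝ) + 1 / 2) ^ 2 - (x₂ - 1) ^ 2)
  have hf0 := hf 0
  have hg0 := hg 0
  set M : ℝ := ((m + 1 : ℕ) : ℝ) with hM
  have hM1 : 1 ≤ M := by rw [hM]; push_cast; linarith [(Nat.cast_nonneg m : (0 : ℝ) ≤ m)]
  simp only [Nat.cast_zero, zero_add] at hf0 hg0 ⊢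
  set r := (1 / 2 : ℝ) ^ 2 - (x₁ - 1) ^ 2 with hr
  set s := (1 / 2 : ℝ) ^ 2 - (x₂ - 1) ^ 2 with hs'
  have hrq : r ≤ 1 / 4 := by rw [hr]; nlinarith [sq_nonneg (x₁ - 1)]
  have e1 : (M - 1 / 2 + x₁) * (M + 1 / 2 + x₁) ≤ (M + 2) ^ 2 := by nlinarith
  have e2 : M ^ 2 ≤ (M - 1 / 2 + x₂) * (M + 1 / 2 + x₂) := by nlinarith
  have e3 : (M + 2) ^ 2 * r < M ^ 2 * s := by
    have : s - r = (x₁ - 1) ^ 2 - (x₂ - 1) ^ 2 := by rw [hr, hs']; ring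
    rw [← this] at hm
    nlinarith
  have hpr := mul_nonneg hp hf0
  calc (M - 1 / 2 + x₁) * (M + 1 / 2 + x₁) * (p₁ * r)
      ≤ (M + 2) ^ 2 * (p₂ * r) := by gcongr
    _ = p₂ * ((M + 2) ^ 2 * r) := by ring
    _ < p₂ * (M ^ 2 * s) := by gcongr
    _ = M ^ 2 * (p₂ * s) := by ring
    _ ≤ (M - 1 / 2 + x₂) * (M + 1 / 2 + x₂) * (p₂ * s) := by gcongr

/-- On the diagonal the divided difference becomes minus the derivative of the product, computed by
its logarithmic derivative. -/
lemma nodeDiff_self {y : ℝ} (h : ∀ j : ℕ, ((j : ℝ) + 1 / 2) ^ 2 - y ≠ 0) (n : ℕ) :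
    nodeDiff y y 0 n =
      nodeProd y 0 n * ∑ j ∈ Finset.range n, (((j : ℝ) + 1 / 2) ^ 2 - y)⁻¹ := by
  induction n with
  | zero => simp [nodeDiff]
  | succ n ih =>
    rw [nodeDiff, ih, nodeProd_succ, Finset.sum_range_succ, zero_add]
    linear_combination -nodeProd y 0 n * mul_inv_cancel₀ (h n)

/-- Exactly one factor, that of index 0, is negative, so the product is negative and the sum of
reciprocals must become positive. At y = 1 the terms with j ≥ 1 telescope to 4/3, which balances the
term -4/3; for y > 1 the balance tips. -/
lemma exists_nodeDiff_self_neg {y : ℝ} (h₁ : 1 < y) (h₂ : y < 9 / 4) :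
    ∃ m : ℕ, nodeDiff y y 0 (m + 1) < 0 := by
  have hpos : ∀ j : ℕ, 0 < (((j + 1 : ℕ) : ℝ) + 1 / 2) ^ 2 - y := fun j => by
    push_cast
    nlinarith [(Nat.cast_nonneg j : (0 : ℝ) ≤ j)]
  have hneg : ((0 : ℕ) + 1 / 2 : ℝ) ^ 2 - y < 0 := by norm_num; linarith
  have hne : ∀ j : ℕ, ((j : ℝ) + 1 / 2) ^ 2 - y ≠ 0 := by
    rintro (_ | j)
    · exact hneg.ne
    · exact (hpos j).ne'
  have hsum : ∀ m : ℕ, 4 / 3 + (1 / 4 - y)⁻¹ - ((m : ℝ) + 1 / 2)⁻¹ ≤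
      ∑ j ∈ Finset.range (m + 1), (((j : ℝ) + 1 / 2) ^ 2 - y)⁻¹ := by
    intro m
    have : 4 / 3 + (1 / 4 - y)⁻¹ - (((m : ℝ) + 1 / 2)⁻¹ + ((m : ℝ) + 3 / 2)⁻¹) / 2 ≤
        ∑ j ∈ Finset.range (m + 1), (((j : ℝ) + 1 / 2) ^ 2 - y)⁻¹ := by
      induction m with
      | zero => norm_num
      | succ m ih =>
        rw [Finset.sum_range_succ]
        have hm : (0 : ℝ) ≤ m := Nat.cast_nonneg m
        have e : ((((m + 1 : ℕ) : ℝ) + 1 / 2) ^ 2 - 1)⁻¹ =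
            (((m : ℝ) + 1 / 2)⁻¹ - ((m : ℝ) + 5 / 2)⁻¹) / 2 := by
          push_cast
          have : ((m : ℝ) + 1 + 1 / 2) ^ 2 - 1 = (m + 1 / 2) * (m + 5 / 2) := by ring
          rw [this]
          field_simp
          ring
        have e2 : ((((m + 1 : ℕ) : ℝ) + 1 / 2) ^ 2 - 1)⁻¹ ≤
            ((((m + 1 : ℕ) : ℝ) + 1 / 2) ^ 2 - y)⁻¹ := inv_anti₀ (hpos m) (by linarith)
        have e3 : (((m + 1 : ℕ) : ℝ) + 1 / 2) = m + 3 / 2 := by push_cast; ring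
        have e4 : (((m + 1 : ℕ) : ℝ) + 3 / 2) = m + 5 / 2 := by push_cast; ring
        rw [e3] at e e2 ⊢
        rw [e4]
        linarith
    have h3 : ((m : ℝ) + 3 / 2)⁻¹ ≤ ((m : ℝ) + 1 / 2)⁻¹ :=
      inv_anti₀ (by positivity) (by linarith)
    linarith
  have hδ : 0 < 4 / 3 + (1 / 4 - y)⁻¹ := by
    have : (y - 1 / 4)⁻¹ < (3 / 4)⁻¹ := inv_strictAnti₀ (by norm_num) (by linarith)
    rw [← neg_sub y, inv_neg]
    norm_num at this ⊢
    linarith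
  obtain ⟨m, hm⟩ := exists_nat_gt (4 / 3 + (1 / 4 - y)⁻¹)⁻¹
  refine ⟨m, ?_⟩
  rw [nodeDiff_self hne]
  refine mul_neg_of_neg_of_pos ?_ ?_
  · rw [nodeProd_succ']
    refine mul_neg_of_neg_of_pos hneg (Finset.prod_pos fun j _ => ?_)
    have := hpos j
    rwa [zero_add, add_comm 1 j]
  · refine lt_of_lt_of_le (sub_pos.2 ?_) (hsum m)
    exact inv_lt_of_inv_lt₀ hδ (by linarith)

/-- The set of parameters with nonnegative eigenvalues. -/
theorem forall_symbEigen_nonneg_iff {x₁ x₂ : ℝ} (h : x₂ ≤ x₁) (h₂ : 0 ≤ x₂) :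
    (∀ m k : ℕ, 0 ≤ (-1) ^ m * symbEigen (x₁ ^ 2) (x₂ ^ 2) m k) ↔
      x₁ ≤ 1 / 2 ∨ (1 / 2 ≤ x₂ ∧ x₁ + x₂ ≤ 2) := by
  simp only [neg_one_pow_mul_symbEigen]
  constructor
  · intro H
    -- These two cases say y₁ + y₂ ≤ 5/2 and (1/4 - y₁)(1/4 - y₂) ≥ 0.
    have h10 := H 1 0
    have h01 := H 0 1
    simp [nodeDiff, nodeProd] at h10 h01
    rw [or_iff_not_imp_left]
    intro hx
    push Not at hx
    have hx₂ : 1 / 2 ≤ x₂ := by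
      by_contra hlt
      push Not at hlt
      nlinarith [mul_pos (by nlinarith : 0 < x₁ ^ 2 - 1 / 4) (by nlinarith : 0 < 1 / 4 - x₂ ^ 2)]
    refine ⟨hx₂, ?_⟩
    by_contra hs
    push Not at hs
    have hx₁ : x₁ ≤ 3 / 2 := by nlinarith
    have : ∃ m : ℕ, nodeDiff (x₁ ^ 2) (x₂ ^ 2) 0 (m + 1) < 0 := by
      rcases h.lt_or_eq with h | rfl
      · exact exists_nodeDiff_neg_of_lt h hx₁ hs
      · exact exists_nodeDiff_self_neg (by nlinarith) (by nlinarith)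
    obtain ⟨m, hm⟩ := this
    have := H m 0
    simp [nodeProd] at this
    linarith
  · rintro (hx | ⟨hx₂, hs⟩) m k
    · have hk : (1 / 4 : ℝ) ≤ ((k : ℝ) + 1 / 2) ^ 2 := by
        nlinarith [(Nat.cast_nonneg k : (0 : ℝ) ≤ k)]
      exact mul_nonneg (mul_nonneg (nodeProd_nonneg (by norm_num; nlinarith))
        (nodeProd_nonneg (by norm_num; nlinarith))) (nodeDiff_nonneg (by nlinarith) (by nlinarith))
    · rcases k with _ | k
      · simpa [nodeProd] using nodeDiff_nonneg_of_le h hx₂ hs m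
      -- For positive second part, y₁, y₂ lie between the nodes 1/4 and 9/4: the two negative first
      -- factors multiply to a nonnegative number and all others are nonnegative.
      · have hk : (9 / 4 : ℝ) ≤ ((k + 1 : ℕ) + 1 / 2 : ℝ) ^ 2 := by
          push_cast
          nlinarith [(Nat.cast_nonneg k : (0 : ℝ) ≤ k)]
        refine mul_nonneg ?_ (nodeDiff_nonneg (by nlinarith) (by nlinarith))
        rw [nodeProd_succ', nodeProd_succ', mul_mul_mul_comm]
        refine mul_nonneg (mul_nonneg_of_nonpos_of_nonpos ?_ ?_) (mul_nonneg (nodeProd_nonneg ?_)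
          (nodeProd_nonneg ?_)) <;> norm_num <;> nlinarith

lemma symbEigen_ofReal (y₁ y₂ : ℝ) (m k : ℕ) :
    symbEigen (y₁ : ℂ) (y₂ : ℂ) m k = (symbEigen y₁ y₂ m k : ℝ) := by
  induction m using Nat.twoStepInduction generalizing k with
  | zero => simp [symbEigen]
  | one => simp [symbEigen]
  | more m ih1 ih2 => simp [symbEigen, ih1, ih2]

end
end Shimura

/-! ### The Shimura set in the Weyl chamber -/

theorem theorem5 :
    Shimura.shimuraSet₀ =
      ({x | ∀ i, x i ∈ Set.Icc 0 (Shimura.rho 1)} ∩ Shimura.chamber) ∪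
      {x | x 1 ≤ x 0 ∧ Shimura.rho 1 ≤ x 1 ∧
        x 0 + x 1 ≤ Shimura.rho 0 + Shimura.rho 1} := by
  have key : ∀ x ∈ Shimura.chamber, (fun i => (x i : ℂ)) ∈ Shimura.shimuraSet ↔
      ∀ m k : ℕ, 0 ≤ (-1) ^ m * Shimura.symbEigen (x 0 ^ 2) (x 1 ^ 2) m k := by
    intro x _
    -- For λ = (m + k, k) the sign of |λ| = m + 2k is that of m.
    have hpow : ∀ m k : ℕ, (-1 : ℝ) ^ (m + k + k) = (-1) ^ m := fun m k => by
      rw [add_assoc, pow_add, ← two_mul, pow_mul]; simp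
    constructor
    · intro hx m k
      obtain ⟨c, hc, h⟩ := Shimura.exists_isEigenvalue_iff (m + k, k)
      obtain ⟨d, hd, hdx⟩ := hx (m + k, k) (Nat.le_add_left k m)
      have e := (h _ _).1 hdx
      simp only [Nat.add_sub_cancel, ← Complex.ofReal_pow, Shimura.symbEigen_ofReal] at e
      have e' : d = c * ((-1) ^ (m + k + k) * Shimura.symbEigen (x 0 ^ 2) (x 1 ^ 2) m k) := by
        exact_mod_cast e
      rw [hpow] at e'
      rw [e'] at hd
      exact nonneg_of_mul_nonneg_right hd hc
    · rintro hx ⟨l₁, l₂⟩ hl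
      obtain ⟨m, rfl⟩ := Nat.exists_eq_add_of_le' (show l₂ ≤ l₁ from hl)
      obtain ⟨c, hc, h⟩ := Shimura.exists_isEigenvalue_iff (m + l₂, l₂)
      refine ⟨c * ((-1) ^ m * Shimura.symbEigen (x 0 ^ 2) (x 1 ^ 2) m l₂),
        mul_nonneg hc.le (hx m l₂), (h _ _).2 ?_⟩
      simp only [Nat.add_sub_cancel, ← Complex.ofReal_pow, Shimura.symbEigen_ofReal]
      rw [← hpow m l₂]
      push_cast
      rfl
  ext x
  constructor
  · rintro ⟨hc, hx⟩
    have hcc := hc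
    obtain ⟨h1, h2⟩ := hcc
    rcases (Shimura.forall_symbEigen_nonneg_iff h1 h2).1 ((key x hc).1 hx) with h | ⟨h, h'⟩
    · refine Or.inl ⟨fun i => ?_, hc⟩
      fin_cases i <;> simp [Shimura.rho] <;> constructor <;> linarith
    · refine Or.inr ⟨h1, ?_, ?_⟩ <;> norm_num [Shimura.rho] <;> linarith
  · rintro (⟨hx, hc⟩ | ⟨h1, h2, h3⟩)
    · obtain ⟨hc1, hc2⟩ := id hc
      have h0 := (hx 0).2
      simp only [Shimura.rho, Matrix.cons_val_one, Matrix.cons_val_fin_one] at h0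
      exact ⟨hc, (key x hc).2 ((Shimura.forall_symbEigen_nonneg_iff hc1 hc2).2 (Or.inl h0))⟩
    · norm_num [Shimura.rho] at h2 h3
      have hc : x ∈ Shimura.chamber := ⟨h1, by linarith⟩
      exact ⟨hc, (key x hc).2 ((Shimura.forall_symbEigen_nonneg_iff h1 hc.2).2
        (Or.inr ⟨by linarith, h3⟩))⟩
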